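/- Let $X$ be a smooth manifold of dimension $n$ (Hausdorff, second countable, without boundary, not necessarily compact) oriented by a smooth nowhere vanishing volume form $\Omega>0$, and let $(g_t)_{t\in J}$, $J\subset\mathbb R$ open, be a family of Riemannian metrics on $X$ depending smoothly on $(t,x)\in J\times X$; write $\dot g_t=\frac{d}{dt}g_t$ and $f_t:=\log\frac{dV_{g_t}}{\Omega}$. For a Riemannian metric $g$, with $\nabla_g$ its Levi-Civita connection, put $\mathrm{Ric}_g(\Omega):=\mathrm{Ric}(g)+\nabla_g\,d\log\frac{dV_g}{\Omega}$ (the $\Omega$-Bakry-Emery-Ricci tensor). For a covariant $p$-tensor $\alpha$ put $\nabla_g\alpha(\xi_0,\dots,\xi_p)=(\nabla_{g,\xi_0}\alpha)(\xi_1,\dots,\xi_p)$, $\hat\nabla_g\alpha(\xi_0,\dots,\xi_p)=\sum_{j=0}^p\nabla_g\alpha(\xi_j,\xi_0,\dots,\hat\xi_j,\dots,\xi_p)$ (which maps $C^\infty(S^pT^*_X)$ to $C^\infty(S^{p+1}T^*_X)$), $\mathcal D_g:=\hat\nabla_g-2\nabla_g$, and $\mathrm{div}_g\beta:=\mathrm{Tr}_g\nabla_g\beta(\cdot,\cdot,\xi_1,\dots,\xi_p)$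 for a $(p+1)$-tensor $\beta$, the trace being taken over the first two arguments. Let $\nabla_g^*$ be the formal adjoint of $\nabla_g:C^\infty((T^*_X)^{\otimes 2})\to C^\infty((T^*_X)^{\otimes 3})$ and $\hat\nabla_g^*$ the formal adjoint of $\hat\nabla_g:C^\infty(S^2T^*_X)\to C^\infty(S^3T^*_X)$, both with respect to $\int_X\langle\cdot,\cdot\rangle_g\,dV_g$ (tested against compactly supported sections), where $\langle\alpha,\beta\rangle_g=\sum g^{i_1j_1}\cdots g^{i_pj_p}\alpha_{i_1\dots i_p}\beta_{j_1\dots j_p}$. For $P=\nabla$ or $\hat\nabla$ put $P^{*_\Omega}_g\beta:=e^{f}P^*_g(e^{-f}\beta)$ with $f=\log\frac{dV_g}{\Omega}$. Then these formal adjoints exist for $g=g_t$, the tensor $\mathrm{Ric}_{g_t}(\Omega)$ is differentiable in $t$ at every point of $X$, and for all $t\in J$ $$2\,\frac{d}{dt}\mathrm{Ric}_{g_t}(\Omega)=e^{f_t}\,\mathrm{div}_{g_t}\bigl(e^{-f_t}\mathcal D_{g_t}\dot g_t\bigr)$$ and $$\frac{d}{dt}\mathrm{Ric}_{g_t}(\Omega)=\nabla_{g_t}^{*_\Omega}\nabla_{g_t}\dot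 g_t-\frac16\,\hat\nabla_{g_t}^{*_\Omega}\hat\nabla_{g_t}\dot g_t .$$ -/

import Mathlib

open scoped Manifold ContDiff

noncomputable section

/-- The model space `ℝⁿ` with its Euclidean structure (and Lebesgue measure). -/
abbrev Coord (n : ℕ) : Type := EuclideanSpace ℝ (Fin n)

/-- The `i`-th standard basis vector of `ℝⁿ`. -/
abbrev stdVec {n : ℕ} (i : Fin n) : Coord n := EuclideanSpace.single i 1

/-- (Not necessarily smooth) covariant `p`-tensor fields, i.e. sections of `(T*M)^{⊗p}`. -/
abbrev TensorField (n : ℕ) (M : Type*) [TopologicalSpace M] [ChartedSpace (Coord n) M]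
    (p : ℕ) : Type _ :=
  (x : M) → ContinuousMultilinearMap ℝ (fun _ : Fin p => TangentSpace (𝓡 n) x) ℝ

namespace BakryEmery

variable {n : ℕ} {M : Type*} [TopologicalSpace M] [ChartedSpace (Coord n) M] {p q : ℕ}

/-! ### Components in a chart -/

/-- The coordinate vector `∂/∂xᵢ` of the chart `e` at the point with coordinates `y`. -/
def coordVec (e : OpenPartialHomeomorph M (Coord n)) (y : Coord n) (i : Fin n) :
    TangentSpace (𝓡 n) (e.symm y) :=
  mfderiv (𝓡 n) (𝓡 n) e.symm y (stdVec i)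

/-- The component `α_{i₁ … i_p}` of a tensor field in the chart `e`, as a function of the
coordinates. -/
def tcomp (α : TensorField n M p) (e : OpenPartialHomeomorph M (Coord n)) (I : Fin p → Fin n)
    (y : Coord n) : ℝ :=
  α (e.symm y) (fun k => coordVec e y (I k))

/-- The differential at `x` of the preferred chart at `x`: it maps a tangent vector to the
vector of its components `(dx₁ ξ, …, dxₙ ξ)`. -/
def coordDiff (x : M) : TangentSpace (𝓡 n) x →L[ℝ] Coord n :=
  mfderiv (𝓡 n) (𝓡 n) (chartAt (Coord n) x) x

/-- The tensor `∑_I c_I dx_{i₁} ⊗ … ⊗ dx_{i_p}` at `x`, where `(xᵢ)` are the coordinates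
given by the preferred chart at `x`. -/
def ofComp (x : M) (c : (Fin p → Fin n) → ℝ) :
    ContinuousMultilinearMap ℝ (fun _ : Fin p => TangentSpace (𝓡 n) x) ℝ :=
  ∑ I : Fin p → Fin n, c I •
    (ContinuousMultilinearMap.mkPiAlgebra ℝ (Fin p) ℝ).compContinuousLinearMap
      (fun k => (EuclideanSpace.proj (I k) : Coord n →L[ℝ] ℝ).comp (coordDiff x))

theorem ofComp_apply (x : M) (c : (Fin p → Fin n) → ℝ) (ξ : Fin p → TangentSpace (𝓡 n) x) :
    ofComp x c ξ = ∑ I : Fin p → Fin n, c I * ∏ k, coordDiff x (ξ k) (I k) := by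
  simp only [ofComp, sum_apply]
  rfl

/-- The partial derivative `∂ᵢ h`. -/
def pderiv (i : Fin n) (h : Coord n → ℝ) (y : Coord n) : ℝ := fderiv ℝ h y (stdVec i)

/-! ### Smoothness, symmetry, metrics, volume forms -/

/-- Smooth tensor fields: all components in all charts are smooth. -/
def IsSmooth (α : TensorField n M p) : Prop :=
  ∀ e ∈ atlas (Coord n) M, ∀ I : Fin p → Fin n, ContDiffOn ℝ ∞ (tcomp α e I) e.target

/-- `C^∞((T*M)^{⊗p})`. -/
def smoothTensors (n : ℕ) (M : Type*) [TopologicalSpace M] [ChartedSpace (Coord n) M] (p : ℕ) :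
    Set (TensorField n M p) :=
  {α | IsSmooth α}

/-- `C^∞(S^p T*M)`. -/
def smoothSymmTensors (n : ℕ) (M : Type*) [TopologicalSpace M] [ChartedSpace (Coord n) M]
    (p : ℕ) : Set (TensorField n M p) :=
  {α | IsSmooth α ∧ ∀ (x : M) (v : Fin p → TangentSpace (𝓡 n) x) (σ : Equiv.Perm (Fin p)),
    α x (fun k => v (σ k)) = α x v}

/-- A one-parameter family of tensor fields, defined for `t ∈ J`, that is smooth in `(t, x)`. -/
def IsSmoothFamily (J : Set ℝ) (g : ℝ → TensorField n M p) : Prop :=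
  ∀ e ∈ atlas (Coord n) M, ∀ I : Fin p → Fin n,
    ContDiffOn ℝ ∞ (fun z : ℝ × Coord n => tcomp (g z.1) e I z.2) (J ×ˢ e.target)

/-- A smooth Riemannian metric. -/
structure IsRiemannian (g : TensorField n M 2) : Prop where
  smooth : IsSmooth g
  symm : ∀ (x : M) (ξ η : TangentSpace (𝓡 n) x), g x ![ξ, η] = g x ![η, ξ]
  pos : ∀ (x : M) (ξ : TangentSpace (𝓡 n) x), ξ ≠ 0 → 0 < g x ![ξ, ξ]

/-- A smooth volume form, i.e. a nowhere vanishing smooth form of top degree. -/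
structure VolumeForm (n : ℕ) (M : Type*) [TopologicalSpace M] [ChartedSpace (Coord n) M] where
  form : (x : M) → TangentSpace (𝓡 n) x [⋀^Fin n]→L[ℝ] ℝ
  smooth : ∀ e ∈ atlas (Coord n) M,
    ContDiffOn ℝ ∞ (fun y => form (e.symm y) (coordVec e y)) e.target
  ne_zero : ∀ x, form x ≠ 0

/-- The time derivative of a family of tensor fields. -/
def timeDeriv (g : ℝ → TensorField n M p) (t : ℝ) : TensorField n M p := fun x =>
  ofComp x fun I => deriv (fun s => tcomp (g s) (chartAt (Coord n) x) I (chartAt (Coord n) x x)) t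

/-- Multiplication of a tensor field by a function. -/
def fsmul (u : M → ℝ) (α : TensorField n M p) : TensorField n M p := fun x => u x • α x

/-! ### Levi-Civita connection and Ricci tensor -/

/-- The matrix `(g_{ij})` in the chart `e`. -/
def gram (g : TensorField n M 2) (e : OpenPartialHomeomorph M (Coord n)) (y : Coord n) :
    Matrix (Fin n) (Fin n) ℝ :=
  Matrix.of fun i j => tcomp g e ![i, j] y

/-- The Christoffel symbol `Γ^k_{ij}` of the Levi-Civita connection of `g`:
`∇_{∂ᵢ} ∂ⱼ = ∑ₖ Γ^k_{ij} ∂ₖ`. -/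
def christoffel (g : TensorField n M 2) (e : OpenPartialHomeomorph M (Coord n))
    (k i j : Fin n) (y : Coord n) : ℝ :=
  (1 / 2) * ∑ l, (gram g e y)⁻¹ k l *
    (pderiv i (tcomp g e ![j, l]) y + pderiv j (tcomp g e ![i, l]) y
      - pderiv l (tcomp g e ![i, j]) y)

/-- The components of `∇_g α`; the first index is the direction of differentiation. -/
def nablaComp (g : TensorField n M 2) (α : TensorField n M p)
    (e : OpenPartialHomeomorph M (Coord n)) (I : Fin (p + 1) → Fin n) (y : Coord n) : ℝ :=
  pderiv (I 0) (tcomp α e (Fin.tail I)) y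
    - ∑ a : Fin p, ∑ l, christoffel g e l (I 0) (I a.succ) y *
        tcomp α e (Function.update (Fin.tail I) a l) y

/-- The covariant derivative `∇_g α (ξ₀, …, ξ_p) = (∇_{g, ξ₀} α)(ξ₁, …, ξ_p)`. -/
def nabla (g : TensorField n M 2) (α : TensorField n M p) : TensorField n M (p + 1) := fun x =>
  ofComp x fun I => nablaComp g α (chartAt (Coord n) x) I (chartAt (Coord n) x x)

/-- The component `R^l_{ijk}` of the curvature tensor, `R(∂ᵢ, ∂ⱼ) ∂ₖ = ∑ₗ R^l_{ijk} ∂ₗ`, where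
`R(ξ, η) = ∇_ξ ∇_η - ∇_η ∇_ξ - ∇_{[ξ, η]}`. -/
def riemannComp (g : TensorField n M 2) (e : OpenPartialHomeomorph M (Coord n))
    (l i j k : Fin n) (y : Coord n) : ℝ :=
  pderiv i (christoffel g e l j k) y - pderiv j (christoffel g e l i k) y
    + ∑ m, (christoffel g e l i m y * christoffel g e m j k y
      - christoffel g e l j m y * christoffel g e m i k y)

/-- The Ricci tensor `Ric(g)(ξ, η) = Tr (R(·, ξ) η)`. -/
def ricci (g : TensorField n M 2) : TensorField n M 2 := fun x =>
  ofComp x fun I => ∑ l, riemannComp g (chartAt (Coord n) x) l l (I 0) (I 1) (chartAt (Coord n) x x)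

/-- The differential of a function, as a `1`-tensor field. -/
def differential (u : M → ℝ) : TensorField n M 1 := fun x =>
  ofComp x fun I => pderiv (I 0) (fun y => u ((chartAt (Coord n) x).symm y)) (chartAt (Coord n) x x)

/-- `dV_g / Ω`, where `dV_g` is the Riemannian volume form for the orientation given by `Ω`:
`dV_g (v₁, …, vₙ) = √ det (g(vᵢ, vⱼ))` if `Ω (v₁, …, vₙ) > 0`. Evaluated on the coordinate frame
of the preferred chart, up to the sign of one vector if that frame is negatively oriented. -/
def volRatio (Ω : VolumeForm n M) (g : TensorField n M 2) (x : M) : ℝ :=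
  √ (gram g (chartAt (Coord n) x) (chartAt (Coord n) x x)).det /
    |Ω.form ((chartAt (Coord n) x).symm (chartAt (Coord n) x x))
      (coordVec (chartAt (Coord n) x) (chartAt (Coord n) x x))|

/-- `f = log (dV_g / Ω)`. -/
def potential (Ω : VolumeForm n M) (g : TensorField n M 2) (x : M) : ℝ :=
  Real.log (volRatio Ω g x)

/-- The `Ω`-Bakry-Emery-Ricci tensor `Ric_g(Ω) = Ric(g) + ∇_g d log (dV_g / Ω)`. -/
def bakryEmeryRicci (Ω : VolumeForm n M) (g : TensorField n M 2) : TensorField n M 2 :=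
  ricci g + nabla g (differential (potential Ω g))

/-! ### The operators `∇̂`, `𝒟` and `div` -/

/-- The symmetrization
`∇̂_g α (ξ₀, …, ξ_p) = ∑ⱼ ∇_g α (ξⱼ, ξ₀, …, ξ_{j-1}, ξ_{j+1}, …, ξ_p)`. -/
def symNabla (g : TensorField n M 2) (α : TensorField n M p) : TensorField n M (p + 1) := fun x =>
  ∑ j : Fin (p + 1), (nabla g α x).domDomCongr j.cycleRange.symm

theorem symNabla_apply (g : TensorField n M 2) (α : TensorField n M p) (x : M)
    (ξ : Fin (p + 1) → TangentSpace (𝓡 n) x) :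
    symNabla g α x ξ =
      ∑ j : Fin (p + 1), nabla g α x (Fin.cons (ξ j) (fun k => ξ (j.succAbove k))) := by
  simp only [symNabla, sum_apply,
    ContinuousMultilinearMap.domDomCongr_apply]
  refine Finset.sum_congr rfl fun j _ => ?_
  congr 1
  funext k
  refine Fin.cases ?_ (fun k => ?_) k
  · simp
  · simp

/-- `𝒟_g = ∇̂_g - 2 ∇_g`. -/
def opD (g : TensorField n M 2) (α : TensorField n M p) : TensorField n M (p + 1) :=
  symNabla g α - (2 : ℝ) • nabla g α

/-- The `g`-trace of the first two arguments. -/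
def traceFirst (g : TensorField n M 2) (α : TensorField n M (p + 2)) : TensorField n M p :=
  fun x => ofComp x fun I =>
    ∑ k, ∑ l, (gram g (chartAt (Coord n) x) (chartAt (Coord n) x x))⁻¹ k l *
      tcomp α (chartAt (Coord n) x) (Fin.cons k (Fin.cons l I)) (chartAt (Coord n) x x)

/-- The divergence `div_g α = Tr_g ∇_g α (·, ·, ξ₁, …, ξ_p)`. -/
def divergence (g : TensorField n M 2) (α : TensorField n M (p + 1)) : TensorField n M p :=
  traceFirst g (nabla g α)

/-! ### Formal adjoints -/

/-- The scalar product `⟨α, β⟩_g = ∑ g^{i₁j₁} ⋯ g^{i_p j_p} α_{i₁ … i_p} β_{j₁ … j_p}`. -/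
def tensorInner (g : TensorField n M 2) (α β : TensorField n M p) (x : M) : ℝ :=
  ∑ I : Fin p → Fin n, ∑ K : Fin p → Fin n,
    (∏ a, (gram g (chartAt (Coord n) x) (chartAt (Coord n) x x))⁻¹ (I a) (K a)) *
      (tcomp α (chartAt (Coord n) x) I (chartAt (Coord n) x x) *
        tcomp β (chartAt (Coord n) x) K (chartAt (Coord n) x x))

/-- The Riemannian volume measure `dV_g`: the least measure on `M` that dominates, for every
chart, the measure `√ det (g_{ij}) dx` on the domain of that chart (and so restricts to it). -/
def volumeMeasure [MeasurableSpace M] (g : TensorField n M 2) : MeasureTheory.Measure M :=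
  ⨆ e ∈ atlas (Coord n) M, MeasureTheory.Measure.map e.symm
    ((MeasureTheory.volume.restrict e.target).withDensity
      (fun y => ENNReal.ofReal (√ (gram g e y).det)))

/-- `Q` is a formal adjoint with respect to `g` of the operator `P` from the sections `A` to the
sections `B`: it maps `B` to `A` and `∫ ⟨P α, β⟩_g dV_g = ∫ ⟨α, Q β⟩_g dV_g` for all `β ∈ B` and
all compactly supported `α ∈ A`. -/
def IsFormalAdjoint [MeasurableSpace M] (g : TensorField n M 2) (A : Set (TensorField n M p))
    (B : Set (TensorField n M q)) (P : TensorField n M p → TensorField n M q)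
    (Q : TensorField n M q → TensorField n M p) : Prop :=
  ∀ β ∈ B, Q β ∈ A ∧ ∀ α ∈ A, (∃ K : Set M, IsCompact K ∧ ∀ x ∉ K, α x = 0) →
    ∫ x, tensorInner g (P α) β x ∂(volumeMeasure g) =
      ∫ x, tensorInner g α (Q β) x ∂(volumeMeasure g)

/-- The formal adjoint `P*_g` of `P` (it is unique on the sections in `B`). -/
def formalAdjoint [MeasurableSpace M] (g : TensorField n M 2) (A : Set (TensorField n M p))
    (B : Set (TensorField n M q)) (P : TensorField n M p → TensorField n M q) :
    TensorField n M q → TensorField n M p :=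
  Classical.epsilon (h := ⟨fun _ => 0⟩) (IsFormalAdjoint g A B P)

/-- The formal adjoint `∇*_g` of `∇_g : C^∞((T*M)^{⊗p}) → C^∞((T*M)^{⊗(p+1)})`. -/
def nablaStar [MeasurableSpace M] (g : TensorField n M 2) :
    TensorField n M (p + 1) → TensorField n M p :=
  formalAdjoint g (smoothTensors n M p) (smoothTensors n M (p + 1)) (nabla g)

/-- The formal adjoint `∇̂*_g` of `∇̂_g : C^∞(S^p T*M) → C^∞(S^{p+1} T*M)`. -/
def symNablaStar [MeasurableSpace M] (g : TensorField n M 2) :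
    TensorField n M (p + 1) → TensorField n M p :=
  formalAdjoint g (smoothSymmTensors n M p) (smoothSymmTensors n M (p + 1)) (symNabla g)

/-- For `S = P*_g`, the operator `P^{*_Ω}_g = e^f P*_g (e^{-f} •)`, where `f = log (dV_g / Ω)`. -/
def weighted (Ω : VolumeForm n M) (g : TensorField n M 2)
    (S : TensorField n M q → TensorField n M p) (β : TensorField n M q) : TensorField n M p :=
  fsmul (fun x => Real.exp (potential Ω g x))
    (S (fsmul (fun x => Real.exp (-potential Ω g x)) β))

end BakryEmery

end

open BakryEmery

namespace BakryEmery

/-- Covariant `p`-tensors on the model space. -/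
abbrev ModelTensor (n p : ℕ) : Type := ContinuousMultilinearMap ℝ (fun _ : Fin p => Coord n) ℝ

/-- The tensor `dx_{i₁} ⊗ … ⊗ dx_{i_p}` on the model space. -/
noncomputable def stdTensor {n p : ℕ} (I : Fin p → Fin n) : ModelTensor n p :=
  (ContinuousMultilinearMap.mkPiAlgebra ℝ (Fin p) ℝ).compContinuousLinearMap
      (fun k => (EuclideanSpace.proj (I k) : Coord n →L[ℝ] ℝ))

theorem stdTensor_apply {n p : ℕ} (I : Fin p → Fin n) (v : Fin p → Coord n) :
    stdTensor I v = ∏ k, v k (I k) := rfl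

theorem sum_smul_stdVec {n : ℕ} (v : Coord n) : ∑ i, v i • (stdVec i : Coord n) = v := by
  have := (EuclideanSpace.basisFun (Fin n) ℝ).sum_repr v
  simpa using this

theorem ModelTensor.apply_eq_sum {n p : ℕ} (T : ModelTensor n p) (v : Fin p → Coord n) :
    T v = ∑ I : Fin p → Fin n, (∏ k, v k (I k)) * T (fun k => stdVec (I k)) := by
  conv_lhs => rw [show v = fun k => ∑ i, v k i • (stdVec i : Coord n) from
    funext fun k => (sum_smul_stdVec (v k)).symm]
  rw [T.map_sum]
  simp [T.map_smul_univ]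

theorem ModelTensor.ext_stdVec {n p : ℕ} {S T : ModelTensor n p}
    (h : ∀ I : Fin p → Fin n, S (fun k => stdVec (I k)) = T (fun k => stdVec (I k))) : S = T := by
  ext v
  rw [S.apply_eq_sum, T.apply_eq_sum]
  simp [h]

theorem ModelTensor.eq_sum {n p : ℕ} (T : ModelTensor n p) :
    T = ∑ I : Fin p → Fin n, T (fun k => stdVec (I k)) • stdTensor I := by
  ext v
  rw [T.apply_eq_sum]
  simp [stdTensor_apply, mul_comm]

theorem sum_smul_stdTensor_apply_stdVec {n p : ℕ} (c : (Fin p → Fin n) → ℝ) (I : Fin p → Fin n) :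
    (∑ K : Fin p → Fin n, c K • stdTensor K : ModelTensor n p) (fun k => stdVec (I k)) = c I := by
  classical
  simp only [sum_apply, smul_apply, stdTensor_apply,
    smul_eq_mul]
  rw [Finset.sum_eq_single I]
  · simp
  · intro K _ hK
    obtain ⟨k, hk⟩ := Function.ne_iff.1 hK
    rw [Finset.prod_eq_zero (Finset.mem_univ k), mul_zero]
    simp [hk]
  · simp

theorem eventually_mem_overlap {n : ℕ} {X : Type*} [TopologicalSpace X]
    {e e' : OpenPartialHomeomorph X (Coord n)} {y : Coord n} (hy : y ∈ e.target) (hy' : e.symm y ∈ e'.source) :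
    ∀ᶠ z in nhds y, z ∈ e.target ∧ e.symm z ∈ e'.source :=
  Filter.Eventually.and (e.open_target.mem_nhds hy)
    ((e.continuousAt_symm hy).eventually_mem (e'.open_source.mem_nhds hy'))

variable {n : ℕ} {M : Type*} [TopologicalSpace M] [ChartedSpace (Coord n) M] {p q : ℕ}

/-- The pullback of a tensor field to the model space by the inverse of a chart. -/
noncomputable def pull (α : TensorField n M p) (e : OpenPartialHomeomorph M (Coord n))
    (y : Coord n) : ModelTensor n p :=
  (α (e.symm y)).compContinuousLinearMap
    (fun _ => (mfderiv (𝓡 n) (𝓡 n) e.symm y : Coord n →L[ℝ] TangentSpace (𝓡 n) (e.symm y)))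

theorem pull_apply_stdVec (α : TensorField n M p) (e : OpenPartialHomeomorph M (Coord n))
    (I : Fin p → Fin n) (y : Coord n) : pull α e y (fun k => stdVec (I k)) = tcomp α e I y := rfl

theorem pull_eq_sum (α : TensorField n M p) (e : OpenPartialHomeomorph M (Coord n))
    (y : Coord n) : pull α e y = ∑ I : Fin p → Fin n, tcomp α e I y • stdTensor I :=
  (pull α e y).eq_sum

/-- The derivative of the change of charts from `e` to `e'`. -/
noncomputable def jac (e e' : OpenPartialHomeomorph M (Coord n)) (y : Coord n) :
    Coord n →L[ℝ] Coord n :=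
  fderiv ℝ (e' ∘ e.symm) y

variable {e e' : OpenPartialHomeomorph M (Coord n)}

section Charts
variable [IsManifold (𝓡 n) ∞ M]

theorem contDiffAt_change (he : e ∈ atlas (Coord n) M) (he' : e' ∈ atlas (Coord n) M)
    {y : Coord n} (hy : y ∈ e.target) (hy' : e.symm y ∈ e'.source) :
    ContDiffAt ℝ ∞ (e' ∘ e.symm) y := by
  have h1 : ContMDiffAt (𝓡 n) (𝓡 n) ∞ e.symm y :=
    contMDiffAt_symm_of_mem_maximalAtlas
      (IsManifold.subset_maximalAtlas he) hy
  have h2 : ContMDiffAt (𝓡 n) (𝓡 n) ∞ e' (e.symm y) :=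
    contMDiffAt_of_mem_maximalAtlas (IsManifold.subset_maximalAtlas he') hy'
  exact (h2.comp y h1).contDiffAt

theorem mdifferentiableAt_chart_symm (he : e ∈ atlas (Coord n) M) {y : Coord n}
    (hy : y ∈ e.target) : MDifferentiableAt (𝓡 n) (𝓡 n) e.symm y :=
  (contMDiffAt_symm_of_mem_maximalAtlas (I := 𝓡 n) (n := ∞)
      (IsManifold.subset_maximalAtlas he) hy).mdifferentiableAt (by simp)

theorem mdifferentiableAt_chart (he : e ∈ atlas (Coord n) M) {x : M}
    (hx : x ∈ e.source) : MDifferentiableAt (𝓡 n) (𝓡 n) e x :=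
  (contMDiffAt_of_mem_maximalAtlas (I := 𝓡 n) (n := ∞)
      (IsManifold.subset_maximalAtlas he) hx).mdifferentiableAt (by simp)

theorem mfderiv_symm_comp_jac (he : e ∈ atlas (Coord n) M) (he' : e' ∈ atlas (Coord n) M)
    {y : Coord n} (hy : y ∈ e.target) (hy' : e.symm y ∈ e'.source) (v : Coord n) :
    (mfderiv (𝓡 n) (𝓡 n) e'.symm (e' (e.symm y)) (jac e e' y v) : Coord n)
      = mfderiv (𝓡 n) (𝓡 n) e.symm y v := by
  have hev : (e'.symm ∘ (e' ∘ e.symm)) =ᶠ[nhds y] e.symm :=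
    (eventually_mem_overlap hy hy').mono fun z hz => e'.left_inv hz.2
  have h1 := (contDiffAt_change he he' hy hy').differentiableAt (by simp)
  have h2 : HasMFDerivAt (𝓡 n) (𝓡 n) (e' ∘ e.symm) y (jac e e' y) :=
    h1.hasFDerivAt.hasMFDerivAt
  have h3 : HasMFDerivAt (𝓡 n) (𝓡 n) e'.symm ((e' ∘ e.symm) y)
      (mfderiv (𝓡 n) (𝓡 n) e'.symm (e' (e.symm y))) :=
    (mdifferentiableAt_chart_symm he' (e'.map_source hy')).hasMFDerivAt
  have h4 := (h3.comp y h2).congr_of_eventuallyEq hev.symm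
  rw [h4.mfderiv]
  rfl

theorem pull_change (he : e ∈ atlas (Coord n) M) (he' : e' ∈ atlas (Coord n) M)
    (α : TensorField n M p) {y : Coord n} (hy : y ∈ e.target) (hy' : e.symm y ∈ e'.source) :
    pull α e y = (pull α e' (e' (e.symm y))).compContinuousLinearMap (fun _ => jac e e' y) := by
  ext v
  have key : ∀ x x' : M, x' = x → ∀ w : Fin p → Coord n,
      α x' (fun k => (w k : TangentSpace (𝓡 n) x')) = α x (fun k => (w k : TangentSpace (𝓡 n) x))
      := by
    rintro x x' rfl w; rfl
  have h := key (e.symm y) (e'.symm (e' (e.symm y))) (e'.left_inv hy')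
    (fun k => mfderiv (𝓡 n) (𝓡 n) e'.symm (e' (e.symm y)) (jac e e' y (v k)))
  have h2 : pull α e y v = α (e.symm y) (fun k => mfderiv (𝓡 n) (𝓡 n) e.symm y (v k)) := rfl
  rw [h2]
  refine Eq.trans ?_ h.symm
  congr 1
  funext k
  exact (mfderiv_symm_comp_jac he he' hy hy' (v k)).symm

theorem mfderiv_comp_mfderiv_symm (he : e ∈ atlas (Coord n) M) {x : M} (hx : x ∈ e.source)
    (v : Coord n) :
    (mfderiv (𝓡 n) (𝓡 n) e x (mfderiv (𝓡 n) (𝓡 n) e.symm (e x) v : Coord n) : Coord n) = v := by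
  have hev : (e ∘ e.symm) =ᶠ[nhds (e x)] id :=
    Filter.Eventually.mono (e.open_target.mem_nhds (e.map_source hx)) fun z hz => e.right_inv hz
  have h1 : HasMFDerivAt (𝓡 n) (𝓡 n) e.symm (e x) (mfderiv (𝓡 n) (𝓡 n) e.symm (e x)) :=
    (mdifferentiableAt_chart_symm he (e.map_source hx)).hasMFDerivAt
  have h2 : HasMFDerivAt (𝓡 n) (𝓡 n) e (e.symm (e x)) (mfderiv (𝓡 n) (𝓡 n) e (e.symm (e x))) :=
    (mdifferentiableAt_chart he (by rwa [e.left_inv hx])).hasMFDerivAt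
  have h3 := (h2.comp (e x) h1).congr_of_eventuallyEq hev.symm
  have h4 := hasMFDerivAt_unique h3 (hasMFDerivAt_id (e x))
  have key : ∀ x' : M, x' = x → ∀ w : Coord n,
      (mfderiv (𝓡 n) (𝓡 n) e x' w : Coord n) = mfderiv (𝓡 n) (𝓡 n) e x w := by
    rintro x' rfl w; rfl
  refine (key _ (e.left_inv hx) _).symm.trans ?_
  exact DFunLike.congr_fun h4 v

theorem mfderiv_symm_comp_mfderiv (he : e ∈ atlas (Coord n) M) {x : M} (hx : x ∈ e.source)
    (v : Coord n) :
    (mfderiv (𝓡 n) (𝓡 n) e.symm (e x) (mfderiv (𝓡 n) (𝓡 n) e x v : Coord n) : Coord n) = v := by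
  have hev : (e.symm ∘ e) =ᶠ[nhds x] id :=
    Filter.Eventually.mono (e.open_source.mem_nhds hx) fun z hz => e.left_inv hz
  have h1 : HasMFDerivAt (𝓡 n) (𝓡 n) e.symm (e x) (mfderiv (𝓡 n) (𝓡 n) e.symm (e x)) :=
    (mdifferentiableAt_chart_symm he (e.map_source hx)).hasMFDerivAt
  have h2 : HasMFDerivAt (𝓡 n) (𝓡 n) e x (mfderiv (𝓡 n) (𝓡 n) e x) :=
    (mdifferentiableAt_chart he hx).hasMFDerivAt
  have h3 := (h1.comp x h2).congr_of_eventuallyEq hev.symm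
  have h4 := hasMFDerivAt_unique h3 (hasMFDerivAt_id x)
  exact DFunLike.congr_fun h4 v

theorem apply_eq_pull (he : e ∈ atlas (Coord n) M) {x : M} (hx : x ∈ e.source)
    (α : TensorField n M p) (v : Fin p → TangentSpace (𝓡 n) x) :
    α x v = pull α e (e x) (fun k => (mfderiv (𝓡 n) (𝓡 n) e x (v k) : Coord n)) := by
  have key : ∀ x' : M, x' = x → ∀ w : Fin p → Coord n,
      α x' (fun k => (w k : TangentSpace (𝓡 n) x')) = α x (fun k => (w k : TangentSpace (𝓡 n) x))
      := by
    rintro x' rfl w; rfl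
  have h := key (e.symm (e x)) (e.left_inv hx)
    (fun k => mfderiv (𝓡 n) (𝓡 n) e.symm (e x) (mfderiv (𝓡 n) (𝓡 n) e x (v k) : Coord n))
  refine Eq.trans ?_ h.symm
  congr 1
  funext k
  exact (mfderiv_symm_comp_mfderiv he hx (v k)).symm

theorem apply_eq_of_pull_eq (he : e ∈ atlas (Coord n) M) {x : M} (hx : x ∈ e.source)
    {α β : TensorField n M p} (h : pull α e (e x) = pull β e (e x)) : α x = β x := by
  ext v
  rw [apply_eq_pull he hx, apply_eq_pull he hx, h]

theorem pull_ofComp {β : TensorField n M p} {x : M} {c : (Fin p → Fin n) → ℝ}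
    (h : β x = ofComp x c) :
    pull β (chartAt (Coord n) x) (chartAt (Coord n) x x) = ∑ I : Fin p → Fin n, c I • stdTensor I
    := by
  have hx := mem_chart_source (Coord n) x
  have he := chart_mem_atlas (Coord n) x
  ext v
  have h1 := apply_eq_pull he hx β (fun k => (mfderiv (𝓡 n) (𝓡 n) (chartAt (Coord n) x).symm
    (chartAt (Coord n) x x) (v k) : Coord n))
  have h2 : (fun k => (mfderiv (𝓡 n) (𝓡 n) (chartAt (Coord n) x) x
    (mfderiv (𝓡 n) (𝓡 n) (chartAt (Coord n) x).symm
    (chartAt (Coord n) x x) (v k) : Coord n) : Coord n)) = v :=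
    funext fun k => mfderiv_comp_mfderiv_symm he hx (v k)
  rw [h2] at h1
  rw [← h1, h]
  refine (ofComp_apply x c _).trans ?_
  simp only [sum_apply, smul_apply, stdTensor_apply, smul_eq_mul]
  refine Finset.sum_congr rfl fun I _ => ?_
  congr 1
  refine Finset.prod_congr rfl fun k _ => ?_
  exact congrArg (fun w : Coord n => w (I k)) (mfderiv_comp_mfderiv_symm he hx (v k))

/-- A family of tensors on the model space, one for each chart, that transforms as the
components of a tensor field. -/
def IsTensorial (C : OpenPartialHomeomorph M (Coord n) → Coord n → ModelTensor n p) : Prop :=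
  ∀ e ∈ atlas (Coord n) M, ∀ e' ∈ atlas (Coord n) M, ∀ y ∈ e.target, e.symm y ∈ e'.source →
    C e y = (C e' (e' (e.symm y))).compContinuousLinearMap (fun _ => jac e e' y)

theorem pull_eq_of_isTensorial {β : TensorField n M p}
    {C : OpenPartialHomeomorph M (Coord n) → Coord n → ModelTensor n p} (hC : IsTensorial C)
    (hβ : ∀ x, β x = ofComp x (fun I => C (chartAt (Coord n) x) (chartAt (Coord n) x x)
      (fun k => stdVec (I k))))
    (he : e ∈ atlas (Coord n) M) {y : Coord n} (hy : y ∈ e.target) :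
    pull β e y = C e y := by
  have he' := chart_mem_atlas (Coord n) (e.symm y)
  have hy' := mem_chart_source (Coord n) (e.symm y)
  rw [pull_change he he' β hy hy', hC e he _ he' y hy hy', pull_ofComp (hβ _),
    ← ModelTensor.eq_sum]

end Charts

theorem IsSmooth.contDiffOn_pull {α : TensorField n M p} (hα : IsSmooth α)
    (he : e ∈ atlas (Coord n) M) : ContDiffOn ℝ ∞ (pull α e) e.target := by
  rw [show pull α e = fun y => ∑ I : Fin p → Fin n, tcomp α e I y • stdTensor I from
    funext (pull_eq_sum α e)]
  exact ContDiffOn.sum fun I _ => (hα e he I).smul contDiffOn_const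

end BakryEmery

namespace BakryEmery

/-- A covariant 2-tensor as a bilinear form. -/
noncomputable def toBilin {n : ℕ} :
    ModelTensor n 2 →L[ℝ] (Coord n →L[ℝ] Coord n →L[ℝ] ℝ) :=
  (ContinuousLinearMap.compL ℝ (Coord n) (ModelTensor n 1) (Coord n →L[ℝ] ℝ)
    (continuousMultilinearCurryFin1 ℝ (Coord n) ℝ :
      ModelTensor n 1 →L[ℝ] (Coord n →L[ℝ] ℝ))).comp
    (continuousMultilinearCurryLeftEquiv ℝ (fun _ : Fin 2 => Coord n) ℝ :
      ModelTensor n 2 →L[ℝ] (Coord n →L[ℝ] ModelTensor n 1))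

theorem toBilin_apply {n : ℕ} (T : ModelTensor n 2) (v w : Coord n) :
    toBilin T v w = T ![v, w] := by
  change T (Fin.cons v (Fin.snoc 0 w)) = T ![v, w]
  congr 1
  funext i
  fin_cases i <;> rfl

theorem eq_zero_of_stdVec {n : ℕ} {F : Type*} [AddCommGroup F] [Module ℝ F]
    (f : Coord n →ₗ[ℝ] F) (h : ∀ i, f (stdVec i) = 0) (v : Coord n) : f v = 0 := by
  rw [← sum_smul_stdVec v, map_sum]
  simp [h]

variable {n : ℕ} {M : Type*} [TopologicalSpace M] [ChartedSpace (Coord n) M] {p q : ℕ}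
  {e e' : OpenPartialHomeomorph M (Coord n)} {g : TensorField n M 2}

theorem gram_apply (y : Coord n) (i j : Fin n) :
    gram g e y i j = toBilin (pull g e y) (stdVec i) (stdVec j) := by
  rw [toBilin_apply]
  change pull g e y (fun k => stdVec (![i, j] k)) = _
  congr 1
  funext k
  fin_cases k <;> rfl

theorem toBilin_eq_sum (y : Coord n) (v w : Coord n) :
    toBilin (pull g e y) v w = ∑ i, ∑ j, v i * gram g e y i j * w j := by
  conv_lhs => rw [← sum_smul_stdVec v, ← sum_smul_stdVec w]
  simp only [map_sum, sum_apply, map_smul, smul_apply, smul_eq_mul, ← gram_apply]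
  simp only [Finset.mul_sum]
  rw [Finset.sum_comm]
  refine Finset.sum_congr rfl fun i _ => Finset.sum_congr rfl fun j _ => ?_
  ring

theorem IsRiemannian.toBilin_symm (hg : IsRiemannian g) (y v w : Coord n) :
    toBilin (pull g e y) v w = toBilin (pull g e y) w v := by
  rw [toBilin_apply, toBilin_apply]
  refine Eq.trans (Eq.trans ?_ (hg.symm (e.symm y) (mfderiv (𝓡 n) (𝓡 n) e.symm y v)
    (mfderiv (𝓡 n) (𝓡 n) e.symm y w))) ?_
  · change g _ _ = g _ _
    congr 1
    funext k
    fin_cases k <;> rfl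
  · change g _ _ = g _ _
    congr 1
    funext k
    fin_cases k <;> rfl

theorem IsRiemannian.gram_symm (hg : IsRiemannian g) (y : Coord n) (i j : Fin n) :
    gram g e y i j = gram g e y j i := by
  rw [gram_apply, gram_apply, hg.toBilin_symm]

theorem IsRiemannian.gram_inv_symm (hg : IsRiemannian g) (y : Coord n) (i j : Fin n) :
    (gram g e y)⁻¹ i j = (gram g e y)⁻¹ j i := by
  have h : (gram g e y).transpose = gram g e y := by
    ext i j; exact hg.gram_symm y j i
  calc (gram g e y)⁻¹ i j = ((gram g e y).transpose)⁻¹ i j := by rw [h]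
    _ = _ := by rw [← Matrix.transpose_nonsing_inv]; rfl

theorem IsSmooth.differentiableAt_pull {α : TensorField n M p} (hα : IsSmooth α)
    (he : e ∈ atlas (Coord n) M) {y : Coord n} (hy : y ∈ e.target) :
    DifferentiableAt ℝ (pull α e) y :=
  ((hα.contDiffOn_pull he).contDiffAt (e.open_target.mem_nhds hy)).differentiableAt (by simp)

theorem IsSmooth.pderiv_tcomp {α : TensorField n M p} (hα : IsSmooth α)
    (he : e ∈ atlas (Coord n) M) {y : Coord n} (hy : y ∈ e.target) (i : Fin n)
    (I : Fin p → Fin n) :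
    pderiv i (tcomp α e I) y = fderiv ℝ (pull α e) y (stdVec i) (fun k => stdVec (I k)) := by
  have h1 := (hα.differentiableAt_pull he hy).hasFDerivAt
  have h2 := ((ContinuousMultilinearMap.apply ℝ (fun _ : Fin p => Coord n) ℝ
    (fun k => stdVec (I k))).hasFDerivAt (x := pull α e y)).comp y h1
  have h3 : fderiv ℝ (tcomp α e I) y = _ := h2.fderiv
  rw [pderiv, h3]
  rfl

theorem IsSmooth.pderiv_tcomp_two {g : TensorField n M 2} (hα : IsSmooth g)
    (he : e ∈ atlas (Coord n) M) {y : Coord n} (hy : y ∈ e.target) (i j l : Fin n) :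
    pderiv i (tcomp g e ![j, l]) y =
      toBilin (fderiv ℝ (pull g e) y (stdVec i)) (stdVec j) (stdVec l) := by
  rw [hα.pderiv_tcomp he hy, toBilin_apply]
  congr 1
  funext k
  fin_cases k <;> rfl

/-- The Christoffel symbols as a bilinear map. -/
noncomputable def connForm (g : TensorField n M 2) (e : OpenPartialHomeomorph M (Coord n))
    (y : Coord n) : Coord n →L[ℝ] Coord n →L[ℝ] Coord n :=
  ∑ i : Fin n, ∑ j : Fin n, ∑ k : Fin n, christoffel g e k i j y •
    (EuclideanSpace.proj i : Coord n →L[ℝ] ℝ).smulRight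
      ((EuclideanSpace.proj j : Coord n →L[ℝ] ℝ).smulRight (stdVec k : Coord n))

theorem connForm_stdVec (y : Coord n) (i j : Fin n) :
    connForm g e y (stdVec i) (stdVec j) = ∑ k, christoffel g e k i j y • (stdVec k : Coord n) := by
  simp only [connForm, sum_apply, smul_apply, ContinuousLinearMap.smulRight_apply,
    PiLp.proj_apply, PiLp.single_apply]
  rw [Finset.sum_eq_single i (fun a _ ha => by simp [ha]) (by simp)]
  rw [Finset.sum_eq_single j (fun a _ ha => by simp [ha]) (by simp)]
  simp

/-- The derivation action of endomorphisms on tensors, in the `a`-th argument. -/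
noncomputable def substAt (T : ModelTensor n p) (a : Fin p) :
    (Coord n →L[ℝ] Coord n) →L[ℝ] ModelTensor n p :=
  ((ContinuousMultilinearMap.compContinuousLinearMapContinuousMultilinear ℝ
      (fun _ : Fin p => Coord n) (fun _ : Fin p => Coord n) ℝ).toContinuousLinearMap
    (fun _ => ContinuousLinearMap.id ℝ (Coord n)) a).flip T

theorem substAt_apply (T : ModelTensor n p) (a : Fin p) (L : Coord n →L[ℝ] Coord n)
    (v : Fin p → Coord n) : substAt T a L v = T (Function.update v a (L (v a))) := by
  change T (fun k => (Function.update (fun _ => ContinuousLinearMap.id ℝ (Coord n)) a L k) (v k))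
    = _
  congr 1
  funext k
  by_cases h : k = a
  · subst h; simp
  · simp [h]

variable [IsManifold (𝓡 n) ∞ M]

theorem IsRiemannian.toBilin_pos (hg : IsRiemannian g) (he : e ∈ atlas (Coord n) M)
    {y : Coord n} (hy : y ∈ e.target) {v : Coord n} (hv : v ≠ 0) :
    0 < toBilin (pull g e y) v v := by
  rw [toBilin_apply]
  have h := hg.pos (e.symm y) (mfderiv (𝓡 n) (𝓡 n) e.symm y v) (fun h0 => hv ?_)
  · refine h.trans_eq ?_
    change g _ _ = g _ _
    congr 1
    funext k
    fin_cases k <;> rfl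
  · have h1 := mfderiv_comp_mfderiv_symm he (e.map_target hy) v
    rw [e.right_inv hy] at h1
    rw [← h1]
    refine Eq.trans (congrArg _ h0) (map_zero _)

theorem IsRiemannian.posDef_gram (hg : IsRiemannian g) (he : e ∈ atlas (Coord n) M)
    {y : Coord n} (hy : y ∈ e.target) : (gram g e y).PosDef := by
  refine Matrix.PosDef.of_dotProduct_mulVec_pos ?_ ?_
  · ext i j
    simp [hg.gram_symm y i j]
  · intro v hv
    have h := hg.toBilin_pos he hy (v := WithLp.toLp 2 v) (fun h0 => hv (by simpa using h0))
    rw [toBilin_eq_sum] at h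
    refine h.trans_eq ?_
    simp only [star_trivial, dotProduct, Matrix.mulVec, Finset.mul_sum, mul_assoc]

theorem IsRiemannian.det_gram_pos (hg : IsRiemannian g) (he : e ∈ atlas (Coord n) M)
    {y : Coord n} (hy : y ∈ e.target) : 0 < (gram g e y).det :=
  (hg.posDef_gram he hy).det_pos

theorem IsRiemannian.gram_inv_mul (hg : IsRiemannian g) (he : e ∈ atlas (Coord n) M)
    {y : Coord n} (hy : y ∈ e.target) : (gram g e y)⁻¹ * gram g e y = 1 :=
  Matrix.nonsing_inv_mul _ (hg.det_gram_pos he hy).ne'.isUnit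

theorem IsRiemannian.gram_mul_inv (hg : IsRiemannian g) (he : e ∈ atlas (Coord n) M)
    {y : Coord n} (hy : y ∈ e.target) : gram g e y * (gram g e y)⁻¹ = 1 :=
  Matrix.mul_nonsing_inv _ (hg.det_gram_pos he hy).ne'.isUnit

theorem IsRiemannian.sum_gram_mul_christoffel (hg : IsRiemannian g) (he : e ∈ atlas (Coord n) M)
    {y : Coord n} (hy : y ∈ e.target) (i j l : Fin n) :
    2 * ∑ k, gram g e y l k * christoffel g e k i j y =
      pderiv i (tcomp g e ![j, l]) y + pderiv j (tcomp g e ![i, l]) y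
      - pderiv l (tcomp g e ![i, j]) y := by
  simp only [christoffel]
  set X : Fin n → ℝ := fun l => pderiv i (tcomp g e ![j, l]) y + pderiv j (tcomp g e ![i, l]) y
      - pderiv l (tcomp g e ![i, j]) y with hX
  have h1 : Matrix.mulVec (gram g e y) (Matrix.mulVec (gram g e y)⁻¹ X) = X := by
    rw [Matrix.mulVec_mulVec, hg.gram_mul_inv he hy, Matrix.one_mulVec]
  have h2 := congrFun h1 l
  change _ = X l
  rw [← h2]
  simp only [Matrix.mulVec, dotProduct, Finset.mul_sum]
  refine Finset.sum_congr rfl fun k _ => Finset.sum_congr rfl fun m _ => ?_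
  ring

theorem IsRiemannian.koszul (hg : IsRiemannian g) (he : e ∈ atlas (Coord n) M)
    {y : Coord n} (hy : y ∈ e.target) (v w u : Coord n) :
    2 * toBilin (pull g e y) (connForm g e y v w) u =
      toBilin (fderiv ℝ (pull g e) y v) w u + toBilin (fderiv ℝ (pull g e) y w) v u
        - toBilin (fderiv ℝ (pull g e) y u) v w := by
  have main : ∀ i j l : Fin n, 2 * toBilin (pull g e y) (connForm g e y (stdVec i) (stdVec j))
      (stdVec l) = toBilin (fderiv ℝ (pull g e) y (stdVec i)) (stdVec j) (stdVec l)
        + toBilin (fderiv ℝ (pull g e) y (stdVec j)) (stdVec i) (stdVec l)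
        - toBilin (fderiv ℝ (pull g e) y (stdVec l)) (stdVec i) (stdVec j) := by
    intro i j l
    rw [connForm_stdVec]
    simp only [← hg.smooth.pderiv_tcomp_two he hy]
    rw [← hg.sum_gram_mul_christoffel he hy]
    simp only [map_sum, map_smul, sum_apply, smul_apply, smul_eq_mul, ← gram_apply]
    congr 1
    refine Finset.sum_congr rfl fun k _ => ?_
    rw [hg.gram_symm y l k, mul_comm]
  have L1 : ∀ j l : Fin n, ∀ v, 2 * toBilin (pull g e y) (connForm g e y v (stdVec j))
      (stdVec l) - (toBilin (fderiv ℝ (pull g e) y v) (stdVec j) (stdVec l)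
        + toBilin (fderiv ℝ (pull g e) y (stdVec j)) v (stdVec l)
        - toBilin (fderiv ℝ (pull g e) y (stdVec l)) v (stdVec j)) = 0 := fun j l =>
    eq_zero_of_stdVec
      { toFun := fun v => 2 * toBilin (pull g e y) (connForm g e y v (stdVec j))
          (stdVec l) - (toBilin (fderiv ℝ (pull g e) y v) (stdVec j) (stdVec l)
          + toBilin (fderiv ℝ (pull g e) y (stdVec j)) v (stdVec l)
          - toBilin (fderiv ℝ (pull g e) y (stdVec l)) v (stdVec j))
        map_add' := fun a b => by simp only [map_add, add_apply]; ring
        map_smul' := fun a b => by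
          simp only [map_smul, smul_apply, smul_eq_mul, RingHom.id_apply]; ring }
      (fun i => sub_eq_zero.2 (main i j l))
  have L2 : ∀ l : Fin n, ∀ w, 2 * toBilin (pull g e y) (connForm g e y v w)
      (stdVec l) - (toBilin (fderiv ℝ (pull g e) y v) w (stdVec l)
        + toBilin (fderiv ℝ (pull g e) y w) v (stdVec l)
        - toBilin (fderiv ℝ (pull g e) y (stdVec l)) v w) = 0 := fun l =>
    eq_zero_of_stdVec
      { toFun := fun w => 2 * toBilin (pull g e y) (connForm g e y v w)
          (stdVec l) - (toBilin (fderiv ℝ (pull g e) y v) w (stdVec l)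
          + toBilin (fderiv ℝ (pull g e) y w) v (stdVec l)
          - toBilin (fderiv ℝ (pull g e) y (stdVec l)) v w)
        map_add' := fun a b => by simp only [map_add, add_apply]; ring
        map_smul' := fun a b => by
          simp only [map_smul, smul_apply, smul_eq_mul, RingHom.id_apply]; ring }
      (fun j => L1 j l v)
  refine sub_eq_zero.1 (eq_zero_of_stdVec
      { toFun := fun u => 2 * toBilin (pull g e y) (connForm g e y v w) u -
          (toBilin (fderiv ℝ (pull g e) y v) w u + toBilin (fderiv ℝ (pull g e) y w) v u
          - toBilin (fderiv ℝ (pull g e) y u) v w)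
        map_add' := fun a b => by simp only [map_add, add_apply]; ring
        map_smul' := fun a b => by
          simp only [map_smul, smul_apply, smul_eq_mul, RingHom.id_apply]; ring }
      (fun l => L2 l w) u)

end BakryEmery

namespace BakryEmery

variable {n : ℕ} {M : Type*} [TopologicalSpace M] [ChartedSpace (Coord n) M] {p q : ℕ}
  {e e' : OpenPartialHomeomorph M (Coord n)} {g : TensorField n M 2}

/-- The components of `∇_g α` in a chart, as a tensor on the model space. -/
noncomputable def nablaTensor (g : TensorField n M 2) (α : TensorField n M p)
    (e : OpenPartialHomeomorph M (Coord n)) (y : Coord n) : ModelTensor n (p + 1) :=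
  (fderiv ℝ (pull α e) y
    - ∑ a, (substAt (pull α e y) a).comp (connForm g e y)).uncurryLeft

theorem nablaTensor_apply (α : TensorField n M p) (y : Coord n) (v : Fin (p + 1) → Coord n) :
    nablaTensor g α e y v = fderiv ℝ (pull α e) y (v 0) (Fin.tail v)
      - ∑ a : Fin p, pull α e y
          (Function.update (Fin.tail v) a (connForm g e y (v 0) (v a.succ))) := by
  simp only [nablaTensor, ContinuousLinearMap.uncurryLeft_apply, sub_apply,
    sum_apply, ContinuousLinearMap.comp_apply, substAt_apply]
  rfl

theorem nablaTensor_apply_stdVec {α : TensorField n M p} (hα : IsSmooth α)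
    (he : e ∈ atlas (Coord n) M) {y : Coord n} (hy : y ∈ e.target) (I : Fin (p + 1) → Fin n) :
    nablaTensor g α e y (fun k => stdVec (I k)) = nablaComp g α e I y := by
  rw [nablaTensor_apply, nablaComp, hα.pderiv_tcomp he hy]
  congr 1
  refine Finset.sum_congr rfl fun a _ => ?_
  rw [connForm_stdVec]
  refine ((pull α e y).toMultilinearMap.map_update_sum _ _ _ _).trans ?_
  refine Finset.sum_congr rfl fun l _ => ?_
  refine ((pull α e y).map_update_smul _ _ _ _).trans ?_
  rw [smul_eq_mul, ← pull_apply_stdVec]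
  congr 2
  funext k
  by_cases h : k = a
  · subst h; simp
  · simp [h, Fin.tail]

variable [IsManifold (𝓡 n) ∞ M]

theorem fderiv_pull_change (he : e ∈ atlas (Coord n) M) (he' : e' ∈ atlas (Coord n) M)
    {α : TensorField n M p} (hα : IsSmooth α) {y : Coord n} (hy : y ∈ e.target)
    (hy' : e.symm y ∈ e'.source) (v : Coord n) (w : Fin p → Coord n) :
    fderiv ℝ (pull α e) y v w =
      fderiv ℝ (pull α e') (e' (e.symm y)) (jac e e' y v) (fun k => jac e e' y (w k))
      + ∑ a, pull α e' (e' (e.symm y)) (Function.update (fun k => jac e e' y (w k)) a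
          (fderiv ℝ (jac e e') y v (w a))) := by
  have hev : pull α e =ᶠ[nhds y] fun z => ((pull α e' ∘ (e' ∘ e.symm)) z).compContinuousLinearMap
      (fun _ => jac e e' z) :=
    (eventually_mem_overlap hy hy').mono fun z hz => pull_change he he' α hz.1 hz.2
  have hφ := contDiffAt_change he he' hy hy'
  have hj : DifferentiableAt ℝ (jac e e') y :=
    (hφ.fderiv_right (m := 1) (by norm_cast)).differentiableAt (by simp)
  have hp : HasFDerivAt (pull α e' ∘ (e' ∘ e.symm)) _ y :=
    (hα.differentiableAt_pull he' (e'.map_source hy')).hasFDerivAt.comp y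
      (hφ.differentiableAt (by simp)).hasFDerivAt
  have hd := hp.continuousMultilinearMapCompContinuousLinearMap
    (g := fun (_ : Fin p) => jac e e') (fun _ => hj.hasFDerivAt)
  rw [(hd.congr_of_eventuallyEq hev).fderiv]
  simp only [add_apply, ContinuousLinearMap.comp_apply,
    ContinuousMultilinearMap.fderivCompContinuousLinearMap_apply]
  congr 1
  refine Finset.sum_congr rfl fun a _ => ?_
  refine congrArg (pull α e' _) ?_
  funext k
  by_cases h : k = a
  · subst h; simp
  · simp [h]

theorem fderiv_jac_symm (he : e ∈ atlas (Coord n) M) (he' : e' ∈ atlas (Coord n) M)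
    {y : Coord n} (hy : y ∈ e.target) (hy' : e.symm y ∈ e'.source) (v w : Coord n) :
    fderiv ℝ (jac e e') y v w = fderiv ℝ (jac e e') y w v := by
  have h := (contDiffAt_change he he' hy hy').isSymmSndFDerivAt
    (by simp only [minSmoothness_of_isRCLikeNormedField]; norm_cast)
  exact h v w

theorem jac_symm_jac (he : e ∈ atlas (Coord n) M) (he' : e' ∈ atlas (Coord n) M)
    {y : Coord n} (hy : y ∈ e.target) (hy' : e.symm y ∈ e'.source) (v : Coord n) :
    jac e' e (e' (e.symm y)) (jac e e' y v) = v := by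
  have hb : e'.symm (e' (e.symm y)) = e.symm y := e'.left_inv hy'
  have h1 := ((contDiffAt_change he he' hy hy').differentiableAt (by simp)).hasFDerivAt
  have h2 := ((contDiffAt_change he' he (e'.map_source hy')
    (by rw [hb]; exact e.map_target hy)).differentiableAt (by simp)).hasFDerivAt
  have h3 := HasFDerivAt.comp y h2 h1
  have hev : (e ∘ e'.symm) ∘ (e' ∘ e.symm) =ᶠ[nhds y] id :=
    (eventually_mem_overlap hy hy').mono fun z hz => by
      simp [e'.left_inv hz.2, e.right_inv hz.1]
  exact DFunLike.congr_fun ((h3.congr_of_eventuallyEq hev.symm).unique (hasFDerivAt_id y)) v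

theorem jac_jac_symm (he : e ∈ atlas (Coord n) M) (he' : e' ∈ atlas (Coord n) M)
    {y : Coord n} (hy : y ∈ e.target) (hy' : e.symm y ∈ e'.source) (v : Coord n) :
    jac e e' y (jac e' e (e' (e.symm y)) v) = v := by
  have hb : e'.symm (e' (e.symm y)) = e.symm y := e'.left_inv hy'
  have h := jac_symm_jac he' he (e'.map_source hy') (by rw [hb]; exact e.map_target hy) v
  rwa [hb, e.right_inv hy] at h

theorem connForm_change (hg : IsRiemannian g) (he : e ∈ atlas (Coord n) M)
    (he' : e' ∈ atlas (Coord n) M) {y : Coord n} (hy : y ∈ e.target)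
    (hy' : e.symm y ∈ e'.source) (v w : Coord n) :
    jac e e' y (connForm g e y v w) = connForm g e' (e' (e.symm y)) (jac e e' y v) (jac e e' y w)
      + fderiv ℝ (jac e e') y v w := by
  set A := jac e e' y
  set D := fderiv ℝ (jac e e') y
  have hA : ∀ a b, toBilin (pull g e y) a b = toBilin (pull g e' (e' (e.symm y))) (A a) (A b) := by
    intro a b
    rw [toBilin_apply, toBilin_apply, pull_change he he' g hy hy',
      ContinuousMultilinearMap.compContinuousLinearMap_apply]
    congr 1
    funext k
    fin_cases k <;> rfl
  have hD : ∀ a b c, toBilin (fderiv ℝ (pull g e) y a) b c =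
      toBilin (fderiv ℝ (pull g e') (e' (e.symm y)) (A a)) (A b) (A c)
        + toBilin (pull g e' (e' (e.symm y))) (D a b) (A c)
        + toBilin (pull g e' (e' (e.symm y))) (A b) (D a c) := by
    intro a b c
    simp only [toBilin_apply]
    rw [fderiv_pull_change he he' hg.smooth hy hy', Fin.sum_univ_two, add_assoc]
    congr 2
    · funext k
      fin_cases k <;> rfl
    · congr 1
      funext k
      fin_cases k <;> rfl
    · congr 1
      funext k
      fin_cases k <;> rfl
  have hyt := e'.map_source hy'
  have hsymm := hg.toBilin_symm (e := e') (e' (e.symm y))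
  have key : ∀ u, toBilin (pull g e' (e' (e.symm y)))
      (A (connForm g e y v w) - (connForm g e' (e' (e.symm y)) (A v) (A w) + D v w)) (A u) = 0 := by
    intro u
    have k1 := hg.koszul he hy v w u
    have k2 := hg.koszul he' hyt (A v) (A w) (A u)
    rw [hA, hD, hD, hD] at k1
    have s1 := fderiv_jac_symm he he' hy hy' w v
    have s2 := fderiv_jac_symm he he' hy hy' u v
    have s3 := fderiv_jac_symm he he' hy hy' u w
    rw [map_sub, map_add, sub_apply, add_apply]
    rw [show D w v = D v w from s1, show D u v = D v u from s2, show D u w = D w u from s3,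
      hsymm (A v) (D w u), hsymm (A w) (D v u)] at k1
    linarith [hsymm (A w) (D v u), hsymm (A v) (D w u)]
  by_contra hne
  refine (hg.toBilin_pos he' hyt (sub_ne_zero.2 hne)).ne' ?_
  have := key (jac e' e (e' (e.symm y))
    (A (connForm g e y v w) - (connForm g e' (e' (e.symm y)) (A v) (A w) + D v w)))
  rwa [jac_jac_symm he he' hy hy'] at this

theorem isTensorial_nablaTensor (hg : IsRiemannian g) {α : TensorField n M p} (hα : IsSmooth α) :
    IsTensorial (nablaTensor g α) := by
  intro e he e' he' y hy hy'
  ext v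
  rw [ContinuousMultilinearMap.compContinuousLinearMap_apply, nablaTensor_apply,
    nablaTensor_apply, fderiv_pull_change he he' hα hy hy', add_sub_assoc, sub_eq_add_neg]
  congr 1
  rw [← sub_eq_add_neg, ← Finset.sum_sub_distrib, ← Finset.sum_neg_distrib]
  refine Finset.sum_congr rfl fun a _ => ?_
  rw [pull_change he he' α hy hy', ContinuousMultilinearMap.compContinuousLinearMap_apply]
  have h1 : (fun k => jac e e' y (Function.update (Fin.tail v) a (connForm g e y (v 0) (v a.succ)) k))
      = Function.update (fun k => jac e e' y (Fin.tail v k)) a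
        (connForm g e' (e' (e.symm y)) (jac e e' y (v 0)) (jac e e' y (v a.succ))
          + fderiv ℝ (jac e e') y (v 0) (v a.succ)) := by
    rw [← connForm_change hg he he' hy hy']
    funext k
    by_cases h : k = a
    · subst h; simp
    · simp [h]
  rw [h1, (pull α e' _).map_update_add]
  simp only [Fin.tail]
  ring_nf
  rfl

theorem pull_nabla (hg : IsRiemannian g) {α : TensorField n M p} (hα : IsSmooth α)
    (he : e ∈ atlas (Coord n) M) {y : Coord n} (hy : y ∈ e.target) :
    pull (nabla g α) e y = nablaTensor g α e y := by
  refine pull_eq_of_isTensorial (isTensorial_nablaTensor hg hα) (fun x => ?_) he hy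
  rw [nabla]
  congr 1
  funext I
  rw [nablaTensor_apply_stdVec hα (chart_mem_atlas _ _) (mem_chart_target _ _)]

theorem tcomp_nabla (hg : IsRiemannian g) {α : TensorField n M p} (hα : IsSmooth α)
    (he : e ∈ atlas (Coord n) M) {y : Coord n} (hy : y ∈ e.target) (I : Fin (p + 1) → Fin n) :
    tcomp (nabla g α) e I y = nablaComp g α e I y := by
  rw [← pull_apply_stdVec, pull_nabla hg hα he hy, nablaTensor_apply_stdVec hα he hy]

end BakryEmery

namespace BakryEmery

section Jacobian
variable {n : ℕ} {X : Type*} [TopologicalSpace X] {e e' : OpenPartialHomeomorph X (Coord n)}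

/-- The Jacobian matrix of the change of charts from `e` to `e'`. -/
noncomputable def jacMat (e e' : OpenPartialHomeomorph X (Coord n)) (y : Coord n) :
    Matrix (Fin n) (Fin n) ℝ :=
  Matrix.of fun a i => jac e e' y (stdVec i) a

theorem jacMat_apply (y : Coord n) (a i : Fin n) :
    jacMat e e' y a i = jac e e' y (stdVec i) a := rfl

theorem det_jacMat (y : Coord n) : (jacMat e e' y).det = (jac e e' y).det := by
  rw [ContinuousLinearMap.det, ← LinearMap.det_toMatrix (EuclideanSpace.basisFun (Fin n) ℝ).toBasis]
  congr 1

end Jacobian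

variable {n : ℕ} {M : Type*} [TopologicalSpace M] [ChartedSpace (Coord n) M] {p q : ℕ}
  {e e' : OpenPartialHomeomorph M (Coord n)} {g : TensorField n M 2}

theorem sum_comm_four {κ : Type*} [Fintype κ] (f : κ → κ → κ → κ → ℝ) :
    ∑ k, ∑ l, ∑ a, ∑ b, f k l a b = ∑ a, ∑ b, ∑ k, ∑ l, f k l a b :=
  calc ∑ k, ∑ l, ∑ a, ∑ b, f k l a b = ∑ k, ∑ a, ∑ l, ∑ b, f k l a b :=
        Finset.sum_congr rfl fun _ _ => Finset.sum_comm
    _ = ∑ a, ∑ k, ∑ l, ∑ b, f k l a b := Finset.sum_comm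
    _ = ∑ a, ∑ k, ∑ b, ∑ l, f k l a b :=
        Finset.sum_congr rfl fun _ _ => Finset.sum_congr rfl fun _ _ => Finset.sum_comm
    _ = ∑ a, ∑ b, ∑ k, ∑ l, f k l a b := Finset.sum_congr rfl fun _ _ => Finset.sum_comm

/-- The `p`-th tensor power of a matrix. -/
def multiMat (p : ℕ) (A : Matrix (Fin n) (Fin n) ℝ) :
    Matrix (Fin p → Fin n) (Fin p → Fin n) ℝ :=
  Matrix.of fun I K => ∏ a, A (I a) (K a)

theorem multiMat_apply (A : Matrix (Fin n) (Fin n) ℝ) (I K : Fin p → Fin n) :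
    multiMat p A I K = ∏ a, A (I a) (K a) := rfl

theorem multiMat_mul (A B : Matrix (Fin n) (Fin n) ℝ) :
    multiMat p (A * B) = multiMat p A * multiMat p B := by
  ext I K
  simp only [multiMat_apply, Matrix.mul_apply, Finset.prod_univ_sum, Fintype.piFinset_univ,
    Finset.prod_mul_distrib]

theorem multiMat_transpose (A : Matrix (Fin n) (Fin n) ℝ) :
    multiMat p A.transpose = (multiMat p A).transpose := rfl

/-- The scalar product of two tensor fields, computed in the chart `e`. -/
noncomputable def innerComp (g : TensorField n M 2) (α β : TensorField n M p)
    (e : OpenPartialHomeomorph M (Coord n)) (y : Coord n) : ℝ :=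
  ∑ I : Fin p → Fin n, ∑ K : Fin p → Fin n,
    multiMat p (gram g e y)⁻¹ I K * (tcomp α e I y * tcomp β e K y)

theorem innerComp_eq_dotProduct (α β : TensorField n M p) (y : Coord n) :
    innerComp g α β e y = dotProduct (fun I => tcomp α e I y)
      (Matrix.mulVec (multiMat p (gram g e y)⁻¹) (fun K => tcomp β e K y)) := by
  simp only [innerComp, dotProduct, Matrix.mulVec, Finset.mul_sum]
  refine Finset.sum_congr rfl fun I _ => Finset.sum_congr rfl fun K _ => ?_
  ring

section Change
variable [IsManifold (𝓡 n) ∞ M]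

theorem tcomp_change (he : e ∈ atlas (Coord n) M) (he' : e' ∈ atlas (Coord n) M)
    (α : TensorField n M p) {y : Coord n} (hy : y ∈ e.target) (hy' : e.symm y ∈ e'.source)
    (I : Fin p → Fin n) :
    tcomp α e I y = Matrix.mulVec (multiMat p (jacMat e e' y)).transpose
      (fun K => tcomp α e' K (e' (e.symm y))) I := by
  rw [← pull_apply_stdVec, pull_change he he' α hy hy',
    ContinuousMultilinearMap.compContinuousLinearMap_apply, ModelTensor.apply_eq_sum]
  rfl

theorem gram_change (he : e ∈ atlas (Coord n) M) (he' : e' ∈ atlas (Coord n) M)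
    (g : TensorField n M 2) {y : Coord n} (hy : y ∈ e.target) (hy' : e.symm y ∈ e'.source) :
    gram g e y = (jacMat e e' y).transpose * gram g e' (e' (e.symm y)) * jacMat e e' y := by
  ext i j
  have h : gram g e y i j = toBilin (pull g e' (e' (e.symm y))) (jac e e' y (stdVec i))
      (jac e e' y (stdVec j)) := by
    rw [gram_apply, toBilin_apply, toBilin_apply, pull_change he he' g hy hy',
      ContinuousMultilinearMap.compContinuousLinearMap_apply]
    congr 1
    funext k
    fin_cases k <;> rfl
  rw [h, toBilin_eq_sum, Finset.sum_comm]
  simp only [Matrix.mul_apply, Finset.sum_mul]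
  rfl

theorem det_jac_ne_zero (he : e ∈ atlas (Coord n) M) (he' : e' ∈ atlas (Coord n) M)
    {y : Coord n} (hy : y ∈ e.target) (hy' : e.symm y ∈ e'.source) :
    (jac e e' y).det ≠ 0 := by
  have h : (jac e' e (e' (e.symm y)) : Coord n →ₗ[ℝ] Coord n) ∘ₗ (jac e e' y : Coord n →ₗ[ℝ] Coord n)
      = LinearMap.id := by
    ext1 v
    exact jac_symm_jac he he' hy hy' v
  have h2 := congrArg LinearMap.det h
  rw [LinearMap.det_comp, LinearMap.det_id] at h2
  exact right_ne_zero_of_mul_eq_one h2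

theorem sqrt_det_gram_change (he : e ∈ atlas (Coord n) M) (he' : e' ∈ atlas (Coord n) M)
    (g : TensorField n M 2) {y : Coord n} (hy : y ∈ e.target) (hy' : e.symm y ∈ e'.source) :
    √(gram g e y).det = |(jac e e' y).det| * √(gram g e' (e' (e.symm y))).det := by
  rw [gram_change he he' g hy hy', Matrix.det_mul, Matrix.det_mul, Matrix.det_transpose, det_jacMat,
    mul_right_comm, ← sq, Real.sqrt_mul (sq_nonneg _), Real.sqrt_sq_eq_abs]

theorem gram_inv_change (he : e ∈ atlas (Coord n) M) (he' : e' ∈ atlas (Coord n) M)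
    (g : TensorField n M 2) {y : Coord n} (hy : y ∈ e.target) (hy' : e.symm y ∈ e'.source) :
    (gram g e' (e' (e.symm y)))⁻¹ =
      jacMat e e' y * (gram g e y)⁻¹ * (jacMat e e' y).transpose := by
  have hu : IsUnit (jacMat e e' y).det := by
    rw [det_jacMat]; exact (det_jac_ne_zero he he' hy hy').isUnit
  have hu' : IsUnit (jacMat e e' y).transpose.det := by rwa [Matrix.det_transpose]
  rw [gram_change he he' g hy hy', Matrix.mul_inv_rev, Matrix.mul_inv_rev, mul_assoc, mul_assoc,
    mul_assoc, Matrix.nonsing_inv_mul _ hu', mul_one, ← mul_assoc, Matrix.mul_nonsing_inv _ hu,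
    one_mul]

theorem innerComp_change (he : e ∈ atlas (Coord n) M) (he' : e' ∈ atlas (Coord n) M)
    (α β : TensorField n M p) {y : Coord n} (hy : y ∈ e.target) (hy' : e.symm y ∈ e'.source) :
    innerComp g α β e' (e' (e.symm y)) = innerComp g α β e y := by
  rw [innerComp_eq_dotProduct, innerComp_eq_dotProduct, gram_inv_change he he' g hy hy',
    multiMat_mul, multiMat_mul, multiMat_transpose]
  rw [show (fun I => tcomp α e I y) = _ from funext (tcomp_change he he' α hy hy'),
    show (fun I => tcomp β e I y) = _ from funext (tcomp_change he he' β hy hy')]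
  rw [Matrix.mulVec_transpose, ← Matrix.dotProduct_mulVec, Matrix.mulVec_mulVec,
    Matrix.mulVec_mulVec, mul_assoc]

theorem tensorInner_eq (he : e ∈ atlas (Coord n) M) (g : TensorField n M 2)
    (α β : TensorField n M p) {x : M} (hx : x ∈ e.source) :
    tensorInner g α β x = innerComp g α β e (e x) := by
  have hx' : e.symm (e x) ∈ (chartAt (Coord n) x).source := by
    rw [e.left_inv hx]; exact mem_chart_source _ _
  rw [← innerComp_change he (chart_mem_atlas (Coord n) x) α β (e.map_source hx) hx',
    e.left_inv hx]
  rfl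

theorem det_mulVec_alternating {V : Type*} [AddCommGroup V] [Module ℝ V]
    (f : V [⋀^Fin n]→ₗ[ℝ] ℝ) (b : Fin n → V) (A : Matrix (Fin n) (Fin n) ℝ) :
    f (fun i => ∑ a, A a i • b a) = A.det * f b := by
  have h := (f.compLinearMap (Fintype.linearCombination ℝ b)).eq_smul_basis_det
    (Pi.basisFun ℝ (Fin n))
  have h2 := DFunLike.congr_fun h (fun i a => A a i)
  have hb : (fun i => Fintype.linearCombination ℝ b (Pi.basisFun ℝ (Fin n) i)) = b := by
    funext i
    simp [Fintype.linearCombination_apply, Pi.single_apply]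
  rw [AlternatingMap.smul_apply, Pi.basisFun_det_apply, smul_eq_mul, mul_comm] at h2
  rw [← Matrix.det_transpose]
  refine h2.trans ?_
  exact congrArg (fun u => A.transpose.det * f u) hb

theorem form_change (he : e ∈ atlas (Coord n) M) (he' : e' ∈ atlas (Coord n) M)
    (Ω : VolumeForm n M) {y : Coord n} (hy : y ∈ e.target) (hy' : e.symm y ∈ e'.source) :
    Ω.form (e.symm y) (coordVec e y) = (jac e e' y).det *
      Ω.form (e'.symm (e' (e.symm y))) (coordVec e' (e' (e.symm y))) := by
  have key : ∀ x x' : M, x' = x → ∀ w : Fin n → Coord n,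
      Ω.form x' (fun k => (w k : TangentSpace (𝓡 n) x'))
        = Ω.form x (fun k => (w k : TangentSpace (𝓡 n) x)) := by
    rintro x x' rfl w; rfl
  rw [← det_jacMat]
  refine Eq.trans ?_ (det_mulVec_alternating (Ω.form (e'.symm (e' (e.symm y)))).toAlternatingMap
    (coordVec e' (e' (e.symm y))) (jacMat e e' y))
  refine Eq.trans (key _ _ (e'.left_inv hy').symm (coordVec e y)) ?_
  refine congrArg (Ω.form (e'.symm (e' (e.symm y)))) (funext fun i => ?_)
  refine (mfderiv_symm_comp_jac he he' hy hy' (stdVec i)).symm.trans ?_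
  rw [← sum_smul_stdVec (jac e e' y (stdVec i))]
  refine (map_sum (mfderiv (𝓡 n) (𝓡 n) e'.symm (e' (e.symm y))) _ _).trans ?_
  refine Finset.sum_congr rfl fun a _ => ?_
  exact map_smul (mfderiv (𝓡 n) (𝓡 n) e'.symm (e' (e.symm y))) _ _

/-- The ratio of `dV_g` and `Ω`, computed in the chart `e`. -/
noncomputable def volRatioComp (Ω : VolumeForm n M) (g : TensorField n M 2)
    (e : OpenPartialHomeomorph M (Coord n)) (y : Coord n) : ℝ :=
  √(gram g e y).det / |Ω.form (e.symm y) (coordVec e y)|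

theorem volRatio_eq (he : e ∈ atlas (Coord n) M) (Ω : VolumeForm n M) (g : TensorField n M 2)
    {y : Coord n} (hy : y ∈ e.target) : volRatio Ω g (e.symm y) = volRatioComp Ω g e y := by
  have he' := chart_mem_atlas (Coord n) (e.symm y)
  have hy' := mem_chart_source (Coord n) (e.symm y)
  rw [volRatioComp, form_change he he' Ω hy hy', sqrt_det_gram_change he he' g hy hy', abs_mul,
    mul_div_mul_left _ _ (abs_ne_zero.2 (det_jac_ne_zero he he' hy hy'))]
  rfl

theorem VolumeForm.form_coordVec_ne_zero (Ω : VolumeForm n M) (he : e ∈ atlas (Coord n) M)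
    {y : Coord n} (hy : y ∈ e.target) : Ω.form (e.symm y) (coordVec e y) ≠ 0 := by
  intro h0
  refine Ω.ne_zero (e.symm y) ?_
  ext v
  let w : Fin n → Coord n := fun i => mfderiv (𝓡 n) (𝓡 n) e (e.symm y) (v i)
  set A : Matrix (Fin n) (Fin n) ℝ := Matrix.of fun a i => w i a
  have h := det_mulVec_alternating (Ω.form (e.symm y)).toAlternatingMap (coordVec e y) A
  have h2 : (fun i => ∑ a, A a i • coordVec e y a) = v := by
    funext i
    have h3 := mfderiv_symm_comp_mfderiv he (e.map_target hy) (v i)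
    rw [e.right_inv hy] at h3
    refine Eq.trans ?_ h3
    refine Eq.trans ?_ (congrArg (fun u : Coord n => (mfderiv (𝓡 n) (𝓡 n) e.symm y u : Coord n))
      (sum_smul_stdVec (w i)))
    refine Eq.symm ((map_sum (mfderiv (𝓡 n) (𝓡 n) e.symm y) _ _).trans ?_)
    refine Finset.sum_congr rfl fun a _ => ?_
    exact map_smul (mfderiv (𝓡 n) (𝓡 n) e.symm y) _ _
  rw [h2] at h
  refine h.trans ?_
  refine (congrArg (A.det * ·) h0).trans ?_
  simp

end Change

/-- Contraction of the first two arguments of a tensor with a matrix. -/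
noncomputable def contractTensor (G : Matrix (Fin n) (Fin n) ℝ) (T : ModelTensor n (p + 2)) :
    ModelTensor n p :=
  ∑ k, ∑ l, G k l • (T.curryLeft (stdVec k)).curryLeft (stdVec l)

theorem contractTensor_apply (G : Matrix (Fin n) (Fin n) ℝ) (T : ModelTensor n (p + 2))
    (w : Fin p → Coord n) : contractTensor G T w =
      ∑ k, ∑ l, G k l * T (Fin.cons (stdVec k) (Fin.cons (stdVec l) w)) := by
  simp only [contractTensor, sum_apply, smul_apply, smul_eq_mul]
  rfl

theorem cons_cons_eq_sum (T : ModelTensor n (p + 2)) (w : Fin p → Coord n) (v v' : Coord n) :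
    T (Fin.cons v (Fin.cons v' w)) =
      ∑ a, ∑ b, v a * v' b * T (Fin.cons (stdVec a) (Fin.cons (stdVec b) w)) := by
  have h1 : T (Fin.cons v (Fin.cons v' w)) = ∑ a, v a * T (Fin.cons (stdVec a) (Fin.cons v' w)) := by
    have := congrArg (fun S : ModelTensor n (p + 1) => S (Fin.cons v' w))
      ((congrArg T.curryLeft (sum_smul_stdVec v)).symm.trans (map_sum _ _ _))
    simpa using this
  rw [h1]
  refine Finset.sum_congr rfl fun a _ => ?_
  have := congrArg (fun S : ModelTensor n p => S w)
      ((congrArg (T.curryLeft (stdVec a)).curryLeft (sum_smul_stdVec v')).symm.trans (map_sum _ _ _))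
  have h2 : T (Fin.cons (stdVec a) (Fin.cons v' w)) =
    ∑ b, v' b * T (Fin.cons (stdVec a) (Fin.cons (stdVec b) w)) := by simpa using this
  rw [h2, Finset.mul_sum]
  exact Finset.sum_congr rfl fun b _ => by ring

theorem comp_cons_cons {X Y : Type*} (A : X → Y) (v v' : X) (w : Fin p → X) :
    (fun k => A ((Fin.cons v (Fin.cons v' w : Fin (p + 1) → X) : Fin (p + 2) → X) k)) =
      (Fin.cons (A v) (Fin.cons (A v') (fun k => A (w k)) : Fin (p + 1) → Y) : Fin (p + 2) → Y) := by
  funext k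
  refine Fin.cases rfl (fun k => ?_) k
  refine Fin.cases rfl (fun k => rfl) k

variable [IsManifold (𝓡 n) ∞ M]

theorem isTensorial_contractTensor (g : TensorField n M 2) (α : TensorField n M (p + 2)) :
    IsTensorial (fun e y => contractTensor (gram g e y)⁻¹ (pull α e y)) := by
  intro e he e' he' y hy hy'
  ext w
  rw [ContinuousMultilinearMap.compContinuousLinearMap_apply, contractTensor_apply,
    contractTensor_apply, pull_change he he' α hy hy', gram_inv_change he he' g hy hy']
  simp only [ContinuousMultilinearMap.compContinuousLinearMap_apply, comp_cons_cons]
  simp only [cons_cons_eq_sum (pull α e' (e' (e.symm y))) _ (jac e e' y _) (jac e e' y _)]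
  simp only [Matrix.mul_apply, Finset.sum_mul, Finset.mul_sum, Matrix.transpose_apply, jacMat_apply]
  rw [sum_comm_four]
  refine Finset.sum_congr rfl fun a _ => Finset.sum_congr rfl fun b _ => ?_
  rw [Finset.sum_comm]
  refine Finset.sum_congr rfl fun l _ => Finset.sum_congr rfl fun k _ => ?_
  ring

theorem pull_traceFirst (g : TensorField n M 2) (α : TensorField n M (p + 2))
    (he : e ∈ atlas (Coord n) M) {y : Coord n} (hy : y ∈ e.target) :
    pull (traceFirst g α) e y = contractTensor (gram g e y)⁻¹ (pull α e y) := by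
  refine pull_eq_of_isTensorial (isTensorial_contractTensor g α) (fun x => ?_) he hy
  rw [traceFirst]
  congr 1
  funext I
  rw [contractTensor_apply]
  refine Finset.sum_congr rfl fun k _ => Finset.sum_congr rfl fun l _ => ?_
  rw [← pull_apply_stdVec]
  exact congrArg (fun w => (gram g (chartAt (Coord n) x) (chartAt (Coord n) x x))⁻¹ k l *
    pull α (chartAt (Coord n) x) (chartAt (Coord n) x x) w) (comp_cons_cons stdVec k l I)

end BakryEmery

namespace BakryEmery

section MatrixCalculus
variable {F : Type*} [NormedAddCommGroup F] [NormedSpace ℝ F] {n : ℕ} {s : Set F}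
  {A : F → Matrix (Fin n) (Fin n) ℝ}

theorem contDiffOn_det (hA : ∀ i j, ContDiffOn ℝ ∞ (fun z => A z i j) s) :
    ContDiffOn ℝ ∞ (fun z => (A z).det) s := by
  simp only [Matrix.det_apply']
  exact ContDiffOn.sum fun σ _ => contDiffOn_const.mul (contDiffOn_prod fun i _ => hA _ _)

theorem contDiffOn_matrix_inv_apply (hA : ∀ i j, ContDiffOn ℝ ∞ (fun z => A z i j) s)
    (hdet : ∀ z ∈ s, (A z).det ≠ 0) (i j : Fin n) :
    ContDiffOn ℝ ∞ (fun z => (A z)⁻¹ i j) s := by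
  have h : ContDiffOn ℝ ∞ (fun z => (A z).adjugate i j) s := by
    simp only [Matrix.adjugate_apply]
    refine contDiffOn_det fun k l => ?_
    by_cases hk : k = j
    · subst hk
      simp only [Matrix.updateRow_self]
      exact contDiffOn_const
    · simpa only [Matrix.updateRow_ne hk] using hA k l
  simp only [Matrix.inv_def, Ring.inverse_eq_inv', Matrix.smul_apply, smul_eq_mul]
  exact ((contDiffOn_det hA).inv hdet).mul h

end MatrixCalculus

section Partial
variable {n : ℕ} {J : Set ℝ} {V : Set (Coord n)} {h : ℝ × Coord n → ℝ}

theorem hasFDerivAt_slice (hJ : IsOpen J) (hV : IsOpen V) (hh : ContDiffOn ℝ ∞ h (J ×ˢ V))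
    {t : ℝ} {y : Coord n} (ht : t ∈ J) (hy : y ∈ V) :
    HasFDerivAt (fun y => h (t, y))
      ((fderiv ℝ h (t, y)).comp (ContinuousLinearMap.inr ℝ ℝ (Coord n))) y := by
  have h1 : DifferentiableAt ℝ h (t, y) :=
    (hh.contDiffAt ((hJ.prod hV).mem_nhds ⟨ht, hy⟩)).differentiableAt (by simp)
  exact h1.hasFDerivAt.comp y (hasFDerivAt_prodMk_right t y)

theorem hasDerivAt_slice (hJ : IsOpen J) (hV : IsOpen V) (hh : ContDiffOn ℝ ∞ h (J ×ˢ V))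
    {t : ℝ} {y : Coord n} (ht : t ∈ J) (hy : y ∈ V) :
    HasDerivAt (fun t => h (t, y)) (fderiv ℝ h (t, y) (1, 0)) t := by
  have h1 : DifferentiableAt ℝ h (t, y) :=
    (hh.contDiffAt ((hJ.prod hV).mem_nhds ⟨ht, hy⟩)).differentiableAt (by simp)
  exact (h1.hasFDerivAt.comp t (hasFDerivAt_prodMk_left t y)).hasDerivAt

theorem pderiv_slice (hJ : IsOpen J) (hV : IsOpen V) (hh : ContDiffOn ℝ ∞ h (J ×ˢ V))
    {t : ℝ} {y : Coord n} (ht : t ∈ J) (hy : y ∈ V) (i : Fin n) :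
    pderiv i (fun y => h (t, y)) y = fderiv ℝ h (t, y) (0, stdVec i) := by
  rw [pderiv, (hasFDerivAt_slice hJ hV hh ht hy).fderiv]
  rfl

theorem contDiffOn_fderiv_apply {F : Type*} [NormedAddCommGroup F] [NormedSpace ℝ F]
    {U : Set F} (hU : IsOpen U) {f : F → ℝ} (hf : ContDiffOn ℝ ∞ f U) (v : F) :
    ContDiffOn ℝ ∞ (fun z => fderiv ℝ f z v) U :=
  (hf.fderiv_of_isOpen hU (by simp)).clm_apply contDiffOn_const

theorem contDiffOn_pderiv_slice (hJ : IsOpen J) (hV : IsOpen V)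
    (hh : ContDiffOn ℝ ∞ h (J ×ˢ V)) (i : Fin n) :
    ContDiffOn ℝ ∞ (fun z : ℝ × Coord n => pderiv i (fun y => h (z.1, y)) z.2) (J ×ˢ V) :=
  (contDiffOn_fderiv_apply (hJ.prod hV) hh (0, stdVec i)).congr
    fun _ hz => pderiv_slice hJ hV hh hz.1 hz.2 i

theorem contDiffOn_deriv_slice (hJ : IsOpen J) (hV : IsOpen V)
    (hh : ContDiffOn ℝ ∞ h (J ×ˢ V)) :
    ContDiffOn ℝ ∞ (fun z : ℝ × Coord n => deriv (fun t => h (t, z.2)) z.1) (J ×ˢ V) :=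
  (contDiffOn_fderiv_apply (hJ.prod hV) hh (1, 0)).congr
    fun _ hz => (hasDerivAt_slice hJ hV hh hz.1 hz.2).deriv

theorem contDiffOn_slice (hh : ContDiffOn ℝ ∞ h (J ×ˢ V)) {t : ℝ} (ht : t ∈ J) :
    ContDiffOn ℝ ∞ (fun y => h (t, y)) V :=
  hh.comp (contDiff_prodMk_right t).contDiffOn fun _ hy => ⟨ht, hy⟩

theorem contDiffOn_pderiv (hV : IsOpen V) {f : Coord n → ℝ} (hf : ContDiffOn ℝ ∞ f V)
    (i : Fin n) : ContDiffOn ℝ ∞ (pderiv i f) V :=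
  contDiffOn_fderiv_apply hV hf (stdVec i)

/-- Time and space derivatives commute. -/
theorem hasDerivAt_pderiv_slice (hJ : IsOpen J) (hV : IsOpen V) (hh : ContDiffOn ℝ ∞ h (J ×ˢ V))
    {t : ℝ} {y : Coord n} (ht : t ∈ J) (hy : y ∈ V) (i : Fin n) :
    HasDerivAt (fun t => pderiv i (fun y => h (t, y)) y)
      (pderiv i (fun y => deriv (fun t => h (t, y)) t) y) t := by
  have hz : J ×ˢ V ∈ nhds (t, y) := (hJ.prod hV).mem_nhds ⟨ht, hy⟩
  have h1 := hasDerivAt_slice hJ hV (contDiffOn_pderiv_slice hJ hV hh i) ht hy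
  have h2 := pderiv_slice hJ hV (contDiffOn_deriv_slice hJ hV hh) ht hy i
  convert h1 using 1
  rw [h2]
  have hd : DifferentiableAt ℝ (fderiv ℝ h) (t, y) :=
    ((hh.contDiffAt hz).fderiv_right (m := 1) (by norm_cast)).differentiableAt (by simp)
  have e1 : (fun z : ℝ × Coord n => pderiv i (fun y => h (z.1, y)) z.2) =ᶠ[nhds (t, y)]
      fun z => fderiv ℝ h z (0, stdVec i) :=
    Filter.Eventually.mono hz fun z hz => pderiv_slice hJ hV hh hz.1 hz.2 i
  have e2 : (fun z : ℝ × Coord n => deriv (fun t => h (t, z.2)) z.1) =ᶠ[nhds (t, y)]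
      fun z => fderiv ℝ h z (1, 0) :=
    Filter.Eventually.mono hz fun z hz => (hasDerivAt_slice hJ hV hh hz.1 hz.2).deriv
  rw [e1.fderiv_eq, e2.fderiv_eq]
  have f1 := fun v : ℝ × Coord n => hd.hasFDerivAt.clm_apply (hasFDerivAt_const v (t, y))
  rw [(f1 _).fderiv, (f1 _).fderiv]
  have hs := (hh.contDiffAt hz).isSymmSndFDerivAt
    (by simp only [minSmoothness_of_isRCLikeNormedField]; norm_cast)
  simpa using hs (0, stdVec i) (1, 0)

end Partial

variable {n : ℕ} {M : Type*} [TopologicalSpace M] [ChartedSpace (Coord n) M] {p q : ℕ}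
  {e e' : OpenPartialHomeomorph M (Coord n)} {g : TensorField n M 2}

theorem isSmoothFamily_const {α : TensorField n M p} (hα : IsSmooth α) :
    IsSmoothFamily Set.univ (fun _ => α) := fun e he I =>
  (hα e he I).comp contDiffOn_snd fun _ hz => hz.2

theorem IsSmooth.sub {α β : TensorField n M p} (hα : IsSmooth α) (hβ : IsSmooth β) :
    IsSmooth (α - β) := fun e he I => (hα e he I).sub (hβ e he I)

theorem IsSmooth.const_smul {α : TensorField n M p} (hα : IsSmooth α) (c : ℝ) :
    IsSmooth (c • α) := fun e he I => contDiffOn_const.mul (hα e he I)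

/-- Smooth functions: their expressions in all charts are smooth. -/
def IsSmoothFun (n : ℕ) {M : Type*} [TopologicalSpace M] [ChartedSpace (Coord n) M]
    (u : M → ℝ) : Prop :=
  ∀ e ∈ atlas (Coord n) M, ContDiffOn ℝ ∞ (fun y => u (e.symm y)) e.target

theorem IsSmooth.fsmul {α : TensorField n M p} (hα : IsSmooth α) {u : M → ℝ}
    (hu : IsSmoothFun n u) : IsSmooth (fsmul u α) := fun e he I => (hu e he).mul (hα e he I)

section Families
variable [IsManifold (𝓡 n) ∞ M] {J : Set ℝ} {g : ℝ → TensorField n M 2}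

theorem IsSmoothFamily.contDiffOn_gram_inv (hsmooth : IsSmoothFamily J g)
    (hg : ∀ t ∈ J, IsRiemannian (g t)) (he : e ∈ atlas (Coord n) M) (i j : Fin n) :
    ContDiffOn ℝ ∞ (fun z : ℝ × Coord n => (gram (g z.1) e z.2)⁻¹ i j) (J ×ˢ e.target) :=
  contDiffOn_matrix_inv_apply (fun i j => hsmooth e he ![i, j])
    (fun z hz => ((hg z.1 hz.1).det_gram_pos he hz.2).ne') i j

theorem IsSmoothFamily.contDiffOn_christoffel (hsmooth : IsSmoothFamily J g) (hJ : IsOpen J)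
    (hg : ∀ t ∈ J, IsRiemannian (g t)) (he : e ∈ atlas (Coord n) M) (k i j : Fin n) :
    ContDiffOn ℝ ∞ (fun z : ℝ × Coord n => christoffel (g z.1) e k i j z.2) (J ×ˢ e.target) := by
  have hp := fun i I => contDiffOn_pderiv_slice hJ e.open_target (hsmooth e he I) i
  refine contDiffOn_const.mul (ContDiffOn.sum fun l _ => ?_)
  exact (hsmooth.contDiffOn_gram_inv hg he k l).mul (((hp _ _).add (hp _ _)).sub (hp _ _))

end Families

theorem tcomp_symNabla (α : TensorField n M p) (I : Fin (p + 1) → Fin n) (y : Coord n) :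
    tcomp (symNabla g α) e I y = ∑ j : Fin (p + 1),
      tcomp (BakryEmery.nabla g α) e (fun k => I (j.cycleRange.symm k)) y := by
  simp only [tcomp, symNabla, sum_apply]
  rfl

section Smooth
variable [IsManifold (𝓡 n) ∞ M]

theorem IsRiemannian.contDiffOn_gram_inv (hg : IsRiemannian g) (he : e ∈ atlas (Coord n) M)
    (i j : Fin n) : ContDiffOn ℝ ∞ (fun y => (gram g e y)⁻¹ i j) e.target :=
  contDiffOn_slice ((isSmoothFamily_const hg.smooth).contDiffOn_gram_inv (fun _ _ => hg) he i j)
    (Set.mem_univ (0 : ℝ))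

theorem IsRiemannian.contDiffOn_christoffel (hg : IsRiemannian g) (he : e ∈ atlas (Coord n) M)
    (k i j : Fin n) : ContDiffOn ℝ ∞ (christoffel g e k i j) e.target :=
  contDiffOn_slice ((isSmoothFamily_const hg.smooth).contDiffOn_christoffel isOpen_univ
    (fun _ _ => hg) he k i j) (Set.mem_univ (0 : ℝ))

theorem IsSmooth.nabla (hg : IsRiemannian g) {α : TensorField n M p} (hα : IsSmooth α) :
    IsSmooth (nabla g α) := by
  intro e he I
  refine ContDiffOn.congr (f := nablaComp g α e I) ?_ fun y hy => tcomp_nabla hg hα he hy I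
  refine (contDiffOn_pderiv e.open_target (hα e he _) _).sub ?_
  exact ContDiffOn.sum fun a _ => ContDiffOn.sum fun l _ =>
    (hg.contDiffOn_christoffel he _ _ _).mul (hα e he _)

theorem IsSmooth.symNabla (hg : IsRiemannian g) {α : TensorField n M p} (hα : IsSmooth α) :
    IsSmooth (symNabla g α) := by
  intro e he I
  rw [show tcomp (BakryEmery.symNabla g α) e I = _ from funext (tcomp_symNabla α I)]
  exact ContDiffOn.sum fun j _ => hα.nabla hg e he _

theorem tcomp_traceFirst (g : TensorField n M 2) (α : TensorField n M (p + 2))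
    (he : e ∈ atlas (Coord n) M) {y : Coord n} (hy : y ∈ e.target) (I : Fin p → Fin n) :
    tcomp (traceFirst g α) e I y = ∑ k, ∑ l, (gram g e y)⁻¹ k l *
      tcomp α e (Fin.cons k (Fin.cons l I)) y := by
  rw [← pull_apply_stdVec, pull_traceFirst g α he hy, contractTensor_apply]
  refine Finset.sum_congr rfl fun k _ => Finset.sum_congr rfl fun l _ => ?_
  rw [← pull_apply_stdVec]
  exact congrArg (fun w => (gram g e y)⁻¹ k l * pull α e y w) (comp_cons_cons stdVec k l I).symm

theorem IsSmooth.traceFirst (hg : IsRiemannian g) {α : TensorField n M (p + 2)}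
    (hα : IsSmooth α) : IsSmooth (traceFirst g α) := by
  intro e he I
  refine ContDiffOn.congr ?_ fun y hy => tcomp_traceFirst g α he hy I
  exact ContDiffOn.sum fun k _ => ContDiffOn.sum fun l _ =>
    (hg.contDiffOn_gram_inv he k l).mul (hα e he _)

theorem IsSmooth.divergence (hg : IsRiemannian g) {α : TensorField n M (p + 1)}
    (hα : IsSmooth α) : IsSmooth (divergence g α) :=
  (hα.nabla hg).traceFirst hg

theorem potential_eq (he : e ∈ atlas (Coord n) M) (Ω : VolumeForm n M) (hg : IsRiemannian g)
    {y : Coord n} (hy : y ∈ e.target) : potential Ω g (e.symm y) =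
      2⁻¹ * Real.log (gram g e y).det - Real.log (Ω.form (e.symm y) (coordVec e y)) := by
  rw [potential, volRatio_eq he Ω g hy, volRatioComp,
    Real.log_div (Real.sqrt_pos.2 (hg.det_gram_pos he hy)).ne'
      (abs_pos.2 (Ω.form_coordVec_ne_zero he hy)).ne', Real.log_abs,
    Real.log_sqrt (hg.det_gram_pos he hy).le]
  ring

theorem contDiffOn_potential {J : Set ℝ} {g : ℝ → TensorField n M 2}
    (hsmooth : IsSmoothFamily J g) (hg : ∀ t ∈ J, IsRiemannian (g t)) (Ω : VolumeForm n M)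
    (he : e ∈ atlas (Coord n) M) :
    ContDiffOn ℝ ∞ (fun z : ℝ × Coord n => potential Ω (g z.1) (e.symm z.2)) (J ×ˢ e.target) := by
  refine ContDiffOn.congr ?_ fun z hz => potential_eq he Ω (hg z.1 hz.1) hz.2
  refine (contDiffOn_const.mul (ContDiffOn.log (contDiffOn_det fun i j => hsmooth e he ![i, j])
    fun z hz => ((hg z.1 hz.1).det_gram_pos he hz.2).ne')).sub ?_
  exact ContDiffOn.log ((Ω.smooth e he).comp contDiffOn_snd fun _ hz => hz.2)
    fun z hz => Ω.form_coordVec_ne_zero he hz.2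

theorem isSmoothFun_potential (hg : IsRiemannian g) (Ω : VolumeForm n M) :
    IsSmoothFun n (potential Ω g) := fun _ he =>
  contDiffOn_slice (contDiffOn_potential (isSmoothFamily_const hg.smooth) (fun _ _ => hg) Ω he)
    (Set.mem_univ (0 : ℝ))

/-- The differential of a function in a chart, as a tensor on the model space. -/
noncomputable def differentialTensor (u : M → ℝ) (e : OpenPartialHomeomorph M (Coord n))
    (y : Coord n) : ModelTensor n 1 :=
  ContinuousMultilinearMap.ofSubsingleton ℝ (Coord n) ℝ (0 : Fin 1)
    (fderiv ℝ (fun y => u (e.symm y)) y)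

theorem isTensorial_differentialTensor {u : M → ℝ} (hu : IsSmoothFun n u) :
    IsTensorial (differentialTensor (n := n) u) := by
  intro e he e' he' y hy hy'
  have hev : (fun z => u (e.symm z)) =ᶠ[nhds y] (fun z => u (e'.symm z)) ∘ (e' ∘ e.symm) :=
    (eventually_mem_overlap hy hy').mono fun z hz => by simp [e'.left_inv hz.2]
  have h1 := ((contDiffAt_change he he' hy hy').differentiableAt (by simp)).hasFDerivAt
  have h2 := (((hu e' he').contDiffAt (e'.open_target.mem_nhds
    (e'.map_source hy'))).differentiableAt (by simp)).hasFDerivAt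
  have h3 := (HasFDerivAt.comp y h2 h1).congr_of_eventuallyEq hev
  ext v
  rw [differentialTensor, h3.fderiv]
  rfl

theorem tcomp_differential {u : M → ℝ} (hu : IsSmoothFun n u)
    (he : e ∈ atlas (Coord n) M) {y : Coord n} (hy : y ∈ e.target) (I : Fin 1 → Fin n) :
    tcomp (differential u) e I y = pderiv (I 0) (fun y => u (e.symm y)) y := by
  rw [← pull_apply_stdVec, pull_eq_of_isTensorial (β := differential u)
    (isTensorial_differentialTensor hu) (fun x => rfl) he hy]
  rfl

/-- The components of the time derivative in any chart. -/
theorem tcomp_timeDeriv {J : Set ℝ} (hJ : IsOpen J) {g : ℝ → TensorField n M p}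
    (hsmooth : IsSmoothFamily J g) {t : ℝ} (ht : t ∈ J)
    (he : e ∈ atlas (Coord n) M) {y : Coord n} (hy : y ∈ e.target) (I : Fin p → Fin n) :
    tcomp (timeDeriv g t) e I y = deriv (fun s => tcomp (g s) e I y) t := by
  have hC : IsTensorial (fun (e : OpenPartialHomeomorph M (Coord n)) y =>
      ∑ I : Fin p → Fin n, deriv (fun s => tcomp (g s) e I y) t • stdTensor I) := by
    intro e he e' he' y hy hy'
    refine ModelTensor.ext_stdVec fun I => ?_
    rw [sum_smul_stdTensor_apply_stdVec, ContinuousMultilinearMap.compContinuousLinearMap_apply]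
    simp only [sum_apply, smul_apply, smul_eq_mul, stdTensor_apply]
    have h1 : ∀ s, tcomp (g s) e I y = ∑ K : Fin p → Fin n,
        tcomp (g s) e' K (e' (e.symm y)) * ∏ k, jac e e' y (stdVec (I k)) (K k) := by
      intro s
      rw [tcomp_change he he' (g s) hy hy']
      simp only [Matrix.mulVec, dotProduct, mul_comm]
      rfl
    simp only [h1]
    have h2 := fun K => (hasDerivAt_slice hJ e'.open_target (hsmooth e' he' K) ht
      (e'.map_source hy')).differentiableAt.hasDerivAt
    exact (HasDerivAt.fun_sum fun K _ => (h2 K).mul_const _).deriv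
  rw [← pull_apply_stdVec, pull_eq_of_isTensorial hC (fun x => ?_) he hy,
    sum_smul_stdTensor_apply_stdVec]
  rw [timeDeriv]
  congr 1
  funext I
  rw [sum_smul_stdTensor_apply_stdVec]

theorem IsSmoothFamily.isSmooth_timeDeriv {J : Set ℝ} (hJ : IsOpen J) {g : ℝ → TensorField n M p}
    (hsmooth : IsSmoothFamily J g) {t : ℝ} (ht : t ∈ J) : IsSmooth (timeDeriv g t) := by
  intro e he I
  refine ContDiffOn.congr ?_ fun y hy => tcomp_timeDeriv hJ hsmooth ht he hy I
  exact contDiffOn_slice (contDiffOn_deriv_slice hJ e.open_target (hsmooth e he I)) ht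

end Smooth

end BakryEmery

namespace BakryEmery

theorem hasFDerivAt_det {F : Type*} [NormedAddCommGroup F] [NormedSpace ℝ F] {n : ℕ}
    {A : F → Matrix (Fin n) (Fin n) ℝ} {A' : Fin n → Fin n → F →L[ℝ] ℝ} {z : F}
    (hA : ∀ i j, HasFDerivAt (fun z => A z i j) (A' i j) z) :
    HasFDerivAt (fun z => (A z).det) (∑ i, ∑ j, (A z).adjugate i j • A' j i) z := by
  simp only [Matrix.det_apply']
  have h := HasFDerivAt.fun_sum (u := Finset.univ) (fun (σ : Equiv.Perm (Fin n)) _ =>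
    (HasFDerivAt.finsetProd (u := Finset.univ) (fun i _ => hA (σ i) i)).const_mul
      ((Equiv.Perm.sign σ : ℤ) : ℝ))
  refine h.congr_fderiv ?_
  ext v
  have h2 : ∀ i, ∑ j, (A z).adjugate i j * A' j i v
      = ((A z).updateCol i (fun j => A' j i v)).det := by
    intro i
    rw [← Matrix.cramer_apply, Matrix.cramer_eq_adjugate_mulVec]
    rfl
  simp only [sum_apply, smul_apply, smul_eq_mul, h2, Matrix.det_apply', Finset.mul_sum]
  rw [Finset.sum_comm]
  refine Finset.sum_congr rfl fun i _ => Finset.sum_congr rfl fun σ _ => ?_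
  congr 1
  rw [← Finset.mul_prod_erase Finset.univ _ (Finset.mem_univ i), Matrix.updateCol_self, mul_comm]
  congr 1
  refine Finset.prod_congr rfl fun k hk => ?_
  rw [Matrix.updateCol_ne (Finset.ne_of_mem_erase hk)]

variable {n : ℕ} {M : Type*} [TopologicalSpace M] [ChartedSpace (Coord n) M] {p q : ℕ}
  {e e' : OpenPartialHomeomorph M (Coord n)} {g : TensorField n M 2}

theorem IsRiemannian.tcomp_symm (hg : IsRiemannian g) (i j : Fin n) :
    tcomp g e ![i, j] = tcomp g e ![j, i] :=
  funext fun y => hg.gram_symm y i j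

theorem IsRiemannian.christoffel_symm (hg : IsRiemannian g) (k i j : Fin n) (y : Coord n) :
    christoffel g e k i j y = christoffel g e k j i y := by
  simp only [christoffel]
  congr 1
  refine Finset.sum_congr rfl fun l _ => ?_
  rw [hg.tcomp_symm i j]
  ring

section Metric
variable [IsManifold (𝓡 n) ∞ M]

theorem IsRiemannian.pderiv_gram (hg : IsRiemannian g) (he : e ∈ atlas (Coord n) M)
    {y : Coord n} (hy : y ∈ e.target) (k l m : Fin n) :
    pderiv k (tcomp g e ![l, m]) y = ∑ p, (christoffel g e p k l y * gram g e y p m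
      + christoffel g e p k m y * gram g e y l p) := by
  have h1 := hg.sum_gram_mul_christoffel he hy k l m
  have h2 := hg.sum_gram_mul_christoffel he hy k m l
  have h3 : ∑ p, (christoffel g e p k l y * gram g e y p m
      + christoffel g e p k m y * gram g e y l p) =
      (∑ p, gram g e y m p * christoffel g e p k l y)
        + ∑ p, gram g e y l p * christoffel g e p k m y := by
    rw [← Finset.sum_add_distrib]
    refine Finset.sum_congr rfl fun p _ => ?_
    rw [hg.gram_symm y p m]
    ring
  rw [h3]
  rw [hg.tcomp_symm m l] at h2
  linarith

theorem IsRiemannian.pderiv_log_det_gram (hg : IsRiemannian g) (he : e ∈ atlas (Coord n) M)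
    {y : Coord n} (hy : y ∈ e.target) (j : Fin n) :
    pderiv j (fun y => 2⁻¹ * Real.log (gram g e y).det) y = ∑ l, christoffel g e l l j y := by
  have hd : ∀ i k, HasFDerivAt (fun y => gram g e y i k) (fderiv ℝ (tcomp g e ![i, k]) y) y :=
    fun i k => (((hg.smooth e he ![i, k]).contDiffAt
      (e.open_target.mem_nhds hy)).differentiableAt (by simp)).hasFDerivAt
  have h1 := ((hasFDerivAt_det hd).log (hg.det_gram_pos he hy).ne').const_mul 2⁻¹
  rw [pderiv, h1.fderiv]
  have hinv : ∀ a b, (gram g e y).det⁻¹ * (gram g e y).adjugate a b = (gram g e y)⁻¹ a b := by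
    intro a b
    rw [Matrix.inv_def, Ring.inverse_eq_inv', Matrix.smul_apply, smul_eq_mul]
  have h2 : ∀ a b, fderiv ℝ (tcomp g e ![a, b]) y (stdVec j) = pderiv j (tcomp g e ![a, b]) y :=
    fun a b => rfl
  have h4 : ∀ c, ∑ a, ∑ b, (gram g e y)⁻¹ a b * (christoffel g e c j b y * gram g e y c a) =
      christoffel g e c j c y := by
    intro c
    have : ∀ a b, (gram g e y)⁻¹ a b * (christoffel g e c j b y * gram g e y c a) =
      christoffel g e c j b y * (gram g e y c a * (gram g e y)⁻¹ a b) := fun a b => by ring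
    simp only [this]
    rw [Finset.sum_comm]
    simp only [← Finset.mul_sum, ← Matrix.mul_apply, hg.gram_mul_inv he hy, Matrix.one_apply]
    simp
  have h5 : ∀ c, ∑ a, ∑ b, (gram g e y)⁻¹ a b * (christoffel g e c j a y * gram g e y b c) =
      christoffel g e c j c y := by
    intro c
    rw [← h4 c, Finset.sum_comm]
    refine Finset.sum_congr rfl fun a _ => Finset.sum_congr rfl fun b _ => ?_
    rw [hg.gram_inv_symm y b a, hg.gram_symm y a c]
  have h6 : ∑ a, ∑ b, ((gram g e y)⁻¹ a b * ∑ c, (christoffel g e c j b y * gram g e y c a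
      + christoffel g e c j a y * gram g e y b c)) =
      ∑ l, christoffel g e l j l y + ∑ l, christoffel g e l j l y := by
    simp only [Finset.mul_sum, mul_add, Finset.sum_add_distrib]
    have s1 : ∀ f : Fin n → Fin n → Fin n → ℝ, ∑ a, ∑ b, ∑ c, f a b c = ∑ c, ∑ a, ∑ b, f a b c := by
      intro f
      rw [Finset.sum_comm]
      rw [Finset.sum_congr rfl fun b _ => Finset.sum_comm, Finset.sum_comm]
      exact Finset.sum_congr rfl fun c _ => Finset.sum_comm
    exact congrArg₂ (· + ·) ((s1 _).trans (Finset.sum_congr rfl fun c _ => h4 c))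
      ((s1 _).trans (Finset.sum_congr rfl fun c _ => h5 c))
  have h7 : ∑ l, christoffel g e l l j y = ∑ l, christoffel g e l j l y :=
    Finset.sum_congr rfl fun l _ => hg.christoffel_symm _ _ _ _
  have h8 : ∀ X : Fin n → Fin n → ℝ, (gram g e y).det⁻¹ * ∑ a, ∑ b, (gram g e y).adjugate a b * X a b
      = ∑ a, ∑ b, (gram g e y)⁻¹ a b * X a b := by
    intro X
    simp only [Finset.mul_sum, ← mul_assoc, hinv]
  simp only [smul_apply, sum_apply, smul_eq_mul, h2]
  rw [h8]
  simp only [hg.pderiv_gram he hy]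
  rw [h6, h7]
  ring

theorem pderiv_potential (hg : IsRiemannian g) (Ω : VolumeForm n M)
    (he : e ∈ atlas (Coord n) M) {y : Coord n} (hy : y ∈ e.target) (j : Fin n) :
    pderiv j (fun y => potential Ω g (e.symm y)) y = ∑ l, christoffel g e l l j y
      - pderiv j (fun y => Real.log (Ω.form (e.symm y) (coordVec e y))) y := by
  have hev : (fun y => potential Ω g (e.symm y)) =ᶠ[nhds y] fun y =>
      2⁻¹ * Real.log (gram g e y).det - Real.log (Ω.form (e.symm y) (coordVec e y)) :=
    Filter.Eventually.mono (e.open_target.mem_nhds hy) fun z hz => potential_eq he Ω hg hz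
  have hn := e.open_target.mem_nhds hy
  have h1 : ContDiffAt ℝ ∞ (fun y => 2⁻¹ * Real.log (gram g e y).det) y :=
    contDiffAt_const.mul (((contDiffOn_det fun i j => hg.smooth e he ![i, j]).contDiffAt hn).log
      (hg.det_gram_pos he hy).ne')
  have h2 : ContDiffAt ℝ ∞ (fun y => Real.log (Ω.form (e.symm y) (coordVec e y))) y :=
    ((Ω.smooth e he).contDiffAt hn).log (Ω.form_coordVec_ne_zero he hy)
  rw [← hg.pderiv_log_det_gram he hy, pderiv, hev.fderiv_eq,
    fderiv_fun_sub (h1.differentiableAt (by simp)) (h2.differentiableAt (by simp))]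
  rfl

end Metric

end BakryEmery

namespace BakryEmery

variable {n : ℕ} {M : Type*} [TopologicalSpace M] [ChartedSpace (Coord n) M] {p q : ℕ}
  {e e' : OpenPartialHomeomorph M (Coord n)}

/-- The time derivative of the Christoffel symbols of a family of metrics. -/
noncomputable def christoffelDeriv (g : ℝ → TensorField n M 2)
    (e : OpenPartialHomeomorph M (Coord n)) (t : ℝ) (k i j : Fin n) (y : Coord n) : ℝ :=
  deriv (fun s => christoffel (g s) e k i j y) t

theorem pderiv_congr {f f' : Coord n → ℝ} {V : Set (Coord n)} (hV : IsOpen V)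
    (h : ∀ z ∈ V, f z = f' z) {y : Coord n} (hy : y ∈ V) (i : Fin n) :
    pderiv i f y = pderiv i f' y := by
  have hev : f =ᶠ[nhds y] f' := Filter.Eventually.mono (hV.mem_nhds hy) h
  rw [pderiv, hev.fderiv_eq, pderiv]

theorem pderiv_sum {κ : Type*} [Fintype κ] {f : κ → Coord n → ℝ} {y : Coord n}
    (h : ∀ k, DifferentiableAt ℝ (f k) y) (i : Fin n) :
    pderiv i (fun y => ∑ k, f k y) y = ∑ k, pderiv i (f k) y := by
  rw [pderiv, fderiv_fun_sum fun k _ => h k]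
  simp [pderiv]

theorem pderiv_mul {f f' : Coord n → ℝ} {y : Coord n}
    (h : DifferentiableAt ℝ f y) (h' : DifferentiableAt ℝ f' y) (i : Fin n) :
    pderiv i (fun y => f y * f' y) y = pderiv i f y * f' y + f y * pderiv i f' y := by
  rw [pderiv, fderiv_fun_mul h h']
  simp [pderiv]
  ring

theorem nablaComp_one (g : TensorField n M 2) (α : TensorField n M 1) (i j : Fin n)
    (y : Coord n) : nablaComp g α e ![i, j] y = pderiv i (tcomp α e ![j]) y
      - ∑ l, christoffel g e l i j y * tcomp α e ![l] y := by
  simp only [nablaComp, Finset.univ_unique, Finset.sum_singleton]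
  congr 1
  refine Finset.sum_congr rfl fun l _ => ?_
  congr 2
  funext k
  fin_cases k; rfl

theorem nablaComp_two (g : TensorField n M 2) (α : TensorField n M 2) (k i j : Fin n)
    (y : Coord n) : nablaComp g α e ![k, i, j] y = pderiv k (tcomp α e ![i, j]) y
      - ((∑ l, christoffel g e l k i y * tcomp α e ![l, j] y)
        + ∑ l, christoffel g e l k j y * tcomp α e ![i, l] y) := by
  simp only [nablaComp, Fin.sum_univ_two]
  congr 2
  · refine Finset.sum_congr rfl fun l _ => ?_
    congr 2
    funext k
    fin_cases k <;> rfl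
  · refine Finset.sum_congr rfl fun l _ => ?_
    congr 2
    funext k
    fin_cases k <;> rfl

theorem nablaComp_three (g : TensorField n M 2) (α : TensorField n M 3) (k l i j : Fin n)
    (y : Coord n) : nablaComp g α e ![k, l, i, j] y = pderiv k (tcomp α e ![l, i, j]) y
      - ((∑ m, christoffel g e m k l y * tcomp α e ![m, i, j] y)
        + (∑ m, christoffel g e m k i y * tcomp α e ![l, m, j] y)
        + ∑ m, christoffel g e m k j y * tcomp α e ![l, i, m] y) := by
  simp only [nablaComp, Fin.sum_univ_three]
  congr 2
  · congr 1
    · refine Finset.sum_congr rfl fun l _ => ?_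
      congr 2
      funext k
      fin_cases k <;> rfl
    · refine Finset.sum_congr rfl fun l _ => ?_
      congr 2
      funext k
      fin_cases k <;> rfl
  · refine Finset.sum_congr rfl fun l _ => ?_
    congr 2
    funext k
    fin_cases k <;> rfl

theorem tcomp_symNabla_two (g : TensorField n M 2) (α : TensorField n M 2) (l i j : Fin n)
    (y : Coord n) : tcomp (symNabla g α) e ![l, i, j] y = tcomp (nabla g α) e ![l, i, j] y
      + tcomp (nabla g α) e ![i, l, j] y + tcomp (nabla g α) e ![j, l, i] y := by
  rw [tcomp_symNabla, Fin.sum_univ_three]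
  have h0 : (fun k => ![l, i, j] ((0 : Fin 3).cycleRange.symm k)) = ![l, i, j] := by
    funext k
    fin_cases k <;> rfl
  have h1 : (fun k => ![l, i, j] ((1 : Fin 3).cycleRange.symm k)) = ![i, l, j] := by
    funext k
    fin_cases k <;> rfl
  have h2 : (fun k => ![l, i, j] ((2 : Fin 3).cycleRange.symm k)) = ![j, l, i] := by
    funext k
    fin_cases k <;> rfl
  rw [h0, h1, h2]

theorem lower_index_identity (G : Fin n → Fin n → ℝ) (Γ C : Fin n → Fin n → Fin n → ℝ)
    (dC : Fin n → ℝ) (w d : ℝ) (k l i j : Fin n) :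
    -(w * d) * (2 * ∑ m, G l m * C m i j) + w * (2 * ∑ m,
        ((∑ p, (Γ p k l * G p m + Γ p k m * G l p)) * C m i j + G l m * dC m))
      - ((∑ m, Γ m k l * (w * (2 * ∑ q, G m q * C q i j)))
        + (∑ m, Γ m k i * (w * (2 * ∑ q, G l q * C q m j)))
        + ∑ m, Γ m k j * (w * (2 * ∑ q, G l q * C q i m)))
    = 2 * w * ∑ m, G l m * (dC m - d * C m i j
        + ∑ q, (Γ m k q * C q i j - Γ q k i * C m q j - Γ q k j * C m i q)) := by
  have h1 : ∑ m, (∑ p, (Γ p k l * G p m + Γ p k m * G l p)) * C m i j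
      = ∑ m, Γ m k l * ∑ q, G m q * C q i j + ∑ m, G l m * ∑ q, Γ m k q * C q i j := by
    simp only [Finset.sum_add_distrib, add_mul, Finset.sum_mul, Finset.mul_sum]
    congr 1
    · rw [Finset.sum_comm]
      exact Finset.sum_congr rfl fun a _ => Finset.sum_congr rfl fun b _ => by ring
    · rw [Finset.sum_comm]
      exact Finset.sum_congr rfl fun a _ => Finset.sum_congr rfl fun b _ => by ring
  have h2 : ∀ X : Fin n → ℝ, ∑ m, Γ m k l * (w * (2 * X m)) = 2 * w * ∑ m, Γ m k l * X m := by
    intro X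
    rw [Finset.mul_sum]
    exact Finset.sum_congr rfl fun a _ => by ring
  have h3 : ∀ (a : Fin n) (X : Fin n → Fin n → ℝ),
      ∑ m, Γ m k a * (w * (2 * ∑ q, G l q * X q m))
      = 2 * w * ∑ m, G l m * ∑ q, Γ q k a * X m q := by
    intro a X
    simp only [Finset.mul_sum]
    rw [Finset.sum_comm]
    exact Finset.sum_congr rfl fun a _ => Finset.sum_congr rfl fun b _ => by ring
  have h4 : ∑ m, G l m * (d * C m i j) = d * ∑ m, G l m * C m i j := by
    rw [Finset.mul_sum]
    exact Finset.sum_congr rfl fun a _ => by ring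
  rw [h2, h3 i fun q m => C q m j, h3 j fun q m => C q i m]
  simp only [mul_add, mul_sub, Finset.sum_add_distrib, Finset.sum_sub_distrib]
  simp only [Finset.sum_add_distrib] at h1
  rw [h1, h4]
  ring

variable [IsManifold (𝓡 n) ∞ M] {J : Set ℝ} {g : ℝ → TensorField n M 2} {t : ℝ}

section
variable (hJ : IsOpen J) (hg : ∀ t ∈ J, IsRiemannian (g t)) (hsmooth : IsSmoothFamily J g)
  (ht : t ∈ J) (he : e ∈ atlas (Coord n) M)
include hJ hg hsmooth ht he

theorem hasDerivAt_christoffel {y : Coord n} (hy : y ∈ e.target) (k i j : Fin n) :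
    HasDerivAt (fun s => christoffel (g s) e k i j y) (christoffelDeriv g e t k i j y) t :=
  (hasDerivAt_slice hJ e.open_target (hsmooth.contDiffOn_christoffel hJ hg he k i j) ht
    hy).differentiableAt.hasDerivAt

theorem hasDerivAt_pderiv_christoffel {y : Coord n} (hy : y ∈ e.target) (l k i j : Fin n) :
    HasDerivAt (fun s => pderiv l (christoffel (g s) e k i j) y)
      (pderiv l (christoffelDeriv g e t k i j) y) t :=
  hasDerivAt_pderiv_slice hJ e.open_target (hsmooth.contDiffOn_christoffel hJ hg he k i j) ht
    hy l

theorem contDiffOn_christoffelDeriv (k i j : Fin n) :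
    ContDiffOn ℝ ∞ (christoffelDeriv g e t k i j) e.target :=
  contDiffOn_slice (contDiffOn_deriv_slice hJ e.open_target
    (hsmooth.contDiffOn_christoffel hJ hg he k i j)) ht

theorem differentiableAt_christoffelDeriv {y : Coord n} (hy : y ∈ e.target) (k i j : Fin n) :
    DifferentiableAt ℝ (christoffelDeriv g e t k i j) y :=
  ((contDiffOn_christoffelDeriv hJ hg hsmooth ht he k i j).contDiffAt
    (e.open_target.mem_nhds hy)).differentiableAt (by simp)

theorem hasDerivAt_pderiv_potential (Ω : VolumeForm n M) {y : Coord n} (hy : y ∈ e.target)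
    (j : Fin n) :
    HasDerivAt (fun s => pderiv j (fun y => potential Ω (g s) (e.symm y)) y)
      (∑ l, christoffelDeriv g e t l l j y) t := by
  have hev : (fun s => pderiv j (fun y => potential Ω (g s) (e.symm y)) y) =ᶠ[nhds t]
      fun s => ∑ l, christoffel (g s) e l l j y
      - pderiv j (fun y => Real.log (Ω.form (e.symm y) (coordVec e y))) y :=
    Filter.Eventually.mono (hJ.mem_nhds ht) fun s hs => pderiv_potential (hg s hs) Ω he hy j
  refine HasDerivAt.congr_of_eventuallyEq ?_ hev
  exact (HasDerivAt.fun_sum fun l _ =>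
    hasDerivAt_christoffel hJ hg hsmooth ht he hy l l j).sub_const _

theorem hasDerivAt_pderiv_pderiv_potential (Ω : VolumeForm n M) {y : Coord n} (hy : y ∈ e.target)
    (i j : Fin n) :
    HasDerivAt (fun s => pderiv i (pderiv j (fun y => potential Ω (g s) (e.symm y))) y)
      (∑ l, pderiv i (christoffelDeriv g e t l l j) y) t := by
  have h := hasDerivAt_pderiv_slice hJ e.open_target
    (contDiffOn_pderiv_slice hJ e.open_target (contDiffOn_potential hsmooth hg Ω he) j) ht hy i
  rw [pderiv_congr e.open_target (fun z hz =>
    (hasDerivAt_pderiv_potential hJ hg hsmooth ht he Ω hz j).deriv) hy, pderiv_sum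
    fun l => differentiableAt_christoffelDeriv hJ hg hsmooth ht he hy l l j] at h
  exact h

theorem hasDerivAt_ricci_add_hessian (Ω : VolumeForm n M) {y : Coord n} (hy : y ∈ e.target)
    (i j : Fin n) :
    HasDerivAt (fun s => ∑ l, riemannComp (g s) e l l i j y
        + nablaComp (g s) (differential (potential Ω (g s))) e ![i, j] y)
      (∑ l, (pderiv l (christoffelDeriv g e t l i j) y
          - christoffelDeriv g e t l i j y * pderiv l (fun y => potential Ω (g t) (e.symm y)) y
          + ∑ m, (christoffel (g t) e l l m y * christoffelDeriv g e t m i j y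
            - christoffelDeriv g e t l i m y * christoffel (g t) e m l j y
            - christoffel (g t) e l i m y * christoffelDeriv g e t m l j y))) t := by
  have hΓ := fun k i j => hasDerivAt_christoffel hJ hg hsmooth ht he hy k i j
  have hdΓ := fun l k i j => hasDerivAt_pderiv_christoffel hJ hg hsmooth ht he hy l k i j
  have hf := fun j => hasDerivAt_pderiv_potential hJ hg hsmooth ht he Ω hy j
  have hev : (fun s => nablaComp (g s) (differential (potential Ω (g s))) e ![i, j] y) =ᶠ[nhds t]
      fun s => pderiv i (pderiv j (fun y => potential Ω (g s) (e.symm y))) y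
      - ∑ l, christoffel (g s) e l i j y * pderiv l (fun y => potential Ω (g s) (e.symm y)) y := by
    refine Filter.Eventually.mono (hJ.mem_nhds ht) fun s hs => ?_
    have hu := isSmoothFun_potential (hg s hs) Ω
    change nablaComp _ _ _ _ _ = _
    rw [nablaComp_one, pderiv_congr e.open_target (fun z hz => tcomp_differential hu he hz ![j]) hy]
    simp only [tcomp_differential hu he hy]
    rfl
  have h1 := HasDerivAt.fun_sum (u := Finset.univ) (fun l _ => ((hdΓ l l i j).sub (hdΓ i l l j)).add
    (HasDerivAt.fun_sum (u := Finset.univ) (fun m _ => ((hΓ l l m).mul (hΓ m i j)).sub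
      ((hΓ l i m).mul (hΓ m l j)))))
  have h2 := ((hasDerivAt_pderiv_pderiv_potential hJ hg hsmooth ht he Ω hy i j).sub
    (HasDerivAt.fun_sum (u := Finset.univ) (fun l _ => (hΓ l i j).mul (hf l)))).congr_of_eventuallyEq
      hev
  refine (h1.add h2).congr_deriv ?_
  have h3 : ∑ l, ∑ m, christoffelDeriv g e t l l m y * christoffel (g t) e m i j y
      = ∑ l, christoffel (g t) e l i j y * ∑ m, christoffelDeriv g e t m m l y := by
    rw [Finset.sum_comm]
    refine Finset.sum_congr rfl fun l _ => ?_
    rw [Finset.mul_sum]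
    exact Finset.sum_congr rfl fun m _ => mul_comm _ _
  simp only [Finset.sum_add_distrib, Finset.sum_sub_distrib]
  rw [h3]
  ring

theorem tcomp_timeDeriv_symm {y : Coord n} (hy : y ∈ e.target) (a b : Fin n) :
    tcomp (timeDeriv g t) e ![a, b] y = tcomp (timeDeriv g t) e ![b, a] y := by
  rw [tcomp_timeDeriv hJ hsmooth ht he hy, tcomp_timeDeriv hJ hsmooth ht he hy]
  refine Filter.EventuallyEq.deriv_eq ?_
  exact Filter.Eventually.mono (hJ.mem_nhds ht) fun s hs => (hg s hs).gram_symm y a b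

theorem two_mul_sum_gram_mul_christoffelDeriv {y : Coord n} (hy : y ∈ e.target) (l i j : Fin n) :
    tcomp (opD (g t) (timeDeriv g t)) e ![l, i, j] y =
      2 * ∑ m, gram (g t) e y l m * christoffelDeriv g e t m i j y := by
  have hh := hsmooth.isSmooth_timeDeriv hJ ht
  have hG : ∀ a b, HasDerivAt (fun s => gram (g s) e y a b)
      (tcomp (timeDeriv g t) e ![a, b] y) t := by
    intro a b
    rw [tcomp_timeDeriv hJ hsmooth ht he hy]
    exact (hasDerivAt_slice hJ e.open_target (hsmooth e he ![a, b]) ht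
      hy).differentiableAt.hasDerivAt
  have hdG : ∀ k a b, HasDerivAt (fun s => pderiv k (tcomp (g s) e ![a, b]) y)
      (pderiv k (tcomp (timeDeriv g t) e ![a, b]) y) t := by
    intro k a b
    rw [pderiv_congr e.open_target (fun z hz => tcomp_timeDeriv hJ hsmooth ht he hz ![a, b]) hy]
    exact hasDerivAt_pderiv_slice hJ e.open_target (hsmooth e he ![a, b]) ht hy k
  have h1 := (HasDerivAt.fun_sum (u := Finset.univ) (fun k _ => (hG l k).mul
    (hasDerivAt_christoffel hJ hg hsmooth ht he hy k i j))).const_mul (2 : ℝ)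
  have h2 := ((hdG i j l).add (hdG j i l)).sub (hdG l i j)
  have h3 := h1.unique (h2.congr_of_eventuallyEq (Filter.Eventually.mono (hJ.mem_nhds ht)
    fun s hs => (hg s hs).sum_gram_mul_christoffel he hy i j l))
  have h4 : tcomp (opD (g t) (timeDeriv g t)) e ![l, i, j] y =
      tcomp (symNabla (g t) (timeDeriv g t)) e ![l, i, j] y
        - 2 * tcomp (nabla (g t) (timeDeriv g t)) e ![l, i, j] y := rfl
  rw [h4, tcomp_symNabla_two]
  simp only [tcomp_nabla (hg t ht) hh he hy, nablaComp_two]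
  have hsym := fun a b => tcomp_timeDeriv_symm hJ hg hsmooth ht he hy a b
  have d1 := pderiv_congr e.open_target
    (fun z hz => tcomp_timeDeriv_symm hJ hg hsmooth ht he hz l i) hy j
  have d2 := pderiv_congr e.open_target
    (fun z hz => tcomp_timeDeriv_symm hJ hg hsmooth ht he hz l j) hy i
  have c2 : ∑ m, christoffel (g t) e m i l y * tcomp (timeDeriv g t) e ![m, j] y =
      ∑ m, christoffel (g t) e m l i y * tcomp (timeDeriv g t) e ![m, j] y :=
    Finset.sum_congr rfl fun m _ => by rw [(hg t ht).christoffel_symm]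
  have c3 : ∑ m, christoffel (g t) e m j l y * tcomp (timeDeriv g t) e ![m, i] y =
      ∑ m, christoffel (g t) e m l j y * tcomp (timeDeriv g t) e ![i, m] y :=
    Finset.sum_congr rfl fun m _ => by rw [(hg t ht).christoffel_symm, hsym]
  have c4 : ∑ m, christoffel (g t) e m j i y * tcomp (timeDeriv g t) e ![l, m] y =
      ∑ m, christoffel (g t) e m i j y * tcomp (timeDeriv g t) e ![l, m] y :=
    Finset.sum_congr rfl fun m _ => by rw [(hg t ht).christoffel_symm]
  have c5 : ∑ m, tcomp (timeDeriv g t) e ![l, m] y * christoffel (g t) e m i j y =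
      ∑ m, christoffel (g t) e m i j y * tcomp (timeDeriv g t) e ![l, m] y :=
    Finset.sum_congr rfl fun m _ => mul_comm _ _
  rw [Finset.sum_add_distrib, c5] at h3
  rw [c2, c3, c4, d1, d2]
  linarith

theorem tcomp_divergence_fsmul_opD (Ω : VolumeForm n M) {y : Coord n} (hy : y ∈ e.target)
    (i j : Fin n) :
    tcomp (divergence (g t) (fsmul (fun x => Real.exp (-potential Ω (g t) x))
        (opD (g t) (timeDeriv g t)))) e ![i, j] y =
      Real.exp (-potential Ω (g t) (e.symm y)) * (2 *
      ∑ l, (pderiv l (christoffelDeriv g e t l i j) y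
          - christoffelDeriv g e t l i j y * pderiv l (fun y => potential Ω (g t) (e.symm y)) y
          + ∑ m, (christoffel (g t) e l l m y * christoffelDeriv g e t m i j y
            - christoffelDeriv g e t l i m y * christoffel (g t) e m l j y
            - christoffel (g t) e l i m y * christoffelDeriv g e t m l j y))) := by
  have hgt := hg t ht
  have hu := isSmoothFun_potential hgt Ω
  have hu' : IsSmoothFun n (fun x => Real.exp (-potential Ω (g t) x)) :=
    fun e he => (hu e he).neg.exp
  have hh := hsmooth.isSmooth_timeDeriv hJ ht
  have hD : IsSmooth (opD (g t) (timeDeriv g t)) :=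
    (hh.symNabla hgt).sub ((hh.nabla hgt).const_smul 2)
  set C := christoffelDeriv g e t with hC
  set Γ := fun k i j => christoffel (g t) e k i j y with hΓ
  set w := Real.exp (-potential Ω (g t) (e.symm y)) with hw
  set df := fun l => pderiv l (fun y => potential Ω (g t) (e.symm y)) y with hdf
  have hB : ∀ l i j, ∀ z ∈ e.target, tcomp (fsmul (fun x => Real.exp (-potential Ω (g t) x))
      (opD (g t) (timeDeriv g t))) e ![l, i, j] z = Real.exp (-potential Ω (g t) (e.symm z)) *
        (2 * ∑ m, gram (g t) e z l m * C m i j z) := by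
    intro l i j z hz
    rw [← two_mul_sum_gram_mul_christoffelDeriv hJ hg hsmooth ht he hz]
    rfl
  have hpot : HasFDerivAt (fun y => potential Ω (g t) (e.symm y)) _ y :=
    (((hu e he).contDiffAt (e.open_target.mem_nhds hy)).differentiableAt (by simp)).hasFDerivAt
  have hexp : HasFDerivAt (fun z => Real.exp (-potential Ω (g t) (e.symm z)))
    (w • -fderiv ℝ (fun y => potential Ω (g t) (e.symm y)) y) y := hpot.neg.exp
  have hwd : ∀ k, pderiv k (fun z => Real.exp (-potential Ω (g t) (e.symm z))) y = -(w * df k) := by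
    intro k
    rw [pderiv, hexp.fderiv]
    simp [hdf, pderiv]
  have hGd : ∀ l m, DifferentiableAt ℝ (tcomp (g t) e ![l, m]) y := fun l m =>
    ((hgt.smooth e he ![l, m]).contDiffAt (e.open_target.mem_nhds hy)).differentiableAt (by simp)
  have hCd := fun k i j => differentiableAt_christoffelDeriv hJ hg hsmooth ht he hy k i j
  have hdB : ∀ k l, pderiv k (tcomp (fsmul (fun x => Real.exp (-potential Ω (g t) x))
      (opD (g t) (timeDeriv g t))) e ![l, i, j]) y =
      -(w * df k) * (2 * ∑ m, gram (g t) e y l m * C m i j y)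
      + w * (2 * ∑ m, ((∑ p, (Γ p k l * gram (g t) e y p m + Γ p k m * gram (g t) e y l p))
        * C m i j y + gram (g t) e y l m * pderiv k (C m i j) y)) := by
    intro k l
    rw [pderiv_congr e.open_target (hB l i j) hy]
    have hs : DifferentiableAt ℝ (fun z => ∑ m, gram (g t) e z l m * C m i j z) y :=
      DifferentiableAt.fun_sum fun m _ => (hGd l m).mul (hCd m i j)
    rw [pderiv_mul hexp.differentiableAt (hs.const_mul 2), hwd]
    congr 2
    have hsd : pderiv k (fun z => ∑ m, gram (g t) e z l m * C m i j z) y =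
        ∑ m, (pderiv k (tcomp (g t) e ![l, m]) y * C m i j y
          + gram (g t) e y l m * pderiv k (C m i j) y) := by
      refine (pderiv_sum (f := fun m z => tcomp (g t) e ![l, m] z * C m i j z)
        (fun m => (hGd l m).mul (hCd m i j)) k).trans ?_
      exact Finset.sum_congr rfl fun m _ => pderiv_mul (hGd l m) (hCd m i j) k
    have h2 : pderiv k (fun _ : Coord n => (2 : ℝ)) y = 0 := by simp [pderiv]
    rw [pderiv_mul (differentiableAt_const _) hs, h2, zero_mul, zero_add, hsd]
    simp only [hgt.pderiv_gram he hy, hΓ]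
  have hY : ∀ k l, tcomp (nabla (g t) (fsmul (fun x => Real.exp (-potential Ω (g t) x))
      (opD (g t) (timeDeriv g t)))) e ![k, l, i, j] y = 2 * w * ∑ m, gram (g t) e y l m *
        (pderiv k (C m i j) y - df k * C m i j y + ∑ q, (Γ m k q * C q i j y
          - Γ q k i * C m q j y - Γ q k j * C m i q y)) := by
    intro k l
    rw [tcomp_nabla hgt (hD.fsmul hu') he hy, nablaComp_three, hdB]
    simp only [hB _ _ _ y hy]
    exact lower_index_identity (gram (g t) e y) Γ (fun m i j => C m i j y)
      (fun m => pderiv k (C m i j) y) w (df k) k l i j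
  rw [divergence, tcomp_traceFirst _ _ he hy]
  have hY' : ∀ k l, tcomp (nabla (g t) (fsmul (fun x => Real.exp (-potential Ω (g t) x))
      (opD (g t) (timeDeriv g t)))) e (Fin.cons k (Fin.cons l ![i, j])) y = _ := hY
  simp only [hY']
  have hcontr : ∀ Y : Fin n → Fin n → ℝ, ∑ k, ∑ l, (gram (g t) e y)⁻¹ k l *
      (2 * w * ∑ m, gram (g t) e y l m * Y k m) = w * (2 * ∑ k, Y k k) := by
    intro Y
    rw [← mul_assoc, mul_comm w, Finset.mul_sum]
    refine Finset.sum_congr rfl fun k _ => ?_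
    have h1 : Matrix.mulVec (gram (g t) e y)⁻¹ (Matrix.mulVec (gram (g t) e y) (Y k)) = Y k := by
      rw [Matrix.mulVec_mulVec, hgt.gram_inv_mul he hy, Matrix.one_mulVec]
    conv_rhs => rw [← congrFun h1 k]
    simp only [Matrix.mulVec, dotProduct]
    rw [Finset.mul_sum]
    refine Finset.sum_congr rfl fun l _ => ?_
    ring
  rw [hcontr]
  congr 2
  simp only [Finset.sum_add_distrib, Finset.sum_sub_distrib]
  have h1 : ∑ k, ∑ q, Γ q k i * C k q j y = ∑ l, ∑ m, christoffel (g t) e l i m y * C m l j y := by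
    rw [Finset.sum_comm]
    refine Finset.sum_congr rfl fun l _ => Finset.sum_congr rfl fun m _ => ?_
    rw [hgt.christoffel_symm l i m]
  have h2 : ∑ k, ∑ q, Γ q k j * C k i q y = ∑ l, ∑ m, C l i m y * christoffel (g t) e m l j y :=
    Finset.sum_congr rfl fun l _ => Finset.sum_congr rfl fun m _ => mul_comm _ _
  have h3 : ∑ k, df k * C k i j y = ∑ l, C l i j y * df l :=
    Finset.sum_congr rfl fun l _ => mul_comm _ _
  rw [h1, h2, h3]
  ring

end

end BakryEmery

namespace BakryEmery
open MeasureTheory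

section ModelMeasurable
variable {n : ℕ} {X : Type*} [TopologicalSpace X] [MeasurableSpace X] [BorelSpace X]

theorem aemeasurable_symm (e : OpenPartialHomeomorph X (Coord n)) :
    AEMeasurable e.symm (volume.restrict e.target) :=
  e.continuousOn_symm.aemeasurable e.open_target.measurableSet

theorem measurableSet_target_inter (e : OpenPartialHomeomorph X (Coord n)) {B : Set X}
    (hB : MeasurableSet B) : MeasurableSet (e.target ∩ e.symm ⁻¹' B) := by
  have h := (continuousOn_iff_continuous_domRestrict.1 e.continuousOn_symm).measurable hB
  have h2 := e.open_target.measurableSet.subtype_image h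
  convert h2 using 1
  ext y
  simp [and_comm]

end ModelMeasurable

variable {n : ℕ} {M : Type*} [TopologicalSpace M] [ChartedSpace (Coord n) M] {p q : ℕ}
  {e e' : OpenPartialHomeomorph M (Coord n)} {g : TensorField n M 2}

theorem IsSmooth.continuousOn_det_gram (hg : IsSmooth g) (he : e ∈ atlas (Coord n) M) :
    ContinuousOn (fun y => √ (gram g e y).det) e.target :=
  (contDiffOn_det fun i j => hg e he ![i, j]).continuousOn.sqrt

variable [MeasurableSpace M] 

/-- The measure `√ det (g_{ij}) dx` on the domain of a chart. -/
noncomputable def chartMeasure (g : TensorField n M 2) (e : OpenPartialHomeomorph M (Coord n)) :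
    Measure M :=
  Measure.map e.symm ((volume.restrict e.target).withDensity
      (fun y => ENNReal.ofReal (√ (gram g e y).det)))

variable [BorelSpace M]

theorem chartMeasure_apply (e : OpenPartialHomeomorph M (Coord n)) {B : Set M}
    (hB : MeasurableSet B) : chartMeasure g e B =
      ∫⁻ y in e.target ∩ e.symm ⁻¹' B, ENNReal.ofReal (√ (gram g e y).det) := by
  have hae := aemeasurable_symm e
  have hm : NullMeasurableSet (e.symm ⁻¹' B) (volume.restrict e.target) := hae.nullMeasurable hB
  rw [chartMeasure, Measure.map_apply_of_aemeasurable
    (hae.mono_ac (withDensity_absolutelyContinuous _ _)) hB,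
    withDensity_apply₀ _ hm, Measure.restrict_restrict₀ hm, Set.inter_comm]

theorem chartMeasure_inter_source (e : OpenPartialHomeomorph M (Coord n)) {B : Set M}
    (hB : MeasurableSet B) : chartMeasure g e (B ∩ e.source) = chartMeasure g e B := by
  rw [chartMeasure_apply e hB, chartMeasure_apply e (hB.inter e.open_source.measurableSet)]
  congr 2
  ext y
  simp only [Set.mem_inter_iff, Set.mem_preimage]
  exact ⟨fun h => ⟨h.1, h.2.1⟩, fun h => ⟨h.1, h.2, e.map_target h.1⟩⟩

variable [IsManifold (𝓡 n) ∞ M]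

theorem chartMeasure_eq (g : TensorField n M 2) (he : e ∈ atlas (Coord n) M)
    (he' : e' ∈ atlas (Coord n) M) {B : Set M} (hB : MeasurableSet B) (h : B ⊆ e.source)
    (h' : B ⊆ e'.source) : chartMeasure g e B = chartMeasure g e' B := by
  rw [chartMeasure_apply e hB, chartMeasure_apply e' hB]
  have himg : (e' ∘ e.symm) '' (e.target ∩ e.symm ⁻¹' B) = e'.target ∩ e'.symm ⁻¹' B := by
    ext z
    constructor
    · rintro ⟨y, ⟨hy, hyB⟩, rfl⟩
      refine ⟨e'.map_source (h' hyB), ?_⟩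
      simpa [e'.left_inv (h' hyB)] using hyB
    · rintro ⟨hz, hzB⟩
      refine ⟨e (e'.symm z), ⟨e.map_source (h hzB), ?_⟩, ?_⟩
      · simpa [e.left_inv (h hzB)] using hzB
      · simp [e.left_inv (h hzB), e'.right_inv hz]
  have hinj : Set.InjOn (e' ∘ e.symm) (e.target ∩ e.symm ⁻¹' B) := by
    rintro y ⟨hy, hyB⟩ z ⟨hz, hzB⟩ heq
    exact e.symm.injOn hy hz (e'.injOn (h' hyB) (h' hzB) heq)
  have hd : ∀ y ∈ e.target ∩ e.symm ⁻¹' B, HasFDerivWithinAt (e' ∘ e.symm) (jac e e' y)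
      (e.target ∩ e.symm ⁻¹' B) y := fun y hy =>
    ((contDiffAt_change he he' hy.1 (h' hy.2)).differentiableAt
      (by simp)).hasFDerivAt.hasFDerivWithinAt
  rw [← himg, lintegral_image_eq_lintegral_abs_det_fderiv_mul volume
    (measurableSet_target_inter e hB) hd hinj]
  refine setLIntegral_congr_fun (measurableSet_target_inter e hB) fun y hy => ?_
  rw [sqrt_det_gram_change he he' g hy.1 (h' hy.2), ENNReal.ofReal_mul (abs_nonneg _)]
  rfl

variable [SecondCountableTopology M]

theorem exists_chart_partition (n : ℕ) (M : Type*) [TopologicalSpace M]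
    [ChartedSpace (Coord n) M] [MeasurableSpace M] [BorelSpace M] [SecondCountableTopology M]
    [Nonempty M] :
    ∃ (c : ℕ → OpenPartialHomeomorph M (Coord n)) (A : ℕ → Set M), (∀ k, c k ∈ atlas (Coord n) M) ∧
      (∀ k, MeasurableSet (A k)) ∧ (∀ k, A k ⊆ (c k).source) ∧
      Pairwise (Function.onFun Disjoint A) ∧ ⋃ k, A k = Set.univ := by
  obtain ⟨s, hs, hcov⟩ := TopologicalSpace.countable_cover_nhds
    (f := fun x : M => (chartAt (Coord n) x).source) (fun x => chart_source_mem_nhds (Coord n) x)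
  have hne : s.Nonempty := by
    rw [Set.nonempty_iff_ne_empty]
    rintro rfl
    obtain ⟨x⟩ := ‹Nonempty M›
    simpa using hcov.ge (Set.mem_univ x)
  obtain ⟨f, rfl⟩ := hs.exists_eq_range hne
  refine ⟨fun k => chartAt (Coord n) (f k), disjointed fun k => (chartAt (Coord n) (f k)).source,
    fun k => chart_mem_atlas _ _, ?_, ?_, disjoint_disjointed _, ?_⟩
  · exact fun k => MeasurableSet.disjointed (fun k => (chartAt (Coord n) (f k)).open_source.measurableSet) k
  · exact fun k => disjointed_subset _ k
  · rw [iUnion_disjointed]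
    simpa using hcov

theorem volumeMeasure_apply (g : TensorField n M 2) (he : e ∈ atlas (Coord n) M) {B : Set M}
    (hB : MeasurableSet B) (h : B ⊆ e.source) : volumeMeasure g B = chartMeasure g e B := by
  refine le_antisymm ?_ ((le_iSup₂ (f := fun (e : OpenPartialHomeomorph M (Coord n))
    (_ : e ∈ atlas (Coord n) M) => chartMeasure g e) e he) B)
  rcases isEmpty_or_nonempty M with hM | hM
  · rw [Set.eq_empty_of_isEmpty B]; simp
  obtain ⟨c, A, hc, hA, hAc, hdisj, hcov⟩ := exists_chart_partition n M
  have hsum : ∀ (e : OpenPartialHomeomorph M (Coord n)) (B : Set M), MeasurableSet B →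
      chartMeasure g e B = ∑' k, chartMeasure g e (B ∩ A k) := by
    intro e B hB
    rw [← measure_iUnion (fun i j hij => (hdisj hij).mono Set.inter_subset_right
      Set.inter_subset_right) (fun k => hB.inter (hA k)), ← Set.inter_iUnion, hcov, Set.inter_univ]
  set ν : Measure M := Measure.sum fun k => (chartMeasure g (c k)).restrict (A k) with hν
  have hνB : ∀ B : Set M, MeasurableSet B → ν B = ∑' k, chartMeasure g (c k) (B ∩ A k) := by
    intro B hB
    rw [hν, Measure.sum_apply _ hB]
    simp only [Measure.restrict_apply hB]
  have hle : volumeMeasure g ≤ ν := by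
    refine iSup₂_le fun e' he' => ?_
    refine Measure.le_iff.2 fun B hB => ?_
    rw [hνB B hB]
    refine (hsum e' B hB).trans_le (ENNReal.tsum_le_tsum fun k => ?_)
    have hm := hB.inter (hA k)
    have hm' := hm.inter e'.open_source.measurableSet
    rw [← chartMeasure_inter_source e' hm, chartMeasure_eq g he' (hc k) hm'
      Set.inter_subset_right (Set.inter_subset_left.trans (Set.inter_subset_right.trans (hAc k)))]
    exact measure_mono Set.inter_subset_left
  refine (hle B).trans_eq ?_
  rw [hνB B hB, hsum e B hB]
  refine tsum_congr fun k => ?_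
  exact chartMeasure_eq g (hc k) he (hB.inter (hA k)) (Set.inter_subset_right.trans (hAc k))
    (Set.inter_subset_left.trans h)

theorem volumeMeasure_restrict (g : TensorField n M 2) (he : e ∈ atlas (Coord n) M) :
    (volumeMeasure g).restrict e.source = chartMeasure g e := by
  ext B hB
  rw [Measure.restrict_apply hB, volumeMeasure_apply g he (hB.inter e.open_source.measurableSet)
    Set.inter_subset_right, chartMeasure_inter_source e hB]

theorem integral_volumeMeasure (hg : IsSmooth g) (he : e ∈ atlas (Coord n) M) {f : M → ℝ}
    (hf : ContinuousOn f e.source) (h0 : ∀ x ∉ e.source, f x = 0) :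
    ∫ x, f x ∂(volumeMeasure g) = ∫ y in e.target, √ (gram g e y).det * f (e.symm y) := by
  rw [← setIntegral_eq_integral_of_forall_compl_eq_zero h0]
  have hm : AEStronglyMeasurable f (chartMeasure g e) := by
    rw [← volumeMeasure_restrict g he]
    exact hf.aestronglyMeasurable e.open_source.measurableSet
  rw [volumeMeasure_restrict g he]
  have hac := withDensity_absolutelyContinuous (volume.restrict e.target)
    (fun y => ENNReal.ofReal (√ (gram g e y).det))
  rw [chartMeasure, integral_map ((aemeasurable_symm e).mono_ac hac) hm,
    integral_withDensity_eq_integral_toReal_smul₀]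
  · refine setIntegral_congr_fun e.open_target.measurableSet fun y _ => ?_
    simp [ENNReal.toReal_ofReal (Real.sqrt_nonneg _)]
  · exact ((hg.continuousOn_det_gram he).aemeasurable e.open_target.measurableSet).ennreal_ofReal
  · exact Filter.Eventually.of_forall fun y => ENNReal.ofReal_lt_top

variable [T2Space M]

theorem volumeMeasure_lt_top (hg : IsSmooth g) (he : e ∈ atlas (Coord n) M) {K : Set M}
    (hK : IsCompact K) (hKe : K ⊆ e.source) : volumeMeasure g K < ⊤ := by
  rw [volumeMeasure_apply g he hK.measurableSet hKe, chartMeasure_apply e hK.measurableSet]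
  have himg : e.target ∩ e.symm ⁻¹' K = e '' K := by
    ext y
    constructor
    · rintro ⟨hy, hyK⟩
      exact ⟨e.symm y, hyK, e.right_inv hy⟩
    · rintro ⟨x, hx, rfl⟩
      exact ⟨e.map_source (hKe hx), by simpa [e.left_inv (hKe hx)] using hx⟩
  rw [himg]
  have hc : IsCompact (e '' K) := hK.image_of_continuousOn (e.continuousOn.mono hKe)
  refine (ContinuousOn.integrableOn_compact hc
    ((hg.continuousOn_det_gram he).mono ?_)).setLIntegral_lt_top
  rw [← himg]
  exact Set.inter_subset_left

theorem integrable_volumeMeasure (hg : IsSmooth g) (he : e ∈ atlas (Coord n) M) {f : M → ℝ}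
    (hf : ContinuousOn f e.source) {K : Set M} (hK : IsCompact K) (hKe : K ⊆ e.source)
    (h0 : ∀ x ∉ K, f x = 0) : Integrable f (volumeMeasure g) := by
  rw [← integrableOn_iff_integrable_of_support_subset (s := K)
    (fun x hx => by_contra fun h => hx (h0 x h))]
  obtain ⟨C, hC⟩ := hK.exists_bound_of_continuousOn (hf.mono hKe)
  exact ⟨(hf.mono hKe).aestronglyMeasurable hK.measurableSet,
    .restrict_of_bounded (C := C) (volumeMeasure_lt_top hg he hK hKe)
      ((ae_restrict_iff' hK.measurableSet).2 (Filter.Eventually.of_forall hC))⟩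

end BakryEmery

namespace BakryEmery

section Algebra
variable {n p : ℕ}

theorem multiMat_one : multiMat p (1 : Matrix (Fin n) (Fin n) ℝ) = 1 := by
  ext I K
  rw [multiMat_apply]
  by_cases h : I = K
  · subst h; simp
  · obtain ⟨a, ha⟩ := Function.ne_iff.1 h
    rw [Matrix.one_apply_ne h]
    exact Finset.prod_eq_zero (Finset.mem_univ a) (Matrix.one_apply_ne ha)

theorem multiMat_cons (A : Matrix (Fin n) (Fin n) ℝ) (k l : Fin n) (I K : Fin p → Fin n) :
    multiMat (p + 1) A (Fin.cons k I) (Fin.cons l K) = A k l * multiMat p A I K := by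
  simp [multiMat_apply, Fin.prod_univ_succ]

theorem sum_cons (f : (Fin (p + 1) → Fin n) → ℝ) :
    ∑ I, f I = ∑ k, ∑ I : Fin p → Fin n, f (Fin.cons k I) := by
  rw [← (Fin.consEquiv (fun _ : Fin (p + 1) => Fin n)).sum_comp, Fintype.sum_prod_type]
  rfl

theorem sum_update (a : Fin p) (f : (Fin p → Fin n) → Fin n → ℝ) :
    ∑ I, ∑ m, f I m = ∑ I, ∑ m, f (Function.update I a m) (I a) := by
  rw [← Fintype.sum_prod_type', ← Fintype.sum_prod_type']
  have h : Function.Involutive (fun x : (Fin p → Fin n) × Fin n =>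
      (Function.update x.1 a x.2, x.1 a)) := by
    rintro ⟨I, m⟩
    simp
  exact (Equiv.sum_comp h.toPerm (fun x => f x.1 x.2)).symm

/-- The bilinear form on components defined by the tensor power of a matrix. -/
noncomputable def multiForm (A : Matrix (Fin n) (Fin n) ℝ) (a b : (Fin p → Fin n) → ℝ) : ℝ :=
  ∑ I, ∑ K, multiMat p A I K * (a I * b K)

theorem multiForm_succ (A : Matrix (Fin n) (Fin n) ℝ) (a b : (Fin (p + 1) → Fin n) → ℝ) :
    multiForm A a b = ∑ k, ∑ l, A k l *
      multiForm A (fun I => a (Fin.cons k I)) (fun I => b (Fin.cons l I)) := by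
  simp only [multiForm]
  rw [sum_cons]
  refine Finset.sum_congr rfl fun k _ => ?_
  simp only [sum_cons (p := p) (n := n), multiMat_cons, Finset.mul_sum]
  rw [Finset.sum_comm]
  refine Finset.sum_congr rfl fun l _ => Finset.sum_congr rfl fun I _ =>
    Finset.sum_congr rfl fun K _ => by ring

/-- The action of a matrix on components as a derivation. -/
noncomputable def derivAct (N : Matrix (Fin n) (Fin n) ℝ) (a : (Fin p → Fin n) → ℝ)
    (I : Fin p → Fin n) : ℝ :=
  ∑ k, ∑ m, N m (I k) * a (Function.update I k m)

theorem multiMat_update_mul (A N : Matrix (Fin n) (Fin n) ℝ) (I K : Fin p → Fin n) (a : Fin p) :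
    ∑ m, N (I a) m * multiMat p A (Function.update I a m) K =
      (∏ b ∈ Finset.univ.erase a, A (I b) (K b)) * (N * A) (I a) (K a) := by
  rw [Matrix.mul_apply, Finset.mul_sum]
  refine Finset.sum_congr rfl fun m _ => ?_
  rw [multiMat_apply, ← Finset.mul_prod_erase Finset.univ _ (Finset.mem_univ a)]
  have : ∏ b ∈ Finset.univ.erase a, A (Function.update I a m b) (K b) =
      ∏ b ∈ Finset.univ.erase a, A (I b) (K b) :=
    Finset.prod_congr rfl fun b hb => by rw [Function.update_of_ne (Finset.ne_of_mem_erase hb)]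
  rw [this, Function.update_self]
  ring

theorem multiForm_derivAct_left (A N : Matrix (Fin n) (Fin n) ℝ) (a b : (Fin p → Fin n) → ℝ) :
    multiForm A (derivAct N a) b = ∑ I, ∑ K,
      (∑ k, (∏ c ∈ Finset.univ.erase k, A (I c) (K c)) * (N * A) (I k) (K k)) * (a I * b K) := by
  have h : ∀ k : Fin p, ∑ I : Fin p → Fin n, ∑ m, (∑ K, N m (I k) * multiMat p A I K *
      (a (Function.update I k m) * b K)) = ∑ I : Fin p → Fin n, ∑ m,
      ∑ K, N (I k) m * multiMat p A (Function.update I k m) K * (a I * b K) := by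
    intro k
    rw [sum_update k]
    simp
  calc multiForm A (derivAct N a) b
      = ∑ k, ∑ I : Fin p → Fin n, ∑ m, (∑ K, N m (I k) * multiMat p A I K *
        (a (Function.update I k m) * b K)) := by
        simp only [multiForm, derivAct]
        conv_rhs => rw [Finset.sum_comm]
        refine Finset.sum_congr rfl fun I _ => ?_
        simp only [Finset.sum_mul, Finset.mul_sum]
        rw [Finset.sum_comm]
        refine Finset.sum_congr rfl fun k _ => ?_
        rw [Finset.sum_comm]
        refine Finset.sum_congr rfl fun m _ => Finset.sum_congr rfl fun K _ => by ring
    _ = ∑ k, ∑ I : Fin p → Fin n, ∑ m,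
        ∑ K, N (I k) m * multiMat p A (Function.update I k m) K * (a I * b K) :=
        Finset.sum_congr rfl fun k _ => h k
    _ = _ := by
        rw [Finset.sum_comm]
        refine Finset.sum_congr rfl fun I _ => ?_
        simp only [← multiMat_update_mul, Finset.sum_mul]
        conv_rhs => rw [Finset.sum_comm]
        exact Finset.sum_congr rfl fun k _ => Finset.sum_comm

theorem multiForm_derivAct_right (A N : Matrix (Fin n) (Fin n) ℝ) (a b : (Fin p → Fin n) → ℝ) :
    multiForm A a (derivAct N b) = ∑ I, ∑ K,
      (∑ k, (∏ c ∈ Finset.univ.erase k, A (I c) (K c)) * (A * N.transpose) (I k) (K k))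
        * (a I * b K) := by
  have h1 : multiForm A a (derivAct N b) = multiForm A.transpose (derivAct N b) a := by
    simp only [multiForm]
    rw [Finset.sum_comm]
    refine Finset.sum_congr rfl fun I _ => Finset.sum_congr rfl fun K _ => ?_
    rw [multiMat_transpose, Matrix.transpose_apply, mul_comm (a K)]
  rw [h1, multiForm_derivAct_left, Finset.sum_comm]
  refine Finset.sum_congr rfl fun I _ => Finset.sum_congr rfl fun K _ => ?_
  rw [mul_comm (b K)]
  congr 1
  refine Finset.sum_congr rfl fun k _ => ?_
  rw [← Matrix.transpose_transpose N, ← Matrix.transpose_mul, Matrix.transpose_apply,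
    Matrix.transpose_transpose]
  rfl

end Algebra

variable {n : ℕ} {M : Type*} [TopologicalSpace M] [ChartedSpace (Coord n) M] {p q : ℕ}
  {e e' : OpenPartialHomeomorph M (Coord n)} {g : TensorField n M 2}

theorem innerComp_eq_multiForm (α β : TensorField n M p) (y : Coord n) :
    innerComp g α β e y = multiForm (gram g e y)⁻¹ (fun I => tcomp α e I y)
      (fun I => tcomp β e I y) := rfl

/-- The matrix `(Γ^m_{kl})_{m,l}`. -/
noncomputable def connMat (g : TensorField n M 2) (e : OpenPartialHomeomorph M (Coord n))
    (k : Fin n) (y : Coord n) : Matrix (Fin n) (Fin n) ℝ :=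
  Matrix.of fun m l => christoffel g e m k l y

theorem nablaComp_cons (α : TensorField n M p) (k : Fin n) (I : Fin p → Fin n) (y : Coord n) :
    nablaComp g α e (Fin.cons k I) y = pderiv k (tcomp α e I) y
      - derivAct (connMat g e k y) (fun I => tcomp α e I y) I := by
  simp only [nablaComp, derivAct, Fin.cons_zero, Fin.cons_succ, Fin.tail_cons]
  rfl

theorem derivAct_cons (N : Matrix (Fin n) (Fin n) ℝ) (a : (Fin (p + 1) → Fin n) → ℝ) (l : Fin n)
    (I : Fin p → Fin n) : derivAct N a (Fin.cons l I) =
      ∑ m, N m l * a (Fin.cons m I) + derivAct N (fun I => a (Fin.cons l I)) I := by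
  simp only [derivAct, Fin.sum_univ_succ, Fin.cons_zero, Fin.cons_succ, Fin.update_cons_zero,
    Fin.cons_update]

section Leibniz
variable [IsManifold (𝓡 n) ∞ M]

theorem IsRiemannian.pderiv_gram_inv (hg : IsRiemannian g) (he : e ∈ atlas (Coord n) M)
    {y : Coord n} (hy : y ∈ e.target) (k i j : Fin n) :
    pderiv k (fun y => (gram g e y)⁻¹ i j) y = -((connMat g e k y * (gram g e y)⁻¹) i j
      + ((gram g e y)⁻¹ * (connMat g e k y).transpose) i j) := by
  have hn := e.open_target.mem_nhds hy
  have hid : ∀ a b, DifferentiableAt ℝ (fun y => (gram g e y)⁻¹ a b) y := fun a b =>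
    ((hg.contDiffOn_gram_inv he a b).contDiffAt hn).differentiableAt (by simp)
  have hgd : ∀ a b, DifferentiableAt ℝ (fun y => gram g e y a b) y := fun a b =>
    ((hg.smooth e he ![a, b]).contDiffAt hn).differentiableAt (by simp)
  set D : Matrix (Fin n) (Fin n) ℝ := Matrix.of fun a b => pderiv k (fun y => (gram g e y)⁻¹ a b) y
  set P : Matrix (Fin n) (Fin n) ℝ := Matrix.of fun a b => pderiv k (fun y => gram g e y a b) y
  set N := connMat g e k y
  have h1 : D * gram g e y + (gram g e y)⁻¹ * P = 0 := by
    ext a b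
    have h2 : pderiv k (fun y => ∑ c, (gram g e y)⁻¹ a c * gram g e y c b) y = 0 := by
      rw [pderiv_congr (f' := fun _ => (1 : Matrix (Fin n) (Fin n) ℝ) a b) e.open_target
        (fun z hz => by rw [← hg.gram_inv_mul he hz, Matrix.mul_apply]) hy]
      simp [pderiv]
    have h3 := pderiv_sum (f := fun c y => (gram g e y)⁻¹ a c * gram g e y c b) (y := y)
      (fun c => (hid a c).mul (hgd c b)) k
    have h4 := h3.symm.trans h2
    rw [Finset.sum_congr rfl fun c _ => pderiv_mul (hid a c) (hgd c b) k,
      Finset.sum_add_distrib] at h4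
    exact h4
  have hP : P = N.transpose * gram g e y + gram g e y * N := by
    ext a b
    refine (hg.pderiv_gram he hy k a b).trans ?_
    rw [Finset.sum_add_distrib, Matrix.add_apply, Matrix.mul_apply, Matrix.mul_apply]
    congr 1
    exact Finset.sum_congr rfl fun c _ => mul_comm _ _
  have h5 : D = -(N * (gram g e y)⁻¹ + (gram g e y)⁻¹ * N.transpose) := by
    have h6 := congrArg (· * (gram g e y)⁻¹) h1
    simp only [add_mul, zero_mul, mul_assoc, hg.gram_mul_inv he hy, mul_one, hP] at h6
    rw [mul_add, ← mul_assoc _ _ (N * _), hg.gram_inv_mul he hy, one_mul] at h6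
    rw [eq_neg_iff_add_eq_zero, ← h6]
    abel
  exact congrFun (congrFun h5 i) j

theorem pderiv_multiMat (hg : IsRiemannian g) (he : e ∈ atlas (Coord n) M)
    {y : Coord n} (hy : y ∈ e.target) (k : Fin n) (I K : Fin p → Fin n) :
    pderiv k (fun y => multiMat p (gram g e y)⁻¹ I K) y = -((∑ a,
      (∏ c ∈ Finset.univ.erase a, (gram g e y)⁻¹ (I c) (K c))
        * (connMat g e k y * (gram g e y)⁻¹) (I a) (K a))
      + ∑ a, (∏ c ∈ Finset.univ.erase a, (gram g e y)⁻¹ (I c) (K c))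
        * ((gram g e y)⁻¹ * (connMat g e k y).transpose) (I a) (K a)) := by
  have hn := e.open_target.mem_nhds hy
  have hid : ∀ a b, DifferentiableAt ℝ (fun y => (gram g e y)⁻¹ a b) y := fun a b =>
    ((hg.contDiffOn_gram_inv he a b).contDiffAt hn).differentiableAt (by simp)
  have h := HasFDerivAt.finsetProd (u := Finset.univ)
    (fun (a : Fin p) _ => (hid (I a) (K a)).hasFDerivAt)
  have h2 : HasFDerivAt (fun y => multiMat p (gram g e y)⁻¹ I K) _ y := h
  rw [pderiv, h2.fderiv, ← Finset.sum_add_distrib, ← Finset.sum_neg_distrib, sum_apply]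
  refine Finset.sum_congr rfl fun a _ => ?_
  rw [smul_apply, smul_eq_mul]
  have h3 := hg.pderiv_gram_inv he hy k (I a) (K a)
  rw [pderiv] at h3
  rw [h3]
  ring

theorem pderiv_multiForm (hg : IsRiemannian g) (he : e ∈ atlas (Coord n) M)
    {y : Coord n} (hy : y ∈ e.target) (k : Fin n) {a b : (Fin p → Fin n) → Coord n → ℝ}
    (ha : ∀ I, DifferentiableAt ℝ (a I) y) (hb : ∀ I, DifferentiableAt ℝ (b I) y) :
    pderiv k (fun y => multiForm (gram g e y)⁻¹ (fun I => a I y) (fun I => b I y)) y =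
      multiForm (gram g e y)⁻¹ (fun I => pderiv k (a I) y
          - derivAct (connMat g e k y) (fun I => a I y) I) (fun I => b I y)
      + multiForm (gram g e y)⁻¹ (fun I => a I y) (fun I => pderiv k (b I) y
          - derivAct (connMat g e k y) (fun I => b I y) I) := by
  have hn := e.open_target.mem_nhds hy
  have hid : ∀ a b, DifferentiableAt ℝ (fun y => (gram g e y)⁻¹ a b) y := fun a b =>
    ((hg.contDiffOn_gram_inv he a b).contDiffAt hn).differentiableAt (by simp)
  have hm : ∀ I K : Fin p → Fin n, DifferentiableAt ℝ (fun y => multiMat p (gram g e y)⁻¹ I K) y :=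
    fun I K => (HasFDerivAt.finsetProd (u := Finset.univ)
      (fun (a : Fin p) _ => (hid (I a) (K a)).hasFDerivAt)).differentiableAt
  have hd : ∀ I K, DifferentiableAt ℝ (fun y => multiMat p (gram g e y)⁻¹ I K * (a I y * b K y)) y :=
    fun I K => (hm I K).mul ((ha I).mul (hb K))
  have h1 : pderiv k (fun y => multiForm (gram g e y)⁻¹ (fun I => a I y) (fun I => b I y)) y =
      ∑ I, ∑ K, (pderiv k (fun y => multiMat p (gram g e y)⁻¹ I K) y * (a I y * b K y)
        + multiMat p (gram g e y)⁻¹ I K * (pderiv k (a I) y * b K y + a I y * pderiv k (b K) y)) := by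
    refine (pderiv_sum (f := fun I y => ∑ K, multiMat p (gram g e y)⁻¹ I K * (a I y * b K y))
      (fun I => DifferentiableAt.fun_sum fun K _ => hd I K) k).trans ?_
    refine Finset.sum_congr rfl fun I _ => ?_
    refine (pderiv_sum (fun K => hd I K) k).trans ?_
    refine Finset.sum_congr rfl fun K _ => ?_
    refine (pderiv_mul (f' := fun y => a I y * b K y) (hm I K) ((ha I).mul (hb K)) k).trans ?_
    rw [pderiv_mul (ha I) (hb K)]
  have hsubl : ∀ (A : Matrix (Fin n) (Fin n) ℝ) (a a' b : (Fin p → Fin n) → ℝ),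
      multiForm A (fun I => a I - a' I) b = multiForm A a b - multiForm A a' b := by
    intro A a a' b
    simp only [multiForm, sub_mul, mul_sub, Finset.sum_sub_distrib]
  have hsubr : ∀ (A : Matrix (Fin n) (Fin n) ℝ) (a b b' : (Fin p → Fin n) → ℝ),
      multiForm A a (fun I => b I - b' I) = multiForm A a b - multiForm A a b' := by
    intro A a a' b
    simp only [multiForm, mul_sub, Finset.sum_sub_distrib]
  rw [h1, hsubl, hsubr, multiForm_derivAct_left, multiForm_derivAct_right]
  simp only [pderiv_multiMat hg he hy, multiForm]
  simp only [neg_mul, add_mul, mul_add, Finset.sum_add_distrib, Finset.sum_neg_distrib]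
  ring

end Leibniz

end BakryEmery

namespace BakryEmery

section Linear
variable {n p : ℕ} (A : Matrix (Fin n) (Fin n) ℝ)

theorem multiForm_sub_right (a b b' : (Fin p → Fin n) → ℝ) :
    multiForm A a (fun I => b I - b' I) = multiForm A a b - multiForm A a b' := by
  simp only [multiForm, mul_sub, Finset.sum_sub_distrib]

theorem multiForm_add_right (a b b' : (Fin p → Fin n) → ℝ) :
    multiForm A a (fun I => b I + b' I) = multiForm A a b + multiForm A a b' := by
  simp only [multiForm, mul_add, Finset.sum_add_distrib]

theorem multiForm_mul_right (c : ℝ) (a b : (Fin p → Fin n) → ℝ) :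
    multiForm A a (fun I => c * b I) = c * multiForm A a b := by
  simp only [multiForm, Finset.mul_sum]
  exact Finset.sum_congr rfl fun I _ => Finset.sum_congr rfl fun K _ => by ring

theorem multiForm_sum_right {κ : Type*} [Fintype κ] (a : (Fin p → Fin n) → ℝ)
    (b : κ → (Fin p → Fin n) → ℝ) :
    multiForm A a (fun I => ∑ k, b k I) = ∑ k, multiForm A a (b k) := by
  simp only [multiForm, Finset.mul_sum]
  conv_rhs => rw [Finset.sum_comm]
  exact Finset.sum_congr rfl fun I _ => Finset.sum_comm

end Linear

variable {n : ℕ} {M : Type*} [TopologicalSpace M] [ChartedSpace (Coord n) M] {p q : ℕ}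
  {e e' : OpenPartialHomeomorph M (Coord n)} {g : TensorField n M 2}

/-- The components in a chart of the vector field, multiplied by `√ det g`, that is dual to the
`1`-form `⟨α, β(ξ, ⋅)⟩`. -/
noncomputable def flux (g : TensorField n M 2) (α : TensorField n M p) (β : TensorField n M (p + 1))
    (e : OpenPartialHomeomorph M (Coord n)) (k : Fin n) (y : Coord n) : ℝ :=
  √ (gram g e y).det * ∑ l, (gram g e y)⁻¹ k l *
    multiForm (gram g e y)⁻¹ (fun I => tcomp α e I y) (fun I => tcomp β e (Fin.cons l I) y)

variable [IsManifold (𝓡 n) ∞ M]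

theorem IsRiemannian.contDiffOn_sqrt_det (hg : IsRiemannian g) (he : e ∈ atlas (Coord n) M) :
    ContDiffOn ℝ ∞ (fun y => √ (gram g e y).det) e.target :=
  (contDiffOn_det fun i j => hg.smooth e he ![i, j]).sqrt fun _ hy => (hg.det_gram_pos he hy).ne'

theorem IsRiemannian.pderiv_sqrt_det (hg : IsRiemannian g) (he : e ∈ atlas (Coord n) M)
    {y : Coord n} (hy : y ∈ e.target) (k : Fin n) :
    pderiv k (fun y => √ (gram g e y).det) y =
      √ (gram g e y).det * ∑ l, christoffel g e l l k y := by
  have hn := e.open_target.mem_nhds hy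
  have h1 : HasFDerivAt (fun y => 2⁻¹ * Real.log (gram g e y).det) _ y :=
    ((contDiffAt_const.mul (((contDiffOn_det fun i j => hg.smooth e he ![i, j]).contDiffAt hn).log
      (hg.det_gram_pos he hy).ne')).differentiableAt (by simp)).hasFDerivAt
  have hexp : ∀ z ∈ e.target, √ (gram g e z).det = Real.exp (2⁻¹ * Real.log (gram g e z).det) := by
    intro z hz
    have hpos := hg.det_gram_pos he hz
    rw [Real.sqrt_eq_rpow, Real.rpow_def_of_pos hpos, mul_comm, one_div]
  have h2 := h1.exp
  rw [pderiv_congr e.open_target hexp hy, pderiv, h2.fderiv, ← hg.pderiv_log_det_gram he hy,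
    hexp y hy]
  rfl

theorem contDiffOn_multiForm (hg : IsRiemannian g) (he : e ∈ atlas (Coord n) M)
    {a b : (Fin p → Fin n) → Coord n → ℝ} (ha : ∀ I, ContDiffOn ℝ ∞ (a I) e.target)
    (hb : ∀ I, ContDiffOn ℝ ∞ (b I) e.target) :
    ContDiffOn ℝ ∞ (fun y => multiForm (gram g e y)⁻¹ (fun I => a I y) (fun I => b I y)) e.target :=
  ContDiffOn.sum fun I _ => ContDiffOn.sum fun K _ =>
    (contDiffOn_prod (t := Finset.univ) fun c _ => hg.contDiffOn_gram_inv he (I c) (K c)).mul ((ha I).mul (hb K))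

theorem contDiffOn_innerComp (hg : IsRiemannian g) (he : e ∈ atlas (Coord n) M)
    {α β : TensorField n M p} (hα : IsSmooth α) (hβ : IsSmooth β) :
    ContDiffOn ℝ ∞ (innerComp g α β e) e.target :=
  contDiffOn_multiForm hg he (hα e he) (hβ e he)

theorem contDiffOn_flux (hg : IsRiemannian g) (he : e ∈ atlas (Coord n) M)
    {α : TensorField n M p} {β : TensorField n M (p + 1)} (hα : IsSmooth α) (hβ : IsSmooth β)
    (k : Fin n) : ContDiffOn ℝ ∞ (flux g α β e k) e.target :=
  (hg.contDiffOn_sqrt_det he).mul (ContDiffOn.sum fun l _ => (hg.contDiffOn_gram_inv he k l).mul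
    (contDiffOn_multiForm hg he (hα e he) fun I => hβ e he (Fin.cons l I)))

theorem sum_pderiv_flux (hg : IsRiemannian g) (he : e ∈ atlas (Coord n) M)
    {α : TensorField n M p} {β : TensorField n M (p + 1)} (hα : IsSmooth α) (hβ : IsSmooth β)
    {y : Coord n} (hy : y ∈ e.target) :
    ∑ k, pderiv k (flux g α β e k) y = √ (gram g e y).det *
      (innerComp g (nabla g α) β e y + innerComp g α (divergence g β) e y) := by
  have hn := e.open_target.mem_nhds hy
  have hα' : ∀ I, DifferentiableAt ℝ (tcomp α e I) y := fun I =>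
    ((hα e he I).contDiffAt hn).differentiableAt (by simp)
  have hβ' : ∀ I, DifferentiableAt ℝ (tcomp β e I) y := fun I =>
    ((hβ e he I).contDiffAt hn).differentiableAt (by simp)
  set G := (gram g e y)⁻¹ with hG
  set ρ := √ (gram g e y).det with hρ
  set Q : Fin n → Coord n → ℝ := fun l y => multiForm (gram g e y)⁻¹ (fun I => tcomp α e I y)
    (fun I => tcomp β e (Fin.cons l I) y) with hQ
  have hQd : ∀ l, DifferentiableAt ℝ (Q l) y := fun l =>
    ((contDiffOn_multiForm hg he (hα e he) fun I => hβ e he (Fin.cons l I)).contDiffAt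
      hn).differentiableAt (by simp)
  have hGd : ∀ a b, DifferentiableAt ℝ (fun y => (gram g e y)⁻¹ a b) y := fun a b =>
    ((hg.contDiffOn_gram_inv he a b).contDiffAt hn).differentiableAt (by simp)
  have hρd : DifferentiableAt ℝ (fun y => √ (gram g e y).det) y :=
    ((hg.contDiffOn_sqrt_det he).contDiffAt hn).differentiableAt (by simp)
  set Qα : Fin n → Fin n → ℝ := fun k l => multiForm G (fun I => pderiv k (tcomp α e I) y
    - derivAct (connMat g e k y) (fun I => tcomp α e I y) I) (fun I => tcomp β e (Fin.cons l I) y)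
    with hQα
  set Qβ : Fin n → Fin n → ℝ := fun k l => multiForm G (fun I => tcomp α e I y)
    (fun I => pderiv k (tcomp β e (Fin.cons l I)) y
      - derivAct (connMat g e k y) (fun I => tcomp β e (Fin.cons l I) y) I) with hQβ
  have hdQ : ∀ k l, pderiv k (Q l) y = Qα k l + Qβ k l := fun k l =>
    pderiv_multiForm hg he hy k hα' fun I => hβ' (Fin.cons l I)
  have h1 : innerComp g (nabla g α) β e y = ∑ k, ∑ l, G k l * Qα k l := by
    rw [innerComp_eq_multiForm, multiForm_succ]
    simp only [tcomp_nabla hg hα he hy, nablaComp_cons]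
    rfl
  have h2 : innerComp g α (divergence g β) e y = ∑ k, ∑ l, G k l *
      (Qβ k l - ∑ m, christoffel g e m k l y * Q m y) := by
    rw [innerComp_eq_multiForm]
    simp only [divergence, tcomp_traceFirst g _ he hy, tcomp_nabla hg hβ he hy, nablaComp_cons,
      derivAct_cons]
    rw [multiForm_sum_right]
    refine Finset.sum_congr rfl fun k _ => ?_
    rw [multiForm_sum_right]
    refine Finset.sum_congr rfl fun l _ => ?_
    rw [multiForm_mul_right]
    congr 1
    simp only [hQβ, hQ, multiForm_sub_right, multiForm_add_right, multiForm_sum_right,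
      multiForm_mul_right]
    exact (sub_add_eq_sub_sub _ _ _).trans (sub_right_comm _ _ _)
  have h3 : ∀ k, pderiv k (flux g α β e k) y =
      ρ * ((∑ m, christoffel g e m m k y) * ∑ l, G k l * Q l y
        + ∑ l, (pderiv k (fun y => (gram g e y)⁻¹ k l) y * Q l y + G k l * (Qα k l + Qβ k l))) := by
    intro k
    have hs : DifferentiableAt ℝ (fun y => ∑ l, (gram g e y)⁻¹ k l * Q l y) y :=
      DifferentiableAt.fun_sum fun l _ => (hGd k l).mul (hQd l)
    refine (pderiv_mul hρd hs k).trans ?_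
    rw [hg.pderiv_sqrt_det he hy]
    have hs' := pderiv_sum (f := fun l y => (gram g e y)⁻¹ k l * Q l y)
      (fun l => (hGd k l).mul (hQd l)) k
    rw [hs', Finset.sum_congr rfl fun l _ => pderiv_mul (hGd k l) (hQd l) k]
    simp only [hdQ]
    ring
  have h4 : ∑ k, ∑ l, pderiv k (fun y => (gram g e y)⁻¹ k l) y * Q l y =
      -((∑ k, (∑ m, christoffel g e m m k y) * ∑ l, G k l * Q l y)
        + ∑ k, ∑ l, G k l * ∑ m, christoffel g e m k l y * Q m y) := by
    simp only [hg.pderiv_gram_inv he hy, neg_mul, add_mul, Finset.sum_neg_distrib,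
      Finset.sum_add_distrib]
    congr 2
    · simp only [Matrix.mul_apply, Finset.sum_mul, Finset.mul_sum]
      rw [Finset.sum_congr rfl fun k _ => Finset.sum_comm, Finset.sum_comm]
      refine Finset.sum_congr rfl fun m _ => ?_
      rw [Finset.sum_comm]
      exact Finset.sum_congr rfl fun l _ => Finset.sum_congr rfl fun k _ => mul_assoc _ _ _
    · refine Finset.sum_congr rfl fun k _ => ?_
      simp only [Matrix.mul_apply, Finset.sum_mul, Finset.mul_sum]
      rw [Finset.sum_comm]
      exact Finset.sum_congr rfl fun l _ => Finset.sum_congr rfl fun m _ => mul_assoc _ _ _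
  rw [h1, h2]
  simp only [h3, ← Finset.mul_sum]
  congr 1
  simp only [Finset.sum_add_distrib, mul_add, mul_sub, Finset.sum_sub_distrib] at h4 ⊢
  rw [h4]
  ring

end BakryEmery

namespace BakryEmery
open MeasureTheory

section Model
variable {n : ℕ}

theorem integral_pderiv_eq_zero {h : Coord n → ℝ} (hh : ContDiff ℝ ∞ h)
    (hc : HasCompactSupport h) (k : Fin n) : ∫ y, pderiv k h y = 0 := by
  have hcont : Continuous fun y => fderiv ℝ h y (stdVec k) :=
    (hh.continuous_fderiv (by simp)).clm_apply continuous_const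
  have hint : Integrable fun y => fderiv ℝ h y (stdVec k) :=
    hcont.integrable_of_hasCompactSupport (hc.fderiv_apply ℝ _)
  have := integral_mul_fderiv_eq_neg_fderiv_mul_of_integrable (μ := volume) (𝕜 := ℝ)
    (f := fun _ : Coord n => (1 : ℝ)) (g := h) (v := stdVec k) (by simp) (by simpa using hint)
    (by simpa using hh.continuous.integrable_of_hasCompactSupport hc)
    (fun _ _ => differentiableAt_const _) (fun x _ => hh.differentiable (by simp) x)
  simpa [pderiv] using this

theorem setIntegral_pderiv_eq_zero {U C : Set (Coord n)} (hU : IsOpen U) (hC : IsCompact C)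
    (hCU : C ⊆ U) {h : Coord n → ℝ} (hh : ContDiffOn ℝ ∞ h U) (h0 : ∀ y ∈ U, y ∉ C → h y = 0)
    (k : Fin n) :
    IntegrableOn (pderiv k h) U ∧ ∫ y in U, pderiv k h y = 0 := by
  classical
  set F := U.indicator h with hF
  have hF0 : ∀ y ∉ C, F y = 0 := by
    intro y hy
    by_cases hyU : y ∈ U
    · rw [hF, Set.indicator_of_mem hyU, h0 y hyU hy]
    · rw [hF, Set.indicator_of_notMem hyU]
  have hFU : ∀ y ∈ U, F =ᶠ[nhds y] h := fun y hy =>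
    Filter.Eventually.mono (hU.mem_nhds hy) fun z hz => Set.indicator_of_mem hz h
  have hFC : ∀ y ∉ C, F =ᶠ[nhds y] fun _ => 0 := fun y hy =>
    Filter.Eventually.mono (hC.isClosed.isOpen_compl.mem_nhds hy) fun z hz => hF0 z hz
  have hFs : ContDiff ℝ ∞ F := by
    rw [contDiff_iff_contDiffAt]
    intro y
    by_cases hy : y ∈ C
    · exact (hh.contDiffAt (hU.mem_nhds (hCU hy))).congr_of_eventuallyEq (hFU y (hCU hy))
    · exact contDiffAt_const.congr_of_eventuallyEq (hFC y hy)
  have hFc : HasCompactSupport F := HasCompactSupport.intro hC hF0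
  have heq : Set.EqOn (pderiv k F) (pderiv k h) U := fun y hy => by
    simp only [pderiv, (hFU y hy).fderiv_eq]
  have hint : Integrable (pderiv k F) :=
    ((hFs.continuous_fderiv (by simp)).clm_apply continuous_const).integrable_of_hasCompactSupport
      (hFc.fderiv_apply ℝ _)
  refine ⟨hint.integrableOn.congr_fun heq hU.measurableSet, ?_⟩
  rw [← setIntegral_congr_fun hU.measurableSet heq,
    setIntegral_eq_integral_of_forall_compl_eq_zero, integral_pderiv_eq_zero hFs hFc]
  intro y hy
  simp [pderiv, (hFC y fun h => hy (hCU h)).fderiv_eq]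

end Model

variable {n : ℕ} {M : Type*} [TopologicalSpace M] [ChartedSpace (Coord n) M] {p q : ℕ}
  {e e' : OpenPartialHomeomorph M (Coord n)} {g : TensorField n M 2}

theorem tcomp_eq_zero {α : TensorField n M p} {y : Coord n} (h : α (e.symm y) = 0)
    (I : Fin p → Fin n) : tcomp α e I y = 0 := by
  rw [tcomp, h]; rfl

theorem ofComp_zero (x : M) : ofComp x (fun _ : Fin p → Fin n => (0 : ℝ)) = 0 := by
  simp [ofComp]

theorem nabla_eq_zero {α : TensorField n M p} {x : M} (h : ∀ᶠ x' in nhds x, α x' = 0) :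
    nabla g α x = 0 := by
  rw [nabla, ← ofComp_zero]
  congr 1
  funext I
  have hc : ContinuousAt (chartAt (Coord n) x).symm (chartAt (Coord n) x x) :=
    (chartAt (Coord n) x).continuousAt_symm (mem_chart_target _ _)
  have hev : ∀ᶠ y in nhds (chartAt (Coord n) x x), α ((chartAt (Coord n) x).symm y) = 0 := by
    refine hc.eventually (p := fun x' => α x' = 0) ?_
    rwa [(chartAt (Coord n) x).left_inv (mem_chart_source _ _)]
  have hz : ∀ I, tcomp α (chartAt (Coord n) x) I =ᶠ[nhds (chartAt (Coord n) x x)] fun _ => 0 :=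
    fun I => hev.mono fun y hy => tcomp_eq_zero hy I
  simp [nablaComp, pderiv, (hz _).fderiv_eq, (hz _).eq_of_nhds]

theorem tensorInner_eq_zero_left {α β : TensorField n M p} {x : M} (h : α x = 0) :
    tensorInner g α β x = 0 := by
  have : α ((chartAt (Coord n) x).symm (chartAt (Coord n) x x)) = 0 := by
    rwa [(chartAt (Coord n) x).left_inv (mem_chart_source _ _)]
  simp [tensorInner, tcomp_eq_zero this]

variable [IsManifold (𝓡 n) ∞ M]

theorem continuousOn_tensorInner (hg : IsRiemannian g) (he : e ∈ atlas (Coord n) M)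
    {α β : TensorField n M p} (hα : IsSmooth α) (hβ : IsSmooth β) :
    ContinuousOn (tensorInner g α β) e.source :=
  ((contDiffOn_innerComp hg he hα hβ).continuousOn.comp e.continuousOn e.mapsTo).congr
    fun _ hx => tensorInner_eq he g α β hx

variable [MeasurableSpace M] [BorelSpace M] [SecondCountableTopology M] [T2Space M]

theorem integrable_tensorInner (hg : IsRiemannian g) (he : e ∈ atlas (Coord n) M)
    {α β : TensorField n M p} (hα : IsSmooth α) (hβ : IsSmooth β) {K : Set M} (hK : IsCompact K)
    (hKe : K ⊆ e.source) (h0 : ∀ x ∉ K, α x = 0) :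
    Integrable (tensorInner g α β) (volumeMeasure g) :=
  integrable_volumeMeasure hg.smooth he (continuousOn_tensorInner hg he hα hβ) hK hKe
    fun x hx => tensorInner_eq_zero_left (h0 x hx)

theorem integral_nabla_add_divergence (hg : IsRiemannian g) (he : e ∈ atlas (Coord n) M)
    {α : TensorField n M p} {β : TensorField n M (p + 1)} (hα : IsSmooth α) (hβ : IsSmooth β)
    {K : Set M} (hK : IsCompact K) (hKe : K ⊆ e.source) (h0 : ∀ x ∉ K, α x = 0) :
    ∫ x, (tensorInner g (nabla g α) β x + tensorInner g α (divergence g β) x)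
      ∂(volumeMeasure g) = 0 := by
  have h0' : ∀ x ∉ K, nabla g α x = 0 := fun x hx =>
    nabla_eq_zero (Filter.Eventually.mono (hK.isClosed.isOpen_compl.mem_nhds hx) fun z hz => h0 z hz)
  refine (integral_volumeMeasure hg.smooth he (f := fun x => tensorInner g (nabla g α) β x
      + tensorInner g α (divergence g β) x)
    ((continuousOn_tensorInner hg he (hα.nabla hg) hβ).add
      (continuousOn_tensorInner hg he hα (hβ.divergence hg))) fun x hx => ?_).trans ?_
  · rw [tensorInner_eq_zero_left (h0 x fun h => hx (hKe h)),
      tensorInner_eq_zero_left (h0' x fun h => hx (hKe h)), add_zero]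
  have hC : IsCompact (e '' K) := hK.image_of_continuousOn (e.continuousOn.mono hKe)
  have hCU : e '' K ⊆ e.target := by
    rintro _ ⟨x, hx, rfl⟩
    exact e.map_source (hKe hx)
  have hz : ∀ k, ∀ y ∈ e.target, y ∉ e '' K → flux g α β e k y = 0 := by
    intro k y hy hyK
    have : α (e.symm y) = 0 := h0 _ fun h => hyK ⟨_, h, e.right_inv hy⟩
    simp [flux, multiForm, tcomp_eq_zero this]
  have hk := fun k => setIntegral_pderiv_eq_zero e.open_target hC hCU
    (contDiffOn_flux hg he hα hβ k) (hz k) k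
  rw [setIntegral_congr_fun (g := fun y => ∑ k, pderiv k (flux g α β e k) y)
    e.open_target.measurableSet, integral_finsetSum _ fun k _ => (hk k).1]
  · exact Finset.sum_eq_zero fun k _ => (hk k).2
  · intro y hy
    dsimp only
    rw [sum_pderiv_flux hg he hα hβ hy, tensorInner_eq he g _ _ (e.map_target hy),
      tensorInner_eq he g _ _ (e.map_target hy), e.right_inv hy]

end BakryEmery

namespace BakryEmery
open MeasureTheory

variable {n : ℕ} {M : Type*} [TopologicalSpace M] [ChartedSpace (Coord n) M] {p q : ℕ}
  {e e' : OpenPartialHomeomorph M (Coord n)} {g : TensorField n M 2}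

theorem tcomp_sum {κ : Type*} (s : Finset κ) (α : κ → TensorField n M p)
    (e : OpenPartialHomeomorph M (Coord n)) (I : Fin p → Fin n) (y : Coord n) :
    tcomp (∑ k ∈ s, α k) e I y = ∑ k ∈ s, tcomp (α k) e I y := by
  simp only [tcomp, Finset.sum_apply, sum_apply]

theorem eq_of_tcomp_eq [IsManifold (𝓡 n) ∞ M] {α β : TensorField n M p} {x : M}
    (h : ∀ I, tcomp α (chartAt (Coord n) x) I (chartAt (Coord n) x x) =
      tcomp β (chartAt (Coord n) x) I (chartAt (Coord n) x x)) : α x = β x :=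
  apply_eq_of_pull_eq (chart_mem_atlas _ x) (mem_chart_source _ x) (ModelTensor.ext_stdVec h)

theorem tensorInner_sum_left {κ : Type*} (s : Finset κ) (α : κ → TensorField n M p)
    (β : TensorField n M p) (x : M) :
    tensorInner g (∑ k ∈ s, α k) β x = ∑ k ∈ s, tensorInner g (α k) β x := by
  simp only [tensorInner, tcomp_sum, Finset.sum_mul, Finset.mul_sum]
  conv_rhs => rw [Finset.sum_comm]
  exact Finset.sum_congr rfl fun I _ => Finset.sum_comm

theorem tensorInner_smul_right (c : ℝ) (α β : TensorField n M p) (x : M) :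
    tensorInner g α (c • β) x = c * tensorInner g α β x := by
  have : ∀ I y, tcomp (c • β) (chartAt (Coord n) x) I y =
    c * tcomp β (chartAt (Coord n) x) I y := fun _ _ => rfl
  simp only [tensorInner, this, Finset.mul_sum]
  exact Finset.sum_congr rfl fun I _ => Finset.sum_congr rfl fun K _ => by ring

theorem tcomp_fsmul_chartAt (u : M → ℝ) (α : TensorField n M p) (x : M) (I : Fin p → Fin n) :
    tcomp (fsmul u α) (chartAt (Coord n) x) I (chartAt (Coord n) x x) =
      u x * tcomp α (chartAt (Coord n) x) I (chartAt (Coord n) x x) :=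
  congrArg (fun x' => u x' * tcomp α (chartAt (Coord n) x) I (chartAt (Coord n) x x))
    ((chartAt (Coord n) x).left_inv (mem_chart_source (Coord n) x))

theorem tensorInner_fsmul_left (u : M → ℝ) (α β : TensorField n M p) (x : M) :
    tensorInner g (fsmul u α) β x = u x * tensorInner g α β x := by
  simp only [tensorInner, tcomp_fsmul_chartAt, Finset.mul_sum]
  exact Finset.sum_congr rfl fun I _ => Finset.sum_congr rfl fun K _ => by ring

theorem nablaComp_sum {κ : Type*} {s : Finset κ} {α : κ → TensorField n M p}
    (h : ∀ k ∈ s, IsSmooth (α k)) (he : e ∈ atlas (Coord n) M) {y : Coord n}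
    (hy : y ∈ e.target) (I : Fin (p + 1) → Fin n) :
    nablaComp g (∑ k ∈ s, α k) e I y = ∑ k ∈ s, nablaComp g (α k) e I y := by
  have hd : ∀ k ∈ s, ∀ I, DifferentiableAt ℝ (tcomp (α k) e I) y := fun k hk I =>
    ((h k hk e he I).contDiffAt (e.open_target.mem_nhds hy)).differentiableAt (by simp)
  have h1 : ∀ I, tcomp (∑ k ∈ s, α k) e I = fun y => ∑ k ∈ s, tcomp (α k) e I y := fun I =>
    funext fun y => tcomp_sum s α e I y
  simp only [nablaComp, h1, pderiv, Finset.sum_sub_distrib]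
  rw [fderiv_fun_sum fun k hk => hd k hk _]
  congr 1
  · rw [sum_apply]
  · simp only [Finset.mul_sum]
    conv_rhs => rw [Finset.sum_comm]
    exact Finset.sum_congr rfl fun a _ => Finset.sum_comm

theorem nabla_sum {κ : Type*} {s : Finset κ} {α : κ → TensorField n M p}
    (h : ∀ k ∈ s, IsSmooth (α k)) : nabla g (∑ k ∈ s, α k) = ∑ k ∈ s, nabla g (α k) := by
  funext x
  rw [Finset.sum_apply]
  ext v
  simp only [sum_apply]
  simp only [nabla, ofComp_apply, nablaComp_sum h (chart_mem_atlas _ x) (mem_chart_target _ x),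
    Finset.sum_mul]
  exact Finset.sum_comm

variable [IsManifold (𝓡 n) ∞ M]

theorem isSmoothFun_of_contMDiff {u : M → ℝ} (hu : ContMDiff (𝓡 n) 𝓘(ℝ) ∞ u) :
    IsSmoothFun n u := by
  intro e he
  have h1 : ContMDiffOn (𝓡 n) (𝓡 n) ∞ e.symm e.target :=
    contMDiffOn_symm_of_mem_maximalAtlas (IsManifold.subset_maximalAtlas he)
  exact (hu.comp_contMDiffOn h1).contDiffOn

variable [MeasurableSpace M] [BorelSpace M] [SecondCountableTopology M] [T2Space M]

theorem isFormalAdjoint_neg_divergence (hg : IsRiemannian g) :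
    IsFormalAdjoint g (smoothTensors n M p) (smoothTensors n M (p + 1)) (nabla g)
      (fun β => (-1 : ℝ) • divergence g β) := by
  intro β hβ
  refine ⟨(IsSmooth.divergence hg hβ).const_smul _, fun α hα ⟨K, hK, h0⟩ => ?_⟩
  have : LocallyCompactSpace M := ChartedSpace.locallyCompactSpace (Coord n) M
  obtain ⟨f, hf⟩ := SmoothPartitionOfUnity.exists_isSubordinate_chartAt_source (𝓡 n) M
  have hfin : {i | (Function.support (f i) ∩ K).Nonempty}.Finite :=
    f.locallyFinite.finite_nonempty_inter_compact hK
  set S := hfin.toFinset with hS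
  have hsum : α = ∑ i ∈ S, fsmul (f i) α := by
    funext x
    rw [Finset.sum_apply]
    by_cases hx : x ∈ K
    · have h1 : ∑ i ∈ S, f i x = 1 := by
        rw [← f.sum_eq_one (Set.mem_univ x), finsum_eq_sum_of_support_subset]
        intro i hi
        exact hfin.mem_toFinset.2 ⟨x, hi, hx⟩
      simp only [fsmul, ← Finset.sum_smul, h1, one_smul]
    · simp [fsmul, h0 x hx]
  have hfs : ∀ i, IsSmooth (fsmul (f i) α) := fun i =>
    IsSmooth.fsmul hα (isSmoothFun_of_contMDiff (f i).contMDiff)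
  have hKi : ∀ i, IsCompact (K ∩ tsupport (f i)) := fun i => hK.inter_right (isClosed_tsupport _)
  have hKe : ∀ i, K ∩ tsupport (f i) ⊆ (chartAt (Coord n) i).source := fun i =>
    Set.inter_subset_right.trans (hf i)
  have hz : ∀ i, ∀ x ∉ K ∩ tsupport (f i), fsmul (f i) α x = 0 := by
    intro i x hx
    by_cases hxK : x ∈ K
    · have : f i x = 0 := image_eq_zero_of_notMem_tsupport fun h => hx ⟨hxK, h⟩
      simp [fsmul, this]
    · simp [fsmul, h0 x hxK]
  have hz' : ∀ i, ∀ x ∉ K ∩ tsupport (f i), nabla g (fsmul (f i) α) x = 0 := fun i x hx =>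
    nabla_eq_zero (Filter.Eventually.mono ((hKi i).isClosed.isOpen_compl.mem_nhds hx)
      fun z hz₁ => hz i z hz₁)
  have hi1 : ∀ i, Integrable (tensorInner g (nabla g (fsmul (f i) α)) β) (volumeMeasure g) :=
    fun i => integrable_tensorInner hg (chart_mem_atlas _ i) ((hfs i).nabla hg) hβ (hKi i) (hKe i)
      (hz' i)
  have hi2 : ∀ i, Integrable (tensorInner g (fsmul (f i) α) (divergence g β)) (volumeMeasure g) :=
    fun i => integrable_tensorInner hg (chart_mem_atlas _ i) (hfs i) (IsSmooth.divergence hg hβ)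
      (hKi i) (hKe i) (hz i)
  rw [hsum, nabla_sum fun i _ => hfs i]
  simp only [tensorInner_smul_right, tensorInner_sum_left]
  rw [integral_const_mul, integral_finsetSum _ fun i _ => hi1 i,
    integral_finsetSum _ fun i _ => hi2 i, neg_one_mul, ← Finset.sum_neg_distrib]
  refine Finset.sum_congr rfl fun i _ => eq_neg_of_add_eq_zero_left ?_
  rw [← integral_add (hi1 i) (hi2 i)]
  exact integral_nabla_add_divergence hg (chart_mem_atlas _ i) (hfs i) hβ (hKi i) (hKe i) (hz i)

end BakryEmery

namespace BakryEmery
open MeasureTheory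

/-- The permutation of `{0, …, p}` that fixes `0` and acts as `σ` on the other elements. -/
def extendPerm {p : ℕ} (σ : Equiv.Perm (Fin p)) : Equiv.Perm (Fin (p + 1)) :=
  Equiv.Perm.decomposeFin.symm (0, σ)

theorem extendPerm_zero {p : ℕ} (σ : Equiv.Perm (Fin p)) : extendPerm σ 0 = 0 := by
  simp [extendPerm]

theorem extendPerm_succ {p : ℕ} (σ : Equiv.Perm (Fin p)) (k : Fin p) :
    extendPerm σ k.succ = (σ k).succ := by
  simp [extendPerm]

theorem cons_extendPerm {p : ℕ} {X : Type*} (σ : Equiv.Perm (Fin p)) (a : X) (v : Fin p → X) :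
    (fun k => (Fin.cons a v : Fin (p + 1) → X) (extendPerm σ k)) =
      Fin.cons a (fun k => v (σ k)) := by
  funext k
  refine Fin.cases ?_ (fun k => ?_) k
  · simp [extendPerm_zero]
  · simp [extendPerm_succ]

theorem exists_perm_succAbove {p : ℕ} (σ : Equiv.Perm (Fin (p + 1))) (j : Fin (p + 1)) :
    ∃ τ : Equiv.Perm (Fin p), ∀ k, σ (j.succAbove k) = (σ j).succAbove (τ k) := by
  have h : ∀ k, ∃ m, (σ j).succAbove m = σ (j.succAbove k) := fun k =>
    Fin.exists_succAbove_eq (σ.injective.ne (Fin.succAbove_ne j k))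
  choose τ hτ using h
  have hinj : Function.Injective τ := fun a b hab => by
    have := hτ a
    rw [hab, hτ b] at this
    exact (Fin.succAbove_right_injective (σ.injective this)).symm
  exact ⟨Equiv.ofBijective τ (Finite.injective_iff_bijective.1 hinj), fun k => (hτ k).symm⟩

variable {n : ℕ} {M : Type*} [TopologicalSpace M] [ChartedSpace (Coord n) M] {p q : ℕ}
  {e e' : OpenPartialHomeomorph M (Coord n)} {g : TensorField n M 2}

/-- Symmetric tensor fields. -/
def IsSymm (α : TensorField n M p) : Prop :=
  ∀ (x : M) (v : Fin p → TangentSpace (𝓡 n) x) (σ : Equiv.Perm (Fin p)),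
    α x (fun k => v (σ k)) = α x v

theorem IsSymm.tcomp_comp {α : TensorField n M p} (h : IsSymm α) (I : Fin p → Fin n)
    (σ : Equiv.Perm (Fin p)) (y : Coord n) : tcomp α e (fun k => I (σ k)) y = tcomp α e I y :=
  h _ (fun k => coordVec e y (I k)) σ

theorem tensorInner_domDomCongr (α : TensorField n M p) {β : TensorField n M p} (hβ : IsSymm β)
    (σ : Equiv.Perm (Fin p)) (x : M) :
    tensorInner g (fun x => (α x).domDomCongr σ) β x = tensorInner g α β x := by
  let ψ : (Fin p → Fin n) ≃ (Fin p → Fin n) := σ.symm.arrowCongr (Equiv.refl _)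
  have hψ : ∀ I, ψ I = fun k => I (σ k) := fun I => rfl
  simp only [tensorInner]
  refine Eq.trans (Finset.sum_congr rfl fun I _ => ?_) (ψ.sum_comp _)
  refine Eq.trans (Finset.sum_congr rfl fun K _ => ?_) (ψ.sum_comp _)
  simp only [hψ]
  rw [hβ.tcomp_comp K σ,
    Equiv.prod_comp σ fun a => (gram g (chartAt (Coord n) x) (chartAt (Coord n) x x))⁻¹ (I a) (K a)]
  rfl

theorem tensorInner_symNabla (α : TensorField n M p) {β : TensorField n M (p + 1)}
    (hβ : IsSymm β) (x : M) :
    tensorInner g (symNabla g α) β x = (p + 1) * tensorInner g (nabla g α) β x := by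
  have h : symNabla g α =
      ∑ j : Fin (p + 1), fun x => (nabla g α x).domDomCongr j.cycleRange.symm := by
    funext x
    rw [Finset.sum_apply]
    rfl
  rw [h, tensorInner_sum_left]
  simp [tensorInner_domDomCongr _ hβ]

theorem IsSymm.nablaComp_extendPerm {α : TensorField n M p} (h : IsSymm α)
    (τ : Equiv.Perm (Fin p)) (I : Fin (p + 1) → Fin n) (y : Coord n) :
    nablaComp g α e (fun k => I (extendPerm τ k)) y = nablaComp g α e I y := by
  have h1 : Fin.tail (fun k => I (extendPerm τ k)) = fun k => Fin.tail I (τ k) := by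
    funext k
    simp [Fin.tail, extendPerm_succ]
  have h2 : tcomp α e (fun k => Fin.tail I (τ k)) = tcomp α e (Fin.tail I) :=
    funext fun y => h.tcomp_comp _ τ y
  simp only [nablaComp, extendPerm_zero, extendPerm_succ, h1, h2]
  congr 1
  rw [← Equiv.sum_comp τ fun a => ∑ l, christoffel g e l (I 0) (I a.succ) y *
    tcomp α e (Function.update (Fin.tail I) a l) y]
  refine Finset.sum_congr rfl fun a _ => Finset.sum_congr rfl fun l _ => ?_
  rw [← h.tcomp_comp (Function.update (Fin.tail I) (τ a) l) τ]
  congr 2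
  funext k
  simp [Function.update_apply]

variable [IsManifold (𝓡 n) ∞ M]

theorem isSymm_of_tcomp {α : TensorField n M p}
    (h : ∀ (x : M) (I : Fin p → Fin n) (σ : Equiv.Perm (Fin p)),
      tcomp α (chartAt (Coord n) x) (fun k => I (σ k)) (chartAt (Coord n) x x) =
        tcomp α (chartAt (Coord n) x) I (chartAt (Coord n) x x)) : IsSymm α := by
  intro x v σ
  have := eq_of_tcomp_eq (α := fun x => (α x).domDomCongr σ) (β := α) (x := x) fun I => h x I σ
  exact congrArg (fun T => T v) this

theorem IsSymm.nabla_extendPerm (hg : IsRiemannian g) {α : TensorField n M p} (hα : IsSmooth α)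
    (h : IsSymm α) (τ : Equiv.Perm (Fin p)) (x : M) (v : Fin (p + 1) → TangentSpace (𝓡 n) x) :
    nabla g α x (fun k => v (extendPerm τ k)) = nabla g α x v := by
  have := eq_of_tcomp_eq (α := fun x => (nabla g α x).domDomCongr (extendPerm τ))
    (β := nabla g α) (x := x) fun I => by
      rw [tcomp_nabla hg hα (chart_mem_atlas _ x) (mem_chart_target _ x),
        ← h.nablaComp_extendPerm τ I,
        ← tcomp_nabla hg hα (chart_mem_atlas _ x) (mem_chart_target _ x)]
      rfl
  exact congrArg (fun T => T v) this

theorem IsSymm.divergence (hg : IsRiemannian g) {β : TensorField n M (p + 1)} (hβ : IsSmooth β)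
    (h : IsSymm β) : IsSymm (divergence g β) := by
  refine isSymm_of_tcomp fun x I σ => ?_
  simp only [BakryEmery.divergence,
    tcomp_traceFirst g _ (chart_mem_atlas _ x) (mem_chart_target _ x),
    tcomp_nabla hg hβ (chart_mem_atlas _ x) (mem_chart_target _ x)]
  refine Finset.sum_congr rfl fun k _ => Finset.sum_congr rfl fun l _ => ?_
  rw [← h.nablaComp_extendPerm (extendPerm σ) (Fin.cons k (Fin.cons l I)), cons_extendPerm,
    cons_extendPerm]

theorem IsSymm.symNabla (hg : IsRiemannian g) {α : TensorField n M p} (hα : IsSmooth α)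
    (h : IsSymm α) : IsSymm (symNabla g α) := by
  intro x v σ
  rw [symNabla_apply, symNabla_apply]
  refine Eq.trans (Finset.sum_congr rfl fun j _ => ?_) (Equiv.sum_comp σ _)
  obtain ⟨τ, hτ⟩ := exists_perm_succAbove σ j
  rw [← h.nabla_extendPerm hg hα τ x (Fin.cons (v (σ j)) fun k => v ((σ j).succAbove k)),
    cons_extendPerm]
  exact congrArg (fun w => nabla g α x (Fin.cons (v (σ j)) w)) (funext fun k => congrArg v (hτ k))

variable [MeasurableSpace M] [BorelSpace M] [SecondCountableTopology M] [T2Space M]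

theorem isFormalAdjoint_neg_smul_divergence (hg : IsRiemannian g) :
    IsFormalAdjoint g (smoothSymmTensors n M p) (smoothSymmTensors n M (p + 1)) (symNabla g)
      (fun β => (-(p + 1) : ℝ) • divergence g β) := by
  rintro β ⟨hβ, hβs⟩
  refine ⟨⟨(IsSmooth.divergence hg hβ).const_smul _, fun x v σ => ?_⟩, fun α hα hK => ?_⟩
  · exact congrArg (fun r : ℝ => (-(p + 1) : ℝ) * r) (IsSymm.divergence hg hβ hβs x v σ)
  · have h := ((isFormalAdjoint_neg_divergence hg) β hβ).2 α hα.1 hK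
    simp only [tensorInner_symNabla α hβs, tensorInner_smul_right, integral_const_mul] at h ⊢
    rw [h]
    ring

end BakryEmery

namespace BakryEmery
open MeasureTheory

variable {n : ℕ} {M : Type*} [TopologicalSpace M] [ChartedSpace (Coord n) M] {p q : ℕ}
  {e e' : OpenPartialHomeomorph M (Coord n)} {g : TensorField n M 2}

open scoped MatrixOrder in
theorem exists_eq_transpose_mul_self {A : Matrix (Fin n) (Fin n) ℝ} (hA : A.PosSemidef) :
    ∃ C : Matrix (Fin n) (Fin n) ℝ, A = C.transpose * C := by
  obtain ⟨C, hC⟩ := CStarAlgebra.nonneg_iff_eq_star_mul_self.1 hA.nonneg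
  exact ⟨C, by rw [hC, Matrix.star_eq_conjTranspose, Matrix.conjTranspose_eq_transpose_of_trivial]⟩

theorem dotProduct_multiMat_self {A C : Matrix (Fin n) (Fin n) ℝ} (h : A = C.transpose * C)
    (v : (Fin p → Fin n) → ℝ) : v ⬝ᵥ (multiMat p A).mulVec v =
      (multiMat p C).mulVec v ⬝ᵥ (multiMat p C).mulVec v := by
  rw [h, multiMat_mul, multiMat_transpose, ← Matrix.mulVec_mulVec, Matrix.dotProduct_mulVec,
    Matrix.vecMul_transpose]

theorem IsSymm.sub {α β : TensorField n M p} (hα : IsSymm α) (hβ : IsSymm β) :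
    IsSymm (α - β) := fun x v σ => congrArg₂ (· - ·) (hα x v σ) (hβ x v σ)

theorem IsSymm.fsmul {α : TensorField n M p} (hα : IsSymm α) (u : M → ℝ) :
    IsSymm (fsmul u α) := fun x v σ => congrArg (u x * ·) (hα x v σ)

variable [IsManifold (𝓡 n) ∞ M]

theorem IsRiemannian.posDef_gram_inv (hg : IsRiemannian g) (he : e ∈ atlas (Coord n) M)
    {y : Coord n} (hy : y ∈ e.target) : (gram g e y)⁻¹.PosDef :=
  (hg.posDef_gram he hy).inv

theorem innerComp_self_nonneg (hg : IsRiemannian g) (he : e ∈ atlas (Coord n) M)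
    {y : Coord n} (hy : y ∈ e.target) (α : TensorField n M p) : 0 ≤ innerComp g α α e y := by
  obtain ⟨C, hC⟩ := exists_eq_transpose_mul_self (hg.posDef_gram_inv he hy).posSemidef
  rw [innerComp_eq_dotProduct, dotProduct_multiMat_self hC]
  exact Finset.sum_nonneg fun I _ => mul_self_nonneg _

theorem tcomp_eq_zero_of_innerComp_self (hg : IsRiemannian g) (he : e ∈ atlas (Coord n) M)
    {y : Coord n} (hy : y ∈ e.target) {α : TensorField n M p} (h : innerComp g α α e y = 0)
    (I : Fin p → Fin n) : tcomp α e I y = 0 := by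
  obtain ⟨C, hC⟩ := exists_eq_transpose_mul_self (hg.posDef_gram_inv he hy).posSemidef
  rw [innerComp_eq_dotProduct, dotProduct_multiMat_self hC, dotProduct_self_eq_zero] at h
  have h1 : (multiMat p (gram g e y)⁻¹).mulVec (fun K => tcomp α e K y) = 0 := by
    rw [hC, multiMat_mul, ← Matrix.mulVec_mulVec, h, Matrix.mulVec_zero]
  have h2 : (multiMat p (gram g e y * (gram g e y)⁻¹)).mulVec (fun K => tcomp α e K y) = 0 := by
    rw [multiMat_mul, ← Matrix.mulVec_mulVec, h1, Matrix.mulVec_zero]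
  rw [hg.gram_mul_inv he hy, multiMat_one, Matrix.one_mulVec] at h2
  exact congrFun h2 I

theorem tensorInner_self_nonneg (hg : IsRiemannian g) (α : TensorField n M p) (x : M) :
    0 ≤ tensorInner g α α x :=
  innerComp_self_nonneg hg (chart_mem_atlas _ x) (mem_chart_target _ x) α

theorem eq_zero_of_tensorInner_self (hg : IsRiemannian g) {α : TensorField n M p} {x : M}
    (h : tensorInner g α α x = 0) : α x = 0 :=
  eq_of_tcomp_eq (β := fun _ => 0) fun I =>
    tcomp_eq_zero_of_innerComp_self hg (chart_mem_atlas _ x) (mem_chart_target _ x) h I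

variable [MeasurableSpace M] [BorelSpace M] [SecondCountableTopology M]

theorem eq_zero_of_integral_eq_zero (hg : IsRiemannian g)
    (he : e ∈ atlas (Coord n) M) {f : M → ℝ} (hf : ContinuousOn f e.source) {K : Set M}
    (hK : IsCompact K) (hKe : K ⊆ e.source) (h0 : ∀ x ∉ K, f x = 0) (hnn : ∀ x, 0 ≤ f x)
    (h : ∫ x, f x ∂(volumeMeasure g) = 0) {x : M} (hx : x ∈ e.source) : f x = 0 := by
  rw [integral_volumeMeasure hg.smooth he hf fun x hx => h0 x fun h => hx (hKe h)] at h
  set F : Coord n → ℝ := fun y => √ (gram g e y).det * f (e.symm y) with hF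
  have hFc : ContinuousOn F e.target :=
    (hg.smooth.continuousOn_det_gram he).mul (hf.comp e.continuousOn_symm e.mapsTo_symm)
  have hC : IsCompact (e '' K) := hK.image_of_continuousOn (e.continuousOn.mono hKe)
  have hCU : e '' K ⊆ e.target := by
    rintro _ ⟨x, hx, rfl⟩
    exact e.map_source (hKe hx)
  have hint : IntegrableOn F e.target := by
    refine ((hFc.mono hCU).integrableOn_compact hC).of_forall_sdiff_eq_zero
      e.open_target.measurableSet fun y hy => ?_
    rw [hF]
    dsimp only
    rw [h0 _ fun h => hy.2 ⟨_, h, e.right_inv hy.1⟩, mul_zero]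
  have hae := (integral_eq_zero_iff_of_nonneg
    (fun y => mul_nonneg (Real.sqrt_nonneg _) (hnn _)) hint).1 h
  have := Measure.eqOn_open_of_ae_eq hae e.open_target hFc continuousOn_const (e.map_source hx)
  simp only [Pi.zero_apply, mul_eq_zero, e.left_inv hx] at this
  exact this.resolve_left (Real.sqrt_pos.2 (hg.det_gram_pos he (e.map_source hx))).ne'

variable [T2Space M]

/-- Formal adjoints are unique, for a class of smooth sections that is closed under
differences and multiplication by smooth functions. -/
theorem IsFormalAdjoint.unique (hg : IsRiemannian g) {A : Set (TensorField n M p)}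
    {B : Set (TensorField n M q)} {P : TensorField n M p → TensorField n M q}
    {Q Q' : TensorField n M q → TensorField n M p} (hA : ∀ α ∈ A, IsSmooth α)
    (hsub : ∀ α ∈ A, ∀ α' ∈ A, α - α' ∈ A)
    (hsmul : ∀ u : M → ℝ, IsSmoothFun n u → ∀ α ∈ A, fsmul u α ∈ A)
    (hQ : IsFormalAdjoint g A B P Q) (hQ' : IsFormalAdjoint g A B P Q')
    {β : TensorField n M q} (hβ : β ∈ B) : Q β = Q' β := by
  obtain ⟨h1, h1'⟩ := hQ β hβ
  obtain ⟨h2, h2'⟩ := hQ' β hβ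
  funext x
  set γ := Q β - Q' β with hγ
  have hγA : γ ∈ A := hsub _ h1 _ h2
  obtain ⟨φ⟩ : Nonempty (SmoothBumpFunction (𝓡 n) x) := inferInstance
  have hφ : IsSmoothFun n φ := isSmoothFun_of_contMDiff φ.contMDiff
  have hαA := hsmul φ hφ γ hγA
  have h0 : ∀ x' ∉ tsupport φ, fsmul φ γ x' = 0 := fun x' hx' => by
    simp [fsmul, image_eq_zero_of_notMem_tsupport hx']
  have hK : IsCompact (tsupport φ) := φ.hasCompactSupport
  have hKe := φ.tsupport_subset_chartAt_source
  have hc := chart_mem_atlas (Coord n) x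
  have heq := (h1' _ hαA ⟨_, hK, h0⟩).symm.trans (h2' _ hαA ⟨_, hK, h0⟩)
  have hdiff : ∀ x', tensorInner g (fsmul φ γ) γ x' =
      tensorInner g (fsmul φ γ) (Q β) x' - tensorInner g (fsmul φ γ) (Q' β) x' := by
    intro x'
    have ht : ∀ I y, tcomp γ (chartAt (Coord n) x') I y = tcomp (Q β) (chartAt (Coord n) x') I y
      - tcomp (Q' β) (chartAt (Coord n) x') I y := fun _ _ => rfl
    simp only [tensorInner, ← Finset.sum_sub_distrib, ← mul_sub, ht]
  have hzero : ∫ x', tensorInner g (fsmul φ γ) γ x' ∂(volumeMeasure g) = 0 := by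
    simp only [hdiff]
    rw [integral_sub (integrable_tensorInner hg hc (hA _ hαA) (hA _ h1) hK hKe h0)
      (integrable_tensorInner hg hc (hA _ hαA) (hA _ h2) hK hKe h0), heq, sub_self]
  have hx := eq_zero_of_integral_eq_zero hg hc
    (continuousOn_tensorInner hg hc (hA _ hαA) (hA _ hγA)) hK hKe
    (fun x' hx' => tensorInner_eq_zero_left (h0 x' hx'))
    (fun x' => by
      rw [tensorInner_fsmul_left]
      exact mul_nonneg φ.nonneg (tensorInner_self_nonneg hg γ x')) hzero (mem_chart_source _ x)
  rw [tensorInner_fsmul_left, φ.eq_one, one_mul] at hx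
  exact sub_eq_zero.1 (eq_zero_of_tensorInner_self hg hx)

theorem isFormalAdjoint_nablaStar (hg : IsRiemannian g) :
    IsFormalAdjoint g (smoothTensors n M p) (smoothTensors n M (p + 1)) (nabla g) (nablaStar g) :=
  Classical.epsilon_spec (p := IsFormalAdjoint g (smoothTensors n M p) (smoothTensors n M (p + 1))
    (nabla g)) ⟨_, isFormalAdjoint_neg_divergence hg⟩

theorem isFormalAdjoint_symNablaStar (hg : IsRiemannian g) :
    IsFormalAdjoint g (smoothSymmTensors n M p) (smoothSymmTensors n M (p + 1)) (symNabla g)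
      (symNablaStar g) :=
  Classical.epsilon_spec (p := IsFormalAdjoint g (smoothSymmTensors n M p)
    (smoothSymmTensors n M (p + 1)) (symNabla g)) ⟨_, isFormalAdjoint_neg_smul_divergence hg⟩

theorem nablaStar_eq (hg : IsRiemannian g) {β : TensorField n M (p + 1)} (hβ : IsSmooth β) :
    nablaStar g β = (-1 : ℝ) • divergence g β :=
  IsFormalAdjoint.unique hg (fun _ h => h) (fun _ h _ h' => IsSmooth.sub h h')
    (fun _ hu _ h => IsSmooth.fsmul h hu) (isFormalAdjoint_nablaStar hg)
    (isFormalAdjoint_neg_divergence hg) hβ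

theorem symNablaStar_eq (hg : IsRiemannian g) {β : TensorField n M (p + 1)} (hβ : IsSmooth β)
    (hβs : IsSymm β) : symNablaStar g β = (-(p + 1) : ℝ) • divergence g β :=
  IsFormalAdjoint.unique (A := smoothSymmTensors n M p) hg (fun _ h => h.1)
    (fun _ h _ h' => ⟨h.1.sub h'.1, IsSymm.sub h.2 h'.2⟩)
    (fun u hu _ h => ⟨h.1.fsmul hu, IsSymm.fsmul h.2 u⟩) (isFormalAdjoint_symNablaStar hg)
    (isFormalAdjoint_neg_smul_divergence hg) ⟨hβ, hβs⟩

end BakryEmery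

namespace BakryEmery

variable {n : ℕ} {M : Type*} [TopologicalSpace M] [ChartedSpace (Coord n) M] {p q : ℕ}
  {e e' : OpenPartialHomeomorph M (Coord n)} {g : TensorField n M 2}

theorem nabla_sub_smul {α β : TensorField n M p} (hα : IsSmooth α) (hβ : IsSmooth β) (c : ℝ) :
    nabla g (α - c • β) = nabla g α - c • nabla g β := by
  funext x
  have hd : ∀ {α : TensorField n M p}, IsSmooth α → ∀ I,
      DifferentiableAt ℝ (tcomp α (chartAt (Coord n) x) I) (chartAt (Coord n) x x) := fun h I =>
    ((h _ (chart_mem_atlas _ x) I).contDiffAt ((chartAt (Coord n) x).open_target.mem_nhds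
      (mem_chart_target _ x))).differentiableAt (by simp)
  have h1 : ∀ I, tcomp (α - c • β) (chartAt (Coord n) x) I = fun y =>
      tcomp α (chartAt (Coord n) x) I y - c * tcomp β (chartAt (Coord n) x) I y := fun _ => rfl
  have h2 : ∀ I, nablaComp g (α - c • β) (chartAt (Coord n) x) I (chartAt (Coord n) x x) =
      nablaComp g α (chartAt (Coord n) x) I (chartAt (Coord n) x x)
        - c * nablaComp g β (chartAt (Coord n) x) I (chartAt (Coord n) x x) := by
    intro I
    simp only [nablaComp, h1, pderiv]
    rw [fderiv_fun_sub (hd hα _) ((hd hβ _).const_mul c), fderiv_const_mul (hd hβ _)]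
    simp only [sub_apply, smul_apply, smul_eq_mul, mul_sub, Finset.sum_sub_distrib, Finset.mul_sum,
      mul_left_comm c]
    ring
  ext v
  change nabla g (α - c • β) x v = nabla g α x v - c * nabla g β x v
  simp only [nabla, ofComp_apply, h2, sub_mul, Finset.sum_sub_distrib, Finset.mul_sum, mul_assoc]

theorem traceFirst_sub_smul (α β : TensorField n M (p + 2)) (c : ℝ) :
    traceFirst g (α - c • β) = traceFirst g α - c • traceFirst g β := by
  funext x
  have h1 : ∀ I y, tcomp (α - c • β) (chartAt (Coord n) x) I y =
      tcomp α (chartAt (Coord n) x) I y - c * tcomp β (chartAt (Coord n) x) I y := fun _ _ => rfl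
  ext v
  change traceFirst g (α - c • β) x v = traceFirst g α x v - c * traceFirst g β x v
  simp only [traceFirst, ofComp_apply, h1, mul_sub, Finset.sum_sub_distrib, sub_mul,
    Finset.mul_sum, Finset.sum_mul, mul_assoc, mul_left_comm c]

theorem divergence_sub_smul {α β : TensorField n M (p + 1)} (hα : IsSmooth α) (hβ : IsSmooth β)
    (c : ℝ) : divergence g (α - c • β) = divergence g α - c • divergence g β := by
  rw [divergence, nabla_sub_smul hα hβ, traceFirst_sub_smul]
  rfl

variable [IsManifold (𝓡 n) ∞ M]

theorem tcomp_of_eq_ofComp {β : TensorField n M p} {x : M} {c : (Fin p → Fin n) → ℝ}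
    (h : β x = ofComp x c) (I : Fin p → Fin n) :
    tcomp β (chartAt (Coord n) x) I (chartAt (Coord n) x x) = c I := by
  rw [← pull_apply_stdVec, pull_ofComp h, sum_smul_stdTensor_apply_stdVec]

theorem tcomp_bakryEmeryRicci (Ω : VolumeForm n M) (g : TensorField n M 2) (x : M)
    (I : Fin 2 → Fin n) :
    tcomp (bakryEmeryRicci Ω g) (chartAt (Coord n) x) I (chartAt (Coord n) x x) =
      ∑ l, riemannComp g (chartAt (Coord n) x) l l (I 0) (I 1) (chartAt (Coord n) x x)
        + nablaComp g (differential (potential Ω g)) (chartAt (Coord n) x) I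
          (chartAt (Coord n) x x) := by
  rw [← tcomp_of_eq_ofComp (β := ricci g) rfl I, ← tcomp_of_eq_ofComp
    (β := nabla g (differential (potential Ω g))) rfl I]
  rfl

section Family
variable {J : Set ℝ} {g : ℝ → TensorField n M 2} {t : ℝ} (hJ : IsOpen J)
  (hg : ∀ t ∈ J, IsRiemannian (g t)) (hsmooth : IsSmoothFamily J g) (ht : t ∈ J)
include hJ hg hsmooth ht

theorem hasDerivAt_tcomp_bakryEmeryRicci (Ω : VolumeForm n M) (x : M) (I : Fin 2 → Fin n) :
    HasDerivAt (fun s => tcomp (bakryEmeryRicci Ω (g s)) (chartAt (Coord n) x) I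
        (chartAt (Coord n) x x))
      (2⁻¹ * (Real.exp (potential Ω (g t) x) * tcomp (divergence (g t)
        (fsmul (fun x => Real.exp (-potential Ω (g t) x)) (opD (g t) (timeDeriv g t))))
          (chartAt (Coord n) x) I (chartAt (Coord n) x x))) t := by
  have he := chart_mem_atlas (Coord n) x
  have hy := mem_chart_target (Coord n) x
  have hI : I = ![I 0, I 1] := by
    funext k
    fin_cases k <;> rfl
  have h := hasDerivAt_ricci_add_hessian hJ hg hsmooth ht he Ω hy (I 0) (I 1)
  have h2 := tcomp_divergence_fsmul_opD hJ hg hsmooth ht he Ω hy (I 0) (I 1)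
  rw [← hI, (chartAt (Coord n) x).left_inv (mem_chart_source _ x)] at h2
  rw [← hI] at h
  simp only [tcomp_bakryEmeryRicci]
  convert h using 1
  rw [h2, Real.exp_neg]
  field_simp

theorem differentiableAt_bakryEmeryRicci (Ω : VolumeForm n M) (x : M)
    (v : Fin 2 → TangentSpace (𝓡 n) x) :
    DifferentiableAt ℝ (fun s => bakryEmeryRicci Ω (g s) x v) t := by
  have key : ∀ s, bakryEmeryRicci Ω (g s) x v = _ := fun s =>
    (apply_eq_pull (chart_mem_atlas (Coord n) x) (mem_chart_source _ x) _ v).trans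
      (ModelTensor.apply_eq_sum _ _)
  rw [funext key]
  refine DifferentiableAt.fun_sum fun I _ => ?_
  exact (hasDerivAt_tcomp_bakryEmeryRicci hJ hg hsmooth ht Ω x I).differentiableAt.const_mul _

theorem two_smul_timeDeriv_bakryEmeryRicci (Ω : VolumeForm n M) :
    (2 : ℝ) • timeDeriv (fun s => bakryEmeryRicci Ω (g s)) t =
      fsmul (fun x => Real.exp (potential Ω (g t) x)) (divergence (g t)
        (fsmul (fun x => Real.exp (-potential Ω (g t) x)) (opD (g t) (timeDeriv g t)))) := by
  funext x
  refine eq_of_tcomp_eq fun I => ?_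
  have h1 : tcomp (timeDeriv (fun s => bakryEmeryRicci Ω (g s)) t) (chartAt (Coord n) x) I
      (chartAt (Coord n) x x) = _ := (tcomp_of_eq_ofComp
    (β := timeDeriv (fun s => bakryEmeryRicci Ω (g s)) t) rfl I).trans
    (hasDerivAt_tcomp_bakryEmeryRicci hJ hg hsmooth ht Ω x I).deriv
  rw [tcomp_fsmul_chartAt]
  refine (congrArg (fun r : ℝ => 2 * r) h1).trans ?_
  ring

theorem isSymm_timeDeriv : IsSymm (timeDeriv g t) := by
  refine isSymm_of_tcomp fun x I σ => ?_
  have hI : ∀ I : Fin 2 → Fin n, I = ![I 0, I 1] := fun I => by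
    funext k
    fin_cases k <;> rfl
  have hσ : σ = 1 ∨ σ = Equiv.swap 0 1 := by
    revert σ
    decide
  rcases hσ with rfl | rfl
  · rfl
  · rw [hI I, hI fun k => ![I 0, I 1] (Equiv.swap 0 1 k)]
    exact tcomp_timeDeriv_symm hJ hg hsmooth ht (chart_mem_atlas _ x) (mem_chart_target _ x) _ _

end Family

end BakryEmery

open BakryEmery
theorem mainTheorem7 {n : ℕ} {M : Type*} [TopologicalSpace M] [T2Space M]
    [SecondCountableTopology M] [ChartedSpace (Coord n) M] [IsManifold (𝓡 n) ∞ M]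
    [MeasurableSpace M] [BorelSpace M]
    (Ω : VolumeForm n M) (J : Set ℝ) (hJ : IsOpen J) (g : ℝ → TensorField n M 2)
    (hg : ∀ t ∈ J, IsRiemannian (g t)) (hsmooth : IsSmoothFamily J g) :
    ∀ t ∈ J,
      (∀ (x : M) (v : Fin 2 → TangentSpace (𝓡 n) x),
        DifferentiableAt ℝ (fun s => bakryEmeryRicci Ω (g s) x v) t) ∧
      (2 : ℝ) • timeDeriv (fun s => bakryEmeryRicci Ω (g s)) t =
        fsmul (fun x => Real.exp (potential Ω (g t) x))
          (divergence (g t)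
            (fsmul (fun x => Real.exp (-potential Ω (g t) x))
              (opD (g t) (timeDeriv g t)))) ∧
      IsFormalAdjoint (g t) (smoothTensors n M 2) (smoothTensors n M 3)
        (nabla (g t)) (nablaStar (g t)) ∧
      IsFormalAdjoint (g t) (smoothSymmTensors n M 2) (smoothSymmTensors n M 3)
        (symNabla (g t)) (symNablaStar (g t)) ∧
      timeDeriv (fun s => bakryEmeryRicci Ω (g s)) t =
        weighted Ω (g t) (nablaStar (g t)) (nabla (g t) (timeDeriv g t))
          - (1 / 6 : ℝ) • weighted Ω (g t) (symNablaStar (g t))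
              (symNabla (g t) (timeDeriv g t)) := by
  intro t ht
  have hgt := hg t ht
  have hderiv := two_smul_timeDeriv_bakryEmeryRicci hJ hg hsmooth ht Ω
  refine ⟨differentiableAt_bakryEmeryRicci hJ hg hsmooth ht Ω, hderiv,
    isFormalAdjoint_nablaStar hgt, isFormalAdjoint_symNablaStar hgt, ?_⟩
  have hh := hsmooth.isSmooth_timeDeriv hJ ht
  have hhs := isSymm_timeDeriv hJ hg hsmooth ht
  have hu : IsSmoothFun n fun x => Real.exp (-potential Ω (g t) x) := fun e he =>
    (isSmoothFun_potential hgt Ω e he).neg.exp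
  have h1 := (hh.nabla hgt).fsmul hu
  have h2 := (hh.symNabla hgt).fsmul hu
  have hD : fsmul (fun x => Real.exp (-potential Ω (g t) x)) (opD (g t) (timeDeriv g t)) =
      fsmul (fun x => Real.exp (-potential Ω (g t) x)) (symNabla (g t) (timeDeriv g t))
        - (2 : ℝ) • fsmul (fun x => Real.exp (-potential Ω (g t) x))
          (nabla (g t) (timeDeriv g t)) := by
    funext x
    ext v
    change Real.exp (-potential Ω (g t) x) * (symNabla (g t) (timeDeriv g t) x v
      - 2 * nabla (g t) (timeDeriv g t) x v) =
      Real.exp (-potential Ω (g t) x) * symNabla (g t) (timeDeriv g t) x v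
        - 2 * (Real.exp (-potential Ω (g t) x) * nabla (g t) (timeDeriv g t) x v)
    ring
  rw [hD, divergence_sub_smul h2 h1] at hderiv
  set A := divergence (g t) (fsmul (fun x => Real.exp (-potential Ω (g t) x))
    (nabla (g t) (timeDeriv g t)))
  set B := divergence (g t) (fsmul (fun x => Real.exp (-potential Ω (g t) x))
    (symNabla (g t) (timeDeriv g t)))
  rw [weighted, weighted, nablaStar_eq hgt h1,
    symNablaStar_eq hgt h2 ((hhs.symNabla hgt hh).fsmul _)]
  funext x
  ext v
  have hx : 2 * timeDeriv (fun s => bakryEmeryRicci Ω (g s)) t x v = _ :=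
    congrArg (fun T : TensorField n M 2 => T x v) hderiv
  refine mul_left_cancel₀ (two_ne_zero' ℝ) (hx.trans ?_)
  change Real.exp (potential Ω (g t) x) * (B x v - 2 * A x v) =
    2 * (Real.exp (potential Ω (g t) x) * (-1 * A x v)
      - 1 / 6 * (Real.exp (potential Ω (g t) x) * (-(((2 : ℕ) : ℝ) + 1) * B x v)))
  push_cast
  ring
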